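/- Let $X$ be a Dedekind scheme, i.e. a scheme that has a finite affine open cover by spectra of Dedekind domains. Let $G$ be a flat, affine group scheme of finite type over $X$, let $V$ be a locally free $\mathcal{O}_X$-module of finite rank with a linear action of $G$, and suppose that the corresponding homomorphism $G\to GL(V)$ of group schemes over $X$ is a closed immersion. A tensorial construction $t$ is a finite iteration of the operations $\otimes$, $\bigwedge^i$, $\mathrm{Sym}^j$, $\oplus$ and $(\cdot)^*$ (dual); $GL(V)$ acts on $t(V)$ by functoriality. A submodule $L\subset t(V)$ is a locally split line bundle if it is a line bundle and, Zariski locally on $X$, a direct summand of $t(V)$. Then there are a tensorial construction $t(V)$ and a locally split line bundle $L\subset t(V)$ such that \[ G=\{g\in GL(V)\mid gL=L\} \] as subgroup functors of $GL(V)$: for every ring $R$ and every $x\colon \operatorname{Spec}R\to X$ that factors through an affine open subset of $X$, an element $g\in GL(V)(R)=\operatorname{Aut}_R(x^*V)$ lies in the image of $G(R)$ if and only if $g(x^*L)=x^*L$ in $t(x^*V)=x^*t(V)$. -/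

import Mathlib

open CategoryTheory AlgebraicGeometry Opposite TensorProduct
open scoped MonObj

universe u

noncomputable section

namespace TensorialStabilizer

/-! ### Multilinear algebra: symmetric powers and base change maps -/

section Algebra

variable {A R : Type u} [CommRing A] [CommRing R] [Algebra A R]

/-- The `n`-th symmetric power of `M`: the degree `n` part of the symmetric algebra. -/
def symPow (R : Type u) [CommRing R] (n : ℕ) (M : Type u) [AddCommGroup M] [Module R M] :
    Submodule R (SymmetricAlgebra R M) :=
  LinearMap.range (SymmetricAlgebra.ι R M) ^ n

/-- A semilinear ring homomorphism between symmetric algebras that sends degree one into degree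
one sends degree `n` into degree `n`. -/
theorem symPow_map_mem {M N : Type u} [AddCommGroup M] [Module A M] [AddCommGroup N] [Module R N]
    (φ : SymmetricAlgebra A M →+* SymmetricAlgebra R N)
    (hφ : ∀ a : A, φ (algebraMap A _ a) = algebraMap R _ (algebraMap A R a))
    (h : ∀ m, φ (SymmetricAlgebra.ι A M m) ∈ LinearMap.range (SymmetricAlgebra.ι R N)) (n : ℕ)
    (x : SymmetricAlgebra A M) (hx : x ∈ symPow A n M) : φ x ∈ symPow R n N := by
  unfold symPow at hx ⊢
  induction n generalizing x with
  | zero =>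
    rw [pow_zero, Submodule.mem_one] at hx ⊢
    obtain ⟨a, rfl⟩ := hx
    exact ⟨algebraMap A R a, (hφ a).symm⟩
  | succ n ih =>
    rw [pow_succ] at hx ⊢
    induction hx using Submodule.mul_induction_on' with
    | mem_mul_mem y hy z hz =>
      obtain ⟨m, rfl⟩ := hz
      rw [map_mul]
      exact Submodule.mul_mem_mul (ih y hy) (h m)
    | add y _ z _ hy hz =>
      rw [map_add]
      exact add_mem hy hz

/-- The map `Symⁿ f : Symⁿ M → Symⁿ N` induced by a linear map `f : M → N`. -/
def symPowMap (n : ℕ) {M N : Type u} [AddCommGroup M] [Module R M]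
    [AddCommGroup N] [Module R N] (f : M →ₗ[R] N) : symPow R n M →ₗ[R] symPow R n N :=
  (SymmetricAlgebra.lift (SymmetricAlgebra.ι R N ∘ₗ f)).toLinearMap.restrict
    (symPow_map_mem (SymmetricAlgebra.lift (SymmetricAlgebra.ι R N ∘ₗ f)).toRingHom
      (fun a ↦ by simp) (fun m ↦ ⟨f m, by simp⟩) n)

theorem symPowMap_id (n : ℕ) {M : Type u} [AddCommGroup M] [Module R M] :
    symPowMap n (LinearMap.id : M →ₗ[R] M) = LinearMap.id := by
  ext x
  simp [symPowMap]

theorem symPowMap_comp (n : ℕ) {M N P : Type u} [AddCommGroup M] [Module R M]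
    [AddCommGroup N] [Module R N] [AddCommGroup P] [Module R P] (g : N →ₗ[R] P) (f : M →ₗ[R] N) :
    symPowMap n (g ∘ₗ f) = symPowMap n g ∘ₗ symPowMap n f := by
  ext x
  have : SymmetricAlgebra.lift (SymmetricAlgebra.ι R P ∘ₗ (g ∘ₗ f)) =
      (SymmetricAlgebra.lift (SymmetricAlgebra.ι R P ∘ₗ g)).comp
        (SymmetricAlgebra.lift (SymmetricAlgebra.ι R N ∘ₗ f)) := by
    ext m
    simp
  exact congrArg (fun φ : SymmetricAlgebra R M →ₐ[R] SymmetricAlgebra R P ↦ φ x.1) this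

/-- The isomorphism `Symⁿ M → Symⁿ N` induced by an isomorphism `M → N`. -/
def symPowCongr (n : ℕ) {M N : Type u} [AddCommGroup M] [Module R M]
    [AddCommGroup N] [Module R N] (e : M ≃ₗ[R] N) : symPow R n M ≃ₗ[R] symPow R n N :=
  LinearEquiv.ofLinearMap (symPowMap n e.toLinearMap) (symPowMap n e.symm.toLinearMap)
    (by rw [← symPowMap_comp]; simp [symPowMap_id])
    (by rw [← symPowMap_comp]; simp [symPowMap_id])

/-- The isomorphism `⋀ⁿ M → ⋀ⁿ N` induced by an isomorphism `M → N`. -/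
def extPowCongr (n : ℕ) {M N : Type u} [AddCommGroup M] [Module R M]
    [AddCommGroup N] [Module R N] (e : M ≃ₗ[R] N) : ⋀[R]^n M ≃ₗ[R] ⋀[R]^n N :=
  LinearEquiv.ofLinearMap (exteriorPower.map n e.toLinearMap) (exteriorPower.map n e.symm.toLinearMap)
    (by rw [← exteriorPower.map_comp]; simp [exteriorPower.map_id])
    (by rw [← exteriorPower.map_comp]; simp [exteriorPower.map_id])

/-- The `R`-linear map `R ⊗ M → P`, `r ⊗ m ↦ r • f m`, given by a semilinear map `f : M → P`. -/
def liftBC {M P : Type u} [AddCommGroup M] [Module A M] [AddCommGroup P] [Module R P]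
    (f : M →ₛₗ[algebraMap A R] P) : R ⊗[A] M →ₗ[R] P :=
  letI : Module A P := Module.compHom P (algebraMap A R)
  haveI : IsScalarTower A R P :=
    ⟨fun a r p ↦ by rw [Algebra.smul_def, mul_smul]; rfl⟩
  LinearMap.liftBaseChange R
    { toFun := f, map_add' := map_add f, map_smul' := fun a m ↦ f.map_smulₛₗ a m }

@[simp]
theorem liftBC_tmul {M P : Type u} [AddCommGroup M] [Module A M] [AddCommGroup P] [Module R P]
    (f : M →ₛₗ[algebraMap A R] P) (r : R) (m : M) : liftBC f (r ⊗ₜ[A] m) = r • f m := rfl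

/-- The semilinear map `Symⁿ M → Symⁿ (R ⊗ M)`, `m₁ ⋯ mₙ ↦ (1 ⊗ m₁) ⋯ (1 ⊗ mₙ)`. -/
def symPowToBC (R : Type u) [CommRing R] [Algebra A R] (n : ℕ) (M : Type u) [AddCommGroup M]
    [Module A M] : symPow A n M →ₛₗ[algebraMap A R] symPow R n (R ⊗[A] M) :=
  letI : Algebra A (SymmetricAlgebra R (R ⊗[A] M)) :=
    ((algebraMap R (SymmetricAlgebra R (R ⊗[A] M))).comp (algebraMap A R)).toAlgebra
  let f : M →ₗ[A] SymmetricAlgebra R (R ⊗[A] M) :=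
    { toFun := fun m ↦ SymmetricAlgebra.ι R (R ⊗[A] M) (1 ⊗ₜ m)
      map_add' := fun x y ↦ by rw [tmul_add, map_add]
      map_smul' := fun a x ↦ by
        rw [tmul_smul, ← algebraMap_smul R a ((1 : R) ⊗ₜ[A] x), map_smul, Algebra.smul_def]
        exact (Algebra.smul_def a _).symm }
  let φ : SymmetricAlgebra A M →ₐ[A] SymmetricAlgebra R (R ⊗[A] M) := SymmetricAlgebra.lift f
  { toFun := fun x ↦ ⟨φ x, symPow_map_mem φ.toRingHom (fun a ↦ φ.commutes a)
      (fun m ↦ ⟨1 ⊗ₜ m, (SymmetricAlgebra.lift_ι_apply f m).symm⟩) n x x.2⟩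
    map_add' := fun x y ↦ Subtype.ext (map_add φ _ _)
    map_smul' := fun a x ↦ Subtype.ext ((map_smul φ a x.1).trans
      ((Algebra.smul_def a (φ x.1)).trans (Algebra.smul_def (algebraMap A R a) (φ x.1)).symm)) }

/-- The semilinear map `⋀ⁿ M → ⋀ⁿ (R ⊗ M)`, `m₁ ∧ ⋯ ∧ mₙ ↦ (1 ⊗ m₁) ∧ ⋯ ∧ (1 ⊗ mₙ)`. -/
def extPowToBC (R : Type u) [CommRing R] [Algebra A R] (n : ℕ) (M : Type u) [AddCommGroup M]
    [Module A M] : ⋀[A]^n M →ₛₗ[algebraMap A R] ⋀[R]^n (R ⊗[A] M) :=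
  letI : Module A (⋀[R]^n (R ⊗[A] M)) := Module.compHom _ (algebraMap A R)
  let α : M [⋀^Fin n]→ₗ[A] ⋀[R]^n (R ⊗[A] M) :=
    { toFun := fun v ↦ exteriorPower.ιMulti R n (fun i ↦ (1 : R) ⊗ₜ[A] v i)
      map_update_add' := fun v i x y ↦ by
        have h (z : M) : (fun j ↦ (1 : R) ⊗ₜ[A] Function.update v i z j) =
            Function.update (fun j ↦ (1 : R) ⊗ₜ[A] v j) i (1 ⊗ₜ z) :=
          (Function.comp_update (fun m ↦ (1 : R) ⊗ₜ[A] m) v i z)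
        rw [h, h, h, tmul_add, AlternatingMap.map_update_add]
      map_update_smul' := fun v i a x ↦ by
        have h (z : M) : (fun j ↦ (1 : R) ⊗ₜ[A] Function.update v i z j) =
            Function.update (fun j ↦ (1 : R) ⊗ₜ[A] v j) i (1 ⊗ₜ z) :=
          (Function.comp_update (fun m ↦ (1 : R) ⊗ₜ[A] m) v i z)
        rw [h, h, tmul_smul, ← algebraMap_smul R a ((1 : R) ⊗ₜ[A] x),
          AlternatingMap.map_update_smul]
        rfl
      map_eq_zero_of_eq' := fun v i j hv hij ↦
        AlternatingMap.map_eq_zero_of_eq _ _ (by rw [hv]) hij }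
  let f := exteriorPower.alternatingMapLinearEquiv α
  { toFun := f, map_add' := map_add f, map_smul' := fun a x ↦ map_smul f a x }

end Algebra

/-! ### Tensorial constructions -/

/-- A tensorial construction: a finite iteration of the operations `⊗`, `⋀ⁱ`, `Symʲ`, `⊕` and
dual, starting from one variable. -/
inductive TensorialConstruction : Type
  | var : TensorialConstruction
  | tensor (s t : TensorialConstruction) : TensorialConstruction
  | ext (i : ℕ) (t : TensorialConstruction) : TensorialConstruction
  | sym (j : ℕ) (t : TensorialConstruction) : TensorialConstruction
  | sum (s t : TensorialConstruction) : TensorialConstruction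
  | dual (t : TensorialConstruction) : TensorialConstruction

namespace TensorialConstruction

/-- The `R`-module `t(M)`. -/
def obj {R : Type u} [CommRing R] : TensorialConstruction → ModuleCat.{u} R → ModuleCat.{u} R
  | var, M => M
  | tensor s t, M => ModuleCat.of R (s.obj M ⊗[R] t.obj M)
  | ext i t, M => ModuleCat.of R (⋀[R]^i (t.obj M))
  | sym j t, M => ModuleCat.of R (symPow R j (t.obj M))
  | sum s t, M => ModuleCat.of R (s.obj M × t.obj M)
  | dual t, M => ModuleCat.of R (Module.Dual R (t.obj M))

/-- The isomorphism `t(e) : t(M) → t(N)` induced by an isomorphism `e : M → N`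
(on duals: the inverse of the transpose). -/
def congr {R : Type u} [CommRing R] {M N : ModuleCat.{u} R} (e : M ≃ₗ[R] N) :
    ∀ t : TensorialConstruction, t.obj M ≃ₗ[R] t.obj N
  | var => e
  | tensor s t => TensorProduct.congr (congr e s) (congr e t)
  | ext i t => extPowCongr i (congr e t)
  | sym j t => symPowCongr j (congr e t)
  | sum s t => (congr e s).prodCongr (congr e t)
  | dual t => (congr e t).symm.dualMap

theorem congr_mul {R : Type u} [CommRing R] {M : ModuleCat.{u} R} (t : TensorialConstruction)
    (e f : M ≃ₗ[R] M) : congr (e * f) t = congr e t * congr f t := by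
  induction t with
  | var => rfl
  | tensor s t hs ht =>
    apply LinearEquiv.toLinearMap_injective
    apply TensorProduct.ext'
    intro x y
    change congr (e * f) s x ⊗ₜ[R] congr (e * f) t y = _
    rw [hs, ht]
    rfl
  | ext i t ht =>
    apply LinearEquiv.toLinearMap_injective
    change exteriorPower.map i (congr (e * f) t).toLinearMap = _ ∘ₗ _
    rw [ht]
    exact exteriorPower.map_comp _ _
  | sym j t ht =>
    apply LinearEquiv.toLinearMap_injective
    change symPowMap j (congr (e * f) t).toLinearMap = _ ∘ₗ _
    rw [ht]
    exact symPowMap_comp j _ _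
  | sum s t hs ht =>
    apply LinearEquiv.ext
    intro x
    change (congr (e * f) s x.1, congr (e * f) t x.2) = _
    rw [hs, ht]
    rfl
  | dual t ht =>
    apply LinearEquiv.ext
    intro x
    change (congr (e * f) t).symm.dualMap x = _
    rw [ht]
    rfl

/-- The natural representation of `GL(M)` on `t(M)`. -/
def action {R : Type u} [CommRing R] (t : TensorialConstruction) (M : ModuleCat.{u} R) :
    (M ≃ₗ[R] M) →* (t.obj M ≃ₗ[R] t.obj M) :=
  MonoidHom.mk' (fun e ↦ congr e t) (congr_mul t)

open Classical in
/-- The canonical base change map `R ⊗ t(M) → t(R ⊗ M)`. For a dual it is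
`R ⊗ P* → (R ⊗ P)*` followed by the inverse transpose of the base change map of `P = t(M)`;
if `M` is finitely generated projective (the only case of interest), all these maps are
isomorphisms, so that the value `0` does not occur. -/
def baseChange {A : Type u} [CommRing A] (R : Type u) [CommRing R] [Algebra A R]
    (M : ModuleCat.{u} A) :
    ∀ t : TensorialConstruction, R ⊗[A] t.obj M →ₗ[R] t.obj (ModuleCat.of R (R ⊗[A] M))
  | var => LinearMap.id
  | tensor s t =>
    TensorProduct.map (baseChange R M s) (baseChange R M t) ∘ₗ
      (AlgebraTensorModule.distribBaseChange A R (s.obj M) (t.obj M)).toLinearMap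
  | ext i t => exteriorPower.map i (baseChange R M t) ∘ₗ liftBC (extPowToBC R i (t.obj M))
  | sym j t => symPowMap j (baseChange R M t) ∘ₗ liftBC (symPowToBC R j (t.obj M))
  | sum s t =>
    LinearMap.prodMap (baseChange R M s) (baseChange R M t) ∘ₗ
      (TensorProduct.prodRight A R R (s.obj M) (t.obj M)).toLinearMap
  | dual t =>
    if h : Function.Bijective (baseChange R M t) then
      (LinearEquiv.ofBijective (baseChange R M t) h).symm.dualMap.toLinearMap.comp
        (LinearMap.liftBaseChange R (Module.Dual.baseChange R (R := A) (V := t.obj M)))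
    else 0

end TensorialConstruction

/-! ### Vector bundles and line subbundles on a scheme -/

variable {X : Scheme.{u}}

/-- A Dedekind scheme: a scheme with a finite affine open cover by spectra of Dedekind domains. -/
def IsDedekindScheme (X : Scheme.{u}) : Prop :=
  ∃ s : Set X.affineOpens, s.Finite ∧ (⨆ U ∈ s, (U : X.Opens)) = ⊤ ∧
    ∀ U ∈ s, IsDedekindDomain Γ(X, U)

/-- A locally free `𝒪_X`-module of finite rank: a quasi-coherent module `V` such that every point
has an affine open neighbourhood `U` on which `V` is free of finite rank. -/
structure IsVectorBundle (V : X.Modules) : Prop where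
  isQuasicoherent : V.IsQuasicoherent
  locally_free : ∀ x : X, ∃ U : X.affineOpens, x ∈ (U : X.Opens) ∧
    Module.Free Γ(X, U) Γ(V, U) ∧ Module.Finite Γ(X, U) Γ(V, U)

/-- The `Γ(X, U)`-module of sections of `V` over an affine open `U`. -/
abbrev sections (V : X.Modules) (U : X.affineOpens) : ModuleCat.{u} Γ(X, U) :=
  ModuleCat.of Γ(X, U) Γ(V, U)

/-- Restriction of functions. -/
abbrev resRing {U U' : X.affineOpens} (h : U' ≤ U) : Γ(X, U) →+* Γ(X, U') :=
  (X.presheaf.map (homOfLE h).op).hom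

/-- Restriction of sections. -/
abbrev resSections (V : X.Modules) {U U' : X.affineOpens} (h : U' ≤ U) :
    Γ(V, U) →+ Γ(V, U') :=
  (V.presheaf.map (homOfLE h).op).hom

/-- The `Spec R`-valued point of `X` given by an affine open `U` and a `Γ(X, U)`-algebra `R`. -/
def pt (U : X.affineOpens) (R : Type u) [CommRing R] [Algebra Γ(X, U) R] :
    Spec (CommRingCat.of R) ⟶ X :=
  Spec.map (CommRingCat.ofHom (algebraMap Γ(X, U) R)) ≫ U.2.fromSpec

/-- The pullback of `V` to `Spec R`, as an `R`-module. -/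
abbrev fiber (V : X.Modules) (U : X.affineOpens) (R : Type u) [CommRing R] [Algebra Γ(X, U) R] :
    ModuleCat.{u} R :=
  ModuleCat.of R (R ⊗[Γ(X, U)] Γ(V, U))

/-- The `R`-valued points of the group scheme `GL(V)`. -/
abbrev GLPoints (V : X.Modules) (U : X.affineOpens) (R : Type u) [CommRing R]
    [Algebra Γ(X, U) R] : Type u :=
  fiber V U R ≃ₗ[R] fiber V U R

/-- The transition map `R ⊗ Γ(V, U) → R' ⊗ Γ(V, U')`, `r ⊗ m ↦ φ r ⊗ m|_{U'}`, for `U' ⊆ U` and a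
ring homomorphism `φ : R → R'` over `Γ(X, U) → Γ(X, U')`. -/
def transition (V : X.Modules) {U U' : X.affineOpens} (h : U' ≤ U)
    {R R' : Type u} [CommRing R] [CommRing R'] [Algebra Γ(X, U) R] [Algebra Γ(X, U') R']
    (φ : R →+* R')
    (hφ : φ.comp (algebraMap Γ(X, U) R) = (algebraMap Γ(X, U') R').comp (resRing h)) :
    fiber V U R →+ fiber V U' R' :=
  TensorProduct.liftAddHom
    { toFun := fun r ↦
        { toFun := fun m ↦ φ r ⊗ₜ[Γ(X, U')] resSections V h m
          map_zero' := by rw [map_zero, tmul_zero]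
          map_add' := fun x y ↦ by rw [map_add, tmul_add] }
      map_zero' := by
        ext m
        simp
      map_add' := fun x y ↦ by
        ext m
        simp [add_tmul] }
    (fun a r m ↦ by
      have h1 : resSections V h (a • m) = resRing h a • resSections V h m := V.map_smul _ a m
      have h2 : φ (algebraMap Γ(X, U) R a) = algebraMap Γ(X, U') R' (resRing h a) :=
        RingHom.congr_fun hφ a
      change φ (a • r) ⊗ₜ[Γ(X, U')] resSections V h m = φ r ⊗ₜ[Γ(X, U')] resSections V h (a • m)
      rw [h1, tmul_smul, smul_tmul', Algebra.smul_def, Algebra.smul_def, map_mul, h2])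

/-- The image of `R ⊗ N` in `t(R ⊗ M)`, for a submodule `N ⊆ t(M)`. -/
def pullbackSub {A : Type u} [CommRing A] (R : Type u) [CommRing R] [Algebra A R]
    (t : TensorialConstruction) (M : ModuleCat.{u} A) (N : Submodule A (t.obj M)) :
    Submodule R (t.obj (ModuleCat.of R (R ⊗[A] M))) :=
  (N.baseChange R).map (t.baseChange R M)

/-- A locally split line bundle `L ⊆ t(V)`. As a quasi-coherent submodule of `t(V)`, it is given by
submodules `L(U) ⊆ t(V(U)) = t(V)(U)` for the affine opens `U`, compatible with restriction to the
basic opens `U' = D(f)` of `U`: the identification `𝒪(U') ⊗ V(U) ≃ V(U')` carries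
`𝒪(U') ⊗ L(U)` to `L(U')`. Locally on `X` it has to be free of rank one and a direct summand. -/
structure LocallySplitLineBundle (V : X.Modules) (t : TensorialConstruction) where
  /-- The sections over affine opens. -/
  sub : ∀ U : X.affineOpens, Submodule Γ(X, U) (t.obj (sections V U))
  restrict : ∀ (U U' : X.affineOpens) (h : U' ≤ U) (f : Γ(X, U)),
    (U' : X.Opens) = X.basicOpen f →
      letI : Algebra Γ(X, U) Γ(X, U') := (resRing h).toAlgebra
      ∃ e : fiber V U Γ(X, U') ≃ₗ[Γ(X, U')] sections V U',
        (∀ m : Γ(V, U), e (1 ⊗ₜ m) = resSections V h m) ∧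
        (pullbackSub Γ(X, U') t (sections V U) (sub U)).map (t.congr e).toLinearMap = sub U'
  locally_split : ∀ x : X, ∃ U : X.affineOpens, x ∈ (U : X.Opens) ∧
    Nonempty (sub U ≃ₗ[Γ(X, U)] Γ(X, U)) ∧ ∃ C : Submodule Γ(X, U) (t.obj (sections V U)),
      IsCompl (sub U) C

/-! ### Representations of group schemes -/

/-- A linear action of the `X`-group scheme `G` on the vector bundle `V`, that is a homomorphism
`G → GL(V)` of group functors over `X`, described on the points with values in affine schemes
that lie over an affine open of `X`. -/
structure LinearAction (G : Over X) [GrpObj G] (V : X.Modules) where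
  /-- The homomorphism on points. -/
  hom : ∀ (U : X.affineOpens) (R : Type u) [CommRing R] [Algebra Γ(X, U) R],
    (Over.mk (pt U R) ⟶ G) →* GLPoints V U R
  natural : ∀ (U U' : X.affineOpens) (h : U' ≤ U) (R R' : Type u) [CommRing R] [CommRing R']
    [Algebra Γ(X, U) R] [Algebra Γ(X, U') R'] (φ : R →+* R')
    (hφ : φ.comp (algebraMap Γ(X, U) R) = (algebraMap Γ(X, U') R').comp (resRing h))
    (g : Over.mk (pt U R) ⟶ G) (g' : Over.mk (pt U' R') ⟶ G),
    g'.left = Spec.map (CommRingCat.ofHom φ) ≫ g.left →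
      ∀ v : fiber V U R, transition V h φ hφ (hom U R g v) = hom U' R' g' (transition V h φ hφ v)

/-- The homomorphism `G → GL(V)` is a closed immersion: it is injective on points, and for every
point `g : Spec R → GL(V)` the fibre product `G ×_{GL(V)} Spec R` is a closed subscheme `V(I)` of
`Spec R`; that is, the base change `g'` of `g` along `φ : R → R'` comes from `G` if and only if
`φ` vanishes on `I`. -/
structure LinearAction.IsClosedImmersion {G : Over X} [GrpObj G] {V : X.Modules}
    (ρ : LinearAction G V) : Prop where
  injective : ∀ (U : X.affineOpens) (R : Type u) [CommRing R] [Algebra Γ(X, U) R],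
    Function.Injective (ρ.hom U R)
  closed : ∀ (U : X.affineOpens) (R : Type u) [CommRing R] [Algebra Γ(X, U) R]
    (g : GLPoints V U R), ∃ I : Ideal R,
      ∀ (R' : Type u) [CommRing R'] [Algebra Γ(X, U) R'] (φ : R →ₐ[Γ(X, U)] R')
        (g' : GLPoints V U R'),
        (∀ v : R ⊗[Γ(X, U)] Γ(V, U), g' (φ.toLinearMap.rTensor Γ(V, U) v) =
          φ.toLinearMap.rTensor Γ(V, U) (g v)) →
        (g' ∈ (ρ.hom U R').range ↔ ∀ a ∈ I, φ a = 0)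

end TensorialStabilizer

end

noncomputable section

namespace TensorialStabilizer

/-! ### Quasi-coherent modules localize on basic opens. -/

section Quasicoherent
variable {X : Scheme.{u}}

/-! Chevalley's argument, carried out over a Dedekind base. Only `⊗`, `⋀ⁱ` and `⊕` are needed. They
are functorial for semilinear maps and commute with every base change (`isBC_smap`), so submodules
of `t(V)` are transported by taking the span of their image (`push`).

Over an affine open `U` with noetherian ring of functions and `V` free, `G` is cut out of `GL_n` by
finitely many polynomials in the matrix entries (`exists_equations`). Each such polynomial `f` is a
matrix coefficient, `f(g) = l(g w)` with `w` a section of `t(V)` over `U` and `l` a linear form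
(`exists_matrixCoeff`). Let `S` be the submodule of `t(V)`, over all of `X`, of those sections `v`
with `l(g v) = 0` for all points `g` of `G`. Membership in `S` can be tested on finitely many
universal points of `G` (`exists_detectors`), which makes `S` quasi-coherent (`stableKer_push_res`).
Flatness of `G` makes it saturated (`stableKer_sat`) and `G`-stable (`stableKer_stable`). Over `U`,
it contains `w` because `f` vanishes on `G`, and it lies in the kernel of `l`. Hence `g` stabilizes
`S` only if `l(g w) = f(g) = 0` (`exists_stab_le_hypersurface`). Direct sums over the equations and
over a finite cover of `X` give one global stable `S` whose stabilizer over each member of the cover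
is `G`.

Over a Dedekind domain a saturated submodule of a finite module has a torsion-free, hence
projective, quotient, so `S` is locally a direct summand (`exists_retraction`). Its rank, which may
differ between components, becomes a constant `D` after adding copies of `⋀⁰ V = 𝒪` where it is too
small (`exists_constant_rank`). Then `L = ⋀ᴰ S` is a locally split line bundle. A split submodule is
recovered from its determinant line, so both have the same stabilizer
(`HasSplitBasis.map_le_of_detSub_map_le`). Since `G` is closed in `GL(V)`, membership of a point
over an arbitrary affine open can be checked locally, on the cover
(`StableSub.mem_GPts_of_extSub_le`). -/

theorem exists_eq_of_isQuasicoherent_Spec {R : CommRingCat.{u}} (M : (Spec R).Modules)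
    [M.IsQuasicoherent] (f : R) (D : (Spec R).Opens) (hD : D = PrimeSpectrum.basicOpen f) :
    (∀ y : Γ(M, D), ∃ (n : ℕ) (x : Γ(M, ⊤)),
      f ^ n • y = M.presheaf.map (homOfLE le_top).op x) ∧
    ∀ x : Γ(M, ⊤), M.presheaf.map (homOfLE (le_top : D ≤ ⊤)).op x = 0 →
      ∃ n : ℕ, f ^ n • x = 0 := by
  subst hD
  have h1 : IsIso M.fromTildeΓ := inferInstance
  have h2 := (isIso_fromTildeΓ_iff_isLocalizing M).1 h1 f
  refine ⟨fun y ↦ ?_, fun x hx ↦ ?_⟩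
  · obtain ⟨⟨x, ⟨_, n, rfl⟩⟩, h⟩ := h2.surj y
    exact ⟨n, x, h⟩
  · obtain ⟨⟨_, n, rfl⟩, h⟩ := h2.exists_of_eq (x₁ := x) (x₂ := 0) (by rw [map_zero]; exact hx)
    exact ⟨n, h.trans (smul_zero _)⟩

theorem appIso_fromSpec_inv {U : X.Opens} (hU : IsAffineOpen U) (W : (Spec Γ(X, U)).Opens)
    (f : Γ(X, U)) (h : hU.fromSpec ''ᵁ W ≤ U) :
    (hU.fromSpec.appIso W).inv ((Spec Γ(X, U)).presheaf.map W.leTop.op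
      ((Scheme.ΓSpecIso Γ(X, U)).inv f)) = X.presheaf.map (homOfLE h).op f := by
  have : (Scheme.ΓSpecIso Γ(X, U)).inv ≫ (Spec Γ(X, U)).presheaf.map W.leTop.op ≫
      (hU.fromSpec.appIso W).inv = X.presheaf.map (homOfLE h).op := by
    rw [← Category.assoc, Iso.comp_inv_eq, Scheme.Hom.appIso_hom', Scheme.Hom.map_appLE,
      Scheme.Hom.appLE, hU.fromSpec_app_of_le U le_rfl]
    simp [← Functor.map_comp]
    rfl
  exact congrArg (fun φ ↦ φ f) (congrArg (fun φ ↦ φ.hom) this)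

theorem smul_restrict_fromSpec (V : X.Modules) {U : X.Opens} (hU : IsAffineOpen U) (W : (Spec Γ(X, U)).Opens)
    (f : Γ(X, U)) (x : Γ(V.restrict hU.fromSpec, W)) 
    (h : hU.fromSpec ''ᵁ W ≤ U) :
    (Scheme.Modules.restrictAppIso hU.fromSpec V W).hom (f • x) = X.presheaf.map (homOfLE h).op f • (Scheme.Modules.restrictAppIso hU.fromSpec V W).hom x := by
  rw [Scheme.Modules.smul_Spec_def, ← appIso_fromSpec_inv]
  exact Scheme.Modules.smul_restrictAppIso_hom_apply hU.fromSpec V W _ x 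

/-- Transported from `Spec Γ(X, U)`, where a quasi-coherent module comes from its global sections.
The two halves are surjectivity and injectivity for the localization at `f`, in the form used by
`isBC_resMod`. -/
theorem exists_eq_of_isQuasicoherent (V : X.Modules) [V.IsQuasicoherent] {U : X.Opens}
    (hU : IsAffineOpen U) (f : Γ(X, U)) {D : X.Opens} (h : D ≤ U) (hD : D = X.basicOpen f) :
    (∀ y : Γ(V, D), ∃ (n : ℕ) (x : Γ(V, U)),
      X.presheaf.map (homOfLE h).op (f ^ n) • y = V.presheaf.map (homOfLE h).op x) ∧
    ∀ x : Γ(V, U), V.presheaf.map (homOfLE h).op x = 0 → ∃ n : ℕ, f ^ n • x = 0 := by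
  let i := hU.fromSpec
  have : (V.restrict i).IsQuasicoherent := Scheme.Modules.isQuasicoherent_restrictFunctor i V
  -- This equality of opens is only propositional, so sections are moved across it by restriction
  -- maps in both directions.
  have hT : i ''ᵁ ⊤ = U := by rw [Scheme.Hom.image_top_eq_opensRange, hU.opensRange_fromSpec]
  obtain ⟨D', hD'⟩ : ∃ D' : (Spec Γ(X, U)).Opens, D' = PrimeSpectrum.basicOpen f := ⟨_, rfl⟩
  have hDD : i ''ᵁ D' = D := by rw [hD', hD]; exact hU.fromSpec_image_basicOpen f
  obtain ⟨h1, h2⟩ := exists_eq_of_isQuasicoherent_Spec (V.restrict i) f D' hD'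
  subst hDD
  have hm {W W' W'' : X.Opens} (a : W' ≤ W) (b : W'' ≤ W') (x : Γ(V, W)) :
      V.presheaf.map (homOfLE b).op (V.presheaf.map (homOfLE a).op x) =
        V.presheaf.map (homOfLE (b.trans a)).op x := by
    rw [← ConcreteCategory.comp_apply, ← Functor.map_comp]
    rfl
  have hid {W : X.Opens} (x : Γ(V, W)) : V.presheaf.map (homOfLE (le_refl W)).op x = x := by
    have : (homOfLE (le_refl W)).op = 𝟙 (op W) := rfl
    rw [this, CategoryTheory.Functor.map_id]
    rfl
  refine ⟨fun y ↦ ?_, fun x hx ↦ ?_⟩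
  · obtain ⟨n, x, hx⟩ := h1 y
    refine ⟨n, V.presheaf.map (homOfLE hT.ge).op x, ?_⟩
    refine ((smul_restrict_fromSpec V hU D' (f ^ n) y h).symm.trans ?_).trans
      (hm hT.ge h x).symm
    exact hx
  · obtain ⟨n, hn⟩ := h2 (V.presheaf.map (homOfLE hT.le).op x) ((hm hT.le _ x).trans hx)
    refine ⟨n, ?_⟩
    have h3 := smul_restrict_fromSpec V hU ⊤ (f ^ n) (V.presheaf.map (homOfLE hT.le).op x) hT.le
    have h4 : X.presheaf.map (homOfLE hT.le).op (f ^ n) • V.presheaf.map (homOfLE hT.le).op x = 0 :=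
      h3.symm.trans hn
    rw [← Scheme.Modules.map_smul] at h4
    rw [← hid (f ^ n • x), ← hm hT.le hT.ge, h4, map_zero]
end Quasicoherent

/-! ### Semilinear maps that exhibit a base change. -/

section BaseChange

variable {A R : Type u} [CommRing A] [CommRing R] [Algebra A R]
variable {M N P : Type u} [AddCommGroup M] [Module A M] [AddCommGroup N] [Module R N]

/-- A semilinear map `M → N` exhibits `N` as the base change of `M`. -/
def IsBC (σ : M →ₛₗ[algebraMap A R] N) : Prop :=
  Function.Bijective (liftBC σ)

variable (R M) in
/-- The canonical map `M → R ⊗ M`. -/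
def inclBC : M →ₛₗ[algebraMap A R] R ⊗[A] M where
  toFun m := 1 ⊗ₜ m
  map_add' := tmul_add 1
  map_smul' a m := by rw [tmul_smul, ← algebraMap_smul R a ((1 : R) ⊗ₜ[A] m)]

@[simp]
theorem inclBC_apply (m : M) : inclBC R M m = (1 : R) ⊗ₜ[A] m := rfl

theorem liftBC_unique (f : R ⊗[A] M →ₗ[R] N) (σ : M →ₛₗ[algebraMap A R] N)
    (h : ∀ m, f (1 ⊗ₜ m) = σ m) : f = liftBC σ := by
  ext x
  induction x using TensorProduct.induction_on with
  | zero => simp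
  | tmul r m =>
    rw [liftBC_tmul, ← h, ← map_smul, smul_tmul', smul_eq_mul, mul_one]
  | add x y hx hy => rw [map_add, map_add, hx, hy]

theorem isBC_inclBC : IsBC (inclBC R M : M →ₛₗ[algebraMap A R] R ⊗[A] M) := by
  rw [IsBC, ← liftBC_unique LinearMap.id (inclBC R M) fun m ↦ rfl]
  exact Function.bijective_id

theorem span_range_inclBC : Submodule.span R (Set.range (inclBC R M : M → R ⊗[A] M)) = ⊤ := by
  rw [eq_top_iff]
  rintro x -
  induction x using TensorProduct.induction_on with
  | zero => exact zero_mem _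
  | tmul r m =>
    have : r ⊗ₜ[A] m = r • inclBC R M m := by
      rw [inclBC_apply, smul_tmul', smul_eq_mul, mul_one]
    rw [this]
    exact Submodule.smul_mem _ _ (Submodule.subset_span ⟨m, rfl⟩)
  | add x y hx hy => exact add_mem hx hy

namespace IsBC

variable {σ : M →ₛₗ[algebraMap A R] N}

/-- The isomorphism `R ⊗ M ≃ N` given by a base change map `M → N`. -/
def equiv (hσ : IsBC σ) : (R ⊗[A] M) ≃ₗ[R] N :=
  LinearEquiv.ofBijective (liftBC σ) hσ

@[simp]
theorem equiv_tmul (hσ : IsBC σ) (r : R) (m : M) : hσ.equiv (r ⊗ₜ m) = r • σ m := rfl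

theorem equiv_symm_apply (hσ : IsBC σ) (m : M) : hσ.equiv.symm (σ m) = 1 ⊗ₜ m := by
  rw [LinearEquiv.symm_apply_eq, equiv_tmul, one_smul]

theorem span_range (hσ : IsBC σ) : Submodule.span R (Set.range σ) = ⊤ := by
  have h : Set.range σ = hσ.equiv.toLinearMap '' Set.range (inclBC R M : M → R ⊗[A] M) := by
    rw [← Set.range_comp]
    congr 1
    ext m
    simp
  rw [h, Submodule.span_image, span_range_inclBC, Submodule.map_top, LinearEquiv.range]

theorem hom_ext (hσ : IsBC σ) {S : Type*} [CommRing S] {P : Type*} [AddCommGroup P] [Module S P] {ψ : R →+* S}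
    {f g : N →ₛₗ[ψ] P} (h : ∀ m, f (σ m) = g (σ m)) : f = g :=
  LinearMap.ext_on_range hσ.span_range h

/-- The linear map on a base change induced by a semilinear map. -/
def lift (hσ : IsBC σ) {P : Type u} [AddCommGroup P] [Module R P] (f : M →ₛₗ[algebraMap A R] P) :
    N →ₗ[R] P :=
  liftBC f ∘ₗ hσ.equiv.symm.toLinearMap

@[simp]
theorem lift_apply (hσ : IsBC σ) {P : Type u} [AddCommGroup P] [Module R P]
    (f : M →ₛₗ[algebraMap A R] P) (m : M) : hσ.lift f (σ m) = f m := by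
  change liftBC f (hσ.equiv.symm (σ m)) = f m
  rw [equiv_symm_apply, liftBC_tmul, one_smul]

/-- The algebra structure of `R` over itself is an arbitrary instance here, such as the one made
from an identity homomorphism. The identity of `M` is then semilinear, and its extension to `N` is a
left inverse of `σ`. -/
theorem injective_of_algebraMap_eq {R : Type u} [CommRing R] (alg : Algebra R R)
    (h : ∀ r : R, algebraMap R R r = r) {M N : Type u} [AddCommGroup M] [Module R M]
    [AddCommGroup N] [Module R N] {σ : M →ₛₗ[algebraMap R R] N} (hσ : IsBC σ) :
    Function.Injective σ := by
  let f : M →ₛₗ[algebraMap R R] M :=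
    { toFun := id
      map_add' := fun _ _ ↦ rfl
      map_smul' := fun r m ↦ by rw [h]; rfl }
  have hf (m : M) : hσ.lift f (σ m) = m := hσ.lift_apply f m
  exact Function.LeftInverse.injective hf

theorem of_equiv {N' : Type u} [AddCommGroup N'] [Module R N'] (hσ : IsBC σ) (e : N ≃ₗ[R] N')
    (σ' : M →ₛₗ[algebraMap A R] N') (h : ∀ m, σ' m = e (σ m)) : IsBC σ' := by
  have : liftBC σ' = e.toLinearMap ∘ₗ liftBC σ := by
    symm
    apply liftBC_unique
    intro m
    simp [h]
  rw [IsBC, this]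
  exact e.bijective.comp hσ

theorem comp {S : Type u} [CommRing S] [Algebra R S] [Algebra A S] [IsScalarTower A R S]
    (hσ : IsBC σ) [AddCommGroup P] [Module S P] {τ : N →ₛₗ[algebraMap R S] P}
    (hτ : IsBC τ) (ρ : M →ₛₗ[algebraMap A S] P) (h : ∀ m, ρ m = τ (σ m)) : IsBC ρ := by
  let e1 : S ⊗[A] M ≃ₗ[S] S ⊗[R] (R ⊗[A] M) :=
    (AlgebraTensorModule.cancelBaseChange A R S S M).symm
  let e2 : S ⊗[R] (R ⊗[A] M) ≃ₗ[S] S ⊗[R] N :=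
    AlgebraTensorModule.congr (LinearEquiv.refl S S) hσ.equiv
  have : liftBC ρ = (e1 ≪≫ₗ e2 ≪≫ₗ hτ.equiv).toLinearMap := by
    symm
    apply liftBC_unique
    intro m
    simp [e1, e2, h]
  rw [IsBC, this]
  exact LinearEquiv.bijective _

/-- Together with `comp` this is the two-out-of-three property, by cancellation of iterated base
changes. -/
theorem of_comp {S : Type u} [CommRing S] [Algebra R S] [Algebra A S] [IsScalarTower A R S]
    (hσ : IsBC σ) [AddCommGroup P] [Module S P] (τ : N →ₛₗ[algebraMap R S] P)
    {ρ : M →ₛₗ[algebraMap A S] P} (hρ : IsBC ρ) (h : ∀ m, ρ m = τ (σ m)) : IsBC τ := by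
  let e1 : S ⊗[A] M ≃ₗ[S] S ⊗[R] (R ⊗[A] M) :=
    (AlgebraTensorModule.cancelBaseChange A R S S M).symm
  let e2 : S ⊗[R] (R ⊗[A] M) ≃ₗ[S] S ⊗[R] N :=
    AlgebraTensorModule.congr (LinearEquiv.refl S S) hσ.equiv
  have h1 : liftBC τ ∘ₗ (e1 ≪≫ₗ e2).toLinearMap = hρ.equiv.toLinearMap := by
    rw [show hρ.equiv.toLinearMap = liftBC ρ from rfl]
    apply liftBC_unique
    intro m
    simp [e1, e2, h]
  have h2 : liftBC τ = ((e1 ≪≫ₗ e2).symm ≪≫ₗ hρ.equiv).toLinearMap := by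
    rw [LinearEquiv.coe_trans, ← h1]
    ext x
    simp
  rw [IsBC, h2]
  exact LinearEquiv.bijective _

theorem exists_equiv (hσ : IsBC σ) (g : M ≃ₗ[A] M) :
    ∃ g' : N ≃ₗ[R] N, ∀ m, g' (σ m) = σ (g m) := by
  let f (g : M ≃ₗ[A] M) : N →ₗ[R] N := hσ.lift (σ.comp g.toLinearMap)
  have hf (g : M ≃ₗ[A] M) (m : M) : f g (σ m) = σ (g m) := hσ.lift_apply _ m
  refine ⟨LinearEquiv.ofLinearMap (f g) (f g.symm) ?_ ?_, fun m ↦ hf g m⟩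
  · refine hσ.hom_ext fun m ↦ ?_
    simp [hf]
  · refine hσ.hom_ext fun m ↦ ?_
    simp [hf]

theorem prod {M' N' : Type u} [AddCommGroup M'] [Module A M'] [AddCommGroup N'] [Module R N']
    {σ' : M' →ₛₗ[algebraMap A R] N'} (hσ : IsBC σ) (hσ' : IsBC σ')
    (τ : M × M' →ₛₗ[algebraMap A R] N × N') (h : ∀ m, τ m = (σ m.1, σ' m.2)) : IsBC τ := by
  have : liftBC τ = (TensorProduct.prodRight A R R M M' ≪≫ₗ
      hσ.equiv.prodCongr hσ'.equiv).toLinearMap := by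
    symm
    apply liftBC_unique
    intro m
    simp [h]
  rw [IsBC, this]
  exact LinearEquiv.bijective _

theorem tensor {M' N' : Type u} [AddCommGroup M'] [Module A M'] [AddCommGroup N'] [Module R N']
    {σ' : M' →ₛₗ[algebraMap A R] N'} (hσ : IsBC σ) (hσ' : IsBC σ')
    (τ : M ⊗[A] M' →ₛₗ[algebraMap A R] N ⊗[R] N') (h : ∀ m m', τ (m ⊗ₜ m') = σ m ⊗ₜ σ' m') :
    IsBC τ := by
  have : liftBC τ = (AlgebraTensorModule.distribBaseChange A R M M' ≪≫ₗ
      TensorProduct.congr hσ.equiv hσ'.equiv).toLinearMap := by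
    symm
    apply liftBC_unique
    intro m
    induction m using TensorProduct.induction_on with
    | zero => simp
    | tmul m m' => simp [h]
    | add x y hx hy => rw [tmul_add, map_add, hx, hy, map_add]
  rw [IsBC, this]
  exact LinearEquiv.bijective _

end IsBC

end BaseChange

/-! ### Exterior powers commute with base change. -/

section ExteriorPower

variable {A R : Type u} [CommRing A] [CommRing R] [Algebra A R]
variable {M N : Type u} [AddCommGroup M] [Module A M] [AddCommGroup N] [Module R N]

theorem extPowToBC_ιMulti (n : ℕ) (v : Fin n → M) :
    extPowToBC R n M (exteriorPower.ιMulti A n v) =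
      exteriorPower.ιMulti R n fun i ↦ (1 : R) ⊗ₜ[A] v i := by
  let : Module A (⋀[R]^n (R ⊗[A] M)) := Module.compHom _ (algebraMap A R)
  exact exteriorPower.alternatingMapLinearEquiv_apply_ιMulti _ v

theorem extPowToBC_surjective (n : ℕ) : Function.Surjective (liftBC (A := A) (extPowToBC R n M)) := by
  rw [← LinearMap.range_eq_top, eq_top_iff,
    ← exteriorPower.ιMulti_span_of_span R n (R ⊗[A] M) span_range_inclBC, Submodule.span_le]
  rintro _ ⟨v, hv, rfl⟩
  choose w hw using fun i ↦ hv ⟨i, rfl⟩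
  refine ⟨1 ⊗ₜ exteriorPower.ιMulti A n w, ?_⟩
  rw [liftBC_tmul, one_smul, extPowToBC_ιMulti]
  congr 1
  ext i
  exact hw i

variable (A R M) in
-- Squares of pure tensors vanish, and the cross terms of a sum cancel because degree-one elements
-- anticommute. Handling the two separately makes the argument valid in characteristic two. The
-- relation yields an algebra map from the exterior algebra of `R ⊗ M` to `R ⊗ ⋀ M`.
theorem baseChange_ι_sq_zero (x : R ⊗[A] M) :
    (ExteriorAlgebra.ι A (M := M)).baseChange R x * (ExteriorAlgebra.ι A).baseChange R x = 0 := by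
  set f := (ExteriorAlgebra.ι A (M := M)).baseChange R
  have anti (x y : R ⊗[A] M) : f x * f y + f y * f x = 0 := by
    induction x using TensorProduct.induction_on with
    | zero => simp
    | add x₁ x₂ h1 h2 =>
      rw [map_add, add_mul, mul_add, add_add_add_comm, h1, h2, add_zero]
    | tmul r m =>
      induction y using TensorProduct.induction_on with
      | zero => simp
      | add x₁ x₂ h1 h2 =>
        rw [map_add, add_mul, mul_add, add_add_add_comm, h1, h2, add_zero]
      | tmul s n =>
        simp only [f, LinearMap.baseChange_tmul, Algebra.TensorProduct.tmul_mul_tmul]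
        rw [mul_comm s r, ← tmul_add, ExteriorAlgebra.ι_add_mul_swap, tmul_zero]
  induction x using TensorProduct.induction_on with
  | zero => simp
  | tmul r m =>
    simp [f, LinearMap.baseChange_tmul, Algebra.TensorProduct.tmul_mul_tmul]
  | add x y hx hy =>
    rw [map_add, add_mul, mul_add, mul_add, hx, hy, zero_add, add_zero, anti]

/-- A left inverse is the algebra map `Φ` obtained from the universal property, followed by
projection to degree `n`. No freeness of `M` is involved. -/
theorem extPowToBC_injective (n : ℕ) : Function.Injective (liftBC (A := A) (extPowToBC R n M)) := by
  let Φ : ExteriorAlgebra R (R ⊗[A] M) →ₐ[R] R ⊗[A] ExteriorAlgebra A M :=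
    ExteriorAlgebra.lift R ⟨(ExteriorAlgebra.ι A).baseChange R, baseChange_ι_sq_zero A R M⟩
  -- The projection to degree `n` is `A`-linear, so it can be base changed to `R`.
  obtain ⟨π, hπ⟩ : ∃ π : ExteriorAlgebra A M →ₗ[A] ⋀[A]^n M, ∀ x : ⋀[A]^n M, π x = x := by
    refine ⟨DirectSum.component A ℕ (fun i ↦ ⋀[A]^i M) n ∘ₗ
      (DirectSum.decomposeLinearEquiv fun i : ℕ ↦ ⋀[A]^i M).toLinearMap, fun x ↦ ?_⟩
    simpa [DirectSum.component] using
      DirectSum.component.lof_self A (M := fun i ↦ ⋀[A]^i M) n x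
  have key : (π.baseChange R ∘ₗ Φ.toLinearMap ∘ₗ (⋀[R]^n (R ⊗[A] M)).subtype) ∘ₗ
      liftBC (extPowToBC R n M) = LinearMap.id := by
    apply TensorProduct.AlgebraTensorModule.curry_injective
    apply LinearMap.ext_ring
    apply exteriorPower.linearMap_ext
    ext v
    have h : Φ (ExteriorAlgebra.ιMulti R n fun i ↦ (1 : R) ⊗ₜ[A] v i) =
        1 ⊗ₜ ExteriorAlgebra.ιMulti A n v := by
      change _ = Algebra.TensorProduct.includeRight (R := A) (A := R) _
      rw [ExteriorAlgebra.ιMulti_apply, ExteriorAlgebra.ιMulti_apply, map_list_prod, map_list_prod,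
        List.map_ofFn, List.map_ofFn]
      congr 2
      ext i
      simp [Φ]
    change π.baseChange R (Φ (liftBC (extPowToBC R n M) (1 ⊗ₜ exteriorPower.ιMulti A n v)).1) =
      1 ⊗ₜ exteriorPower.ιMulti A n v
    rw [liftBC_tmul, one_smul, extPowToBC_ιMulti, exteriorPower.ιMulti_apply_coe, h,
      LinearMap.baseChange_tmul, ← exteriorPower.ιMulti_apply_coe, hπ]
  exact Function.LeftInverse.injective (g := π.baseChange R ∘ₗ Φ.toLinearMap ∘ₗ (⋀[R]^n (R ⊗[A] M)).subtype)
    (LinearMap.congr_fun key)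

theorem isBC_extPowToBC (n : ℕ) : IsBC (A := A) (extPowToBC R n M) :=
  ⟨extPowToBC_injective n, extPowToBC_surjective n⟩

/-- The map on exterior powers induced by a semilinear map. -/
def extPowSemilinear {A R : Type u} [CommRing A] [CommRing R] {M N : Type u} [AddCommGroup M]
    [Module A M] [AddCommGroup N] [Module R N] {φ : A →+* R} (n : ℕ) (f : M →ₛₗ[φ] N) : ⋀[A]^n M →ₛₗ[φ] ⋀[R]^n N :=
  letI := φ.toAlgebra
  (exteriorPower.map n (liftBC f)).comp (extPowToBC R n M)

theorem extPowSemilinear_ιMulti {A R : Type u} [CommRing A] [CommRing R] {M N : Type u}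
    [AddCommGroup M] [Module A M] [AddCommGroup N] [Module R N] {φ : A →+* R} (n : ℕ) (f : M →ₛₗ[φ] N) (v : Fin n → M) :
    extPowSemilinear n f (exteriorPower.ιMulti A n v) =
      exteriorPower.ιMulti R n fun i ↦ f (v i) := by
  let := φ.toAlgebra
  change exteriorPower.map n (liftBC f) (extPowToBC R n M _) = _
  rw [extPowToBC_ιMulti, exteriorPower.map_apply_ιMulti]
  congr 1
  ext i
  simp

theorem IsBC.extPow {σ : M →ₛₗ[algebraMap A R] N} (hσ : IsBC σ) (n : ℕ) :
    IsBC (extPowSemilinear n σ) := by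
  refine (isBC_extPowToBC n).of_equiv (extPowCongr n hσ.equiv) _ fun m ↦ ?_
  have : (extPowCongr n hσ.equiv).toLinearMap.comp (extPowToBC R n M) = extPowSemilinear n σ := by
    refine LinearMap.ext_on (exteriorPower.ιMulti_span A n M) ?_
    rintro _ ⟨v, rfl⟩
    rw [extPowSemilinear_ιMulti, LinearMap.comp_apply, extPowToBC_ιMulti]
    change exteriorPower.map n hσ.equiv.toLinearMap _ = _
    rw [exteriorPower.map_apply_ιMulti]
    congr 1
    ext i
    simp
  exact (LinearMap.congr_fun this m).symm

end ExteriorPower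

/-! ### Functoriality and base change for constructions from `⊗`, `⋀ⁱ` and `⊕`. -/

namespace TensorialConstruction

/-- The tensorial constructions that use only `⊗`, `⋀ⁱ` and `⊕`. They are functorial for all
linear maps and commute with every base change. -/
def IsPoly : TensorialConstruction → Prop
  | var => True
  | tensor s t => s.IsPoly ∧ t.IsPoly
  | ext _ t => t.IsPoly
  | sym _ _ => False
  | sum s t => s.IsPoly ∧ t.IsPoly
  | dual _ => False

section

variable {A R S : Type u} [CommRing A] [CommRing R] [CommRing S]

/-- The semilinear map `t(M) → t(N)` induced by a semilinear map `M → N`, for a tensorial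
construction without duals and symmetric powers. -/
def smap {φ : A →+* R} {M : ModuleCat.{u} A} {N : ModuleCat.{u} R} (σ : M →ₛₗ[φ] N) :
    ∀ t : TensorialConstruction, t.obj M →ₛₗ[φ] t.obj N
  | var => σ
  | tensor s t => TensorProduct.map (smap σ s) (smap σ t)
  | ext i t => extPowSemilinear i (smap σ t)
  | sym _ _ => 0
  | sum s t =>
    { toFun := fun x ↦ (smap σ s x.1, smap σ t x.2)
      map_add' := fun _ _ ↦ Prod.ext (map_add (smap σ s) _ _) (map_add (smap σ t) _ _)
      map_smul' := fun a x ↦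
        Prod.ext ((smap σ s).map_smulₛₗ a x.1) ((smap σ t).map_smulₛₗ a x.2) }
  | dual _ => 0

/-- The composite `ρ` and its ring homomorphism `χ` are separate variables tied by equations, so
that the lemma applies when the ring homomorphisms agree only propositionally. -/
theorem smap_comp {φ : A →+* R} {ψ : R →+* S} {χ : A →+* S} {M : ModuleCat.{u} A}
    {N : ModuleCat.{u} R} {P : ModuleCat.{u} S} (σ : M →ₛₗ[φ] N) (τ : N →ₛₗ[ψ] P)
    (ρ : M →ₛₗ[χ] P) (h : ∀ m, ρ m = τ (σ m)) (hχ : χ = ψ.comp φ) {t : TensorialConstruction} (ht : t.IsPoly) (x : t.obj M) :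
    smap ρ t x = smap τ t (smap σ t x) := by
  have : RingHomCompTriple φ ψ χ := ⟨hχ.symm⟩
  suffices H : smap ρ t = (smap τ t).comp (smap σ t) from LinearMap.congr_fun H x
  clear x
  induction t with
  | var => exact LinearMap.ext h
  | tensor s t hs ht' =>
    apply TensorProduct.ext'
    intro x y
    change smap ρ s x ⊗ₜ[S] smap ρ t y = _
    rw [hs ht.1, ht' ht.2]
    rfl
  | ext i t ht' =>
    refine LinearMap.ext_on (exteriorPower.ιMulti_span A i _) ?_
    rintro _ ⟨v, rfl⟩
    change extPowSemilinear i (smap ρ t) _ =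
      extPowSemilinear i (smap τ t) (extPowSemilinear i (smap σ t) _)
    simp only [extPowSemilinear_ιMulti, ht' ht]
    rfl
  | sym j t ht' => exact ht.elim
  | sum s t hs ht' =>
    apply LinearMap.ext
    intro x
    change (smap ρ s x.1, smap ρ t x.2) = _
    rw [hs ht.1, ht' ht.2]
    rfl
  | dual t ht' => exact ht.elim

theorem congr_eq_smap {M N : ModuleCat.{u} A} (e : M ≃ₗ[A] N) {t : TensorialConstruction}
    (ht : t.IsPoly) (x : t.obj M) : congr e t x = smap e.toLinearMap t x := by
  suffices H : (congr e t).toLinearMap = smap e.toLinearMap t from LinearMap.congr_fun H x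
  clear x
  induction t with
  | var => rfl
  | tensor s t hs ht' =>
    apply TensorProduct.ext'
    intro x y
    change congr e s x ⊗ₜ[A] congr e t y = smap e.toLinearMap s x ⊗ₜ[A] smap e.toLinearMap t y
    rw [← hs ht.1, ← ht' ht.2]
    rfl
  | ext i t ht' =>
    refine LinearMap.ext_on (exteriorPower.ιMulti_span A i _) ?_
    rintro _ ⟨v, rfl⟩
    change exteriorPower.map i (congr e t).toLinearMap _ =
      extPowSemilinear i (smap e.toLinearMap t) _
    rw [extPowSemilinear_ιMulti, ← ht' ht]
    exact exteriorPower.map_apply_ιMulti _ _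
  | sym j t ht' => exact ht.elim
  | sum s t hs ht' =>
    apply LinearMap.ext
    intro x
    change (congr e s x.1, congr e t x.2) = (smap e.toLinearMap s x.1, smap e.toLinearMap t x.2)
    rw [← hs ht.1, ← ht' ht.2]
    rfl
  | dual t ht' => exact ht.elim

/-- `congr` of the identity is an idempotent in a group, hence trivial. -/
theorem smap_id {M : ModuleCat.{u} A} (σ : M →ₗ[A] M) (h : ∀ m, σ m = m) {t : TensorialConstruction}
    (ht : t.IsPoly) (x : t.obj M) : smap σ t x = x := by
  have h1 : σ = (LinearEquiv.refl A M).toLinearMap := LinearMap.ext h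
  have h2 := congr_mul t (LinearEquiv.refl A M) (LinearEquiv.refl A M)
  have h3 : congr (LinearEquiv.refl A M) t = 1 := by
    have : (LinearEquiv.refl A M) * (LinearEquiv.refl A M) = LinearEquiv.refl A M := rfl
    rw [this] at h2
    exact mul_left_cancel (h2.symm.trans (mul_one _).symm)
  rw [h1, ← congr_eq_smap _ ht, h3]
  rfl

theorem isBC_smap [Algebra A R] {M : ModuleCat.{u} A} {N : ModuleCat.{u} R} {σ : M →ₛₗ[algebraMap A R] N}
    (hσ : IsBC σ) {t : TensorialConstruction} (ht : t.IsPoly) : IsBC (smap σ t) := by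
  induction t with
  | var => exact hσ
  | tensor s t hs ht' => exact (hs ht.1).tensor (ht' ht.2) _ fun m m' ↦ rfl
  | ext i t ht' => exact (ht' ht).extPow i
  | sym j t ht' => exact ht.elim
  | sum s t hs ht' => exact (hs ht.1).prod (ht' ht.2) _ fun m ↦ rfl
  | dual t ht' => exact ht.elim

theorem baseChange_tmul [Algebra A R] {M : ModuleCat.{u} A} {t : TensorialConstruction} (ht : t.IsPoly) (r : R)
    (x : t.obj M) : t.baseChange R M (r ⊗ₜ x) =
      r • smap (N := ModuleCat.of R (R ⊗[A] M)) (inclBC R M) t x := by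
  suffices H : (t.baseChange R M).comp (inclBC R (t.obj M)) =
      smap (N := ModuleCat.of R (R ⊗[A] M)) (inclBC R M) t by
    rw [← H, LinearMap.comp_apply, ← map_smul, inclBC_apply, smul_tmul', smul_eq_mul, mul_one]
  clear x
  induction t with
  | var => rfl
  | tensor s t hs ht' =>
    apply TensorProduct.ext'
    intro x y
    change _ = smap _ s x ⊗ₜ[R] smap _ t y
    rw [← hs ht.1, ← ht' ht.2]
    rfl
  | ext i t ht' =>
    refine LinearMap.ext_on (exteriorPower.ιMulti_span A i _) ?_
    rintro _ ⟨v, rfl⟩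
    change exteriorPower.map i (baseChange R M t) ((1 : R) • extPowToBC R i (t.obj M) _) =
      extPowSemilinear i (smap _ t) _
    rw [one_smul, extPowSemilinear_ιMulti, extPowToBC_ιMulti, exteriorPower.map_apply_ιMulti,
      ← ht' ht]
    rfl
  | sym j t ht' => exact ht.elim
  | sum s t hs ht' =>
    apply LinearMap.ext
    intro x
    change _ = (smap _ s x.1, smap _ t x.2)
    rw [← hs ht.1, ← ht' ht.2]
    rfl
  | dual t ht' => exact ht.elim

theorem free_finite_obj {M : ModuleCat.{u} A} (h1 : Module.Free A M) (h2 : Module.Finite A M)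
    {t : TensorialConstruction} (ht : t.IsPoly) :
    Module.Free A (t.obj M) ∧ Module.Finite A (t.obj M) := by
  induction t with
  | var => exact ⟨h1, h2⟩
  | tensor s t hs ht' =>
    obtain ⟨_, _⟩ := hs ht.1
    obtain ⟨_, _⟩ := ht' ht.2
    exact ⟨inferInstanceAs (Module.Free A (s.obj M ⊗[A] t.obj M)),
      inferInstanceAs (Module.Finite A (s.obj M ⊗[A] t.obj M))⟩
  | ext i t ht' =>
    obtain ⟨_, _⟩ := ht' ht
    exact ⟨inferInstanceAs (Module.Free A (⋀[A]^i (t.obj M))),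
      inferInstanceAs (Module.Finite A (⋀[A]^i (t.obj M)))⟩
  | sym j t ht' => exact ht.elim
  | sum s t hs ht' =>
    obtain ⟨_, _⟩ := hs ht.1
    obtain ⟨_, _⟩ := ht' ht.2
    exact ⟨inferInstanceAs (Module.Free A (s.obj M × t.obj M)),
      inferInstanceAs (Module.Finite A (s.obj M × t.obj M))⟩
  | dual t ht' => exact ht.elim

/-- The submodule of `t(N)` generated by the image of a submodule of `t(M)`. -/
def push {φ : A →+* R} {M : ModuleCat.{u} A} {N : ModuleCat.{u} R} (σ : M →ₛₗ[φ] N)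
    (t : TensorialConstruction) (L : Submodule A (t.obj M)) : Submodule R (t.obj N) :=
  Submodule.span R (smap σ t '' L)

theorem push_le_iff {φ : A →+* R} {M : ModuleCat.{u} A} {N : ModuleCat.{u} R} (σ : M →ₛₗ[φ] N)
    {t : TensorialConstruction} {L : Submodule A (t.obj M)} {L' : Submodule R (t.obj N)} :
    push σ t L ≤ L' ↔ ∀ x ∈ L, smap σ t x ∈ L' := by
  rw [push, Submodule.span_le, Set.image_subset_iff]
  rfl

theorem smap_mem_push {φ : A →+* R} {M : ModuleCat.{u} A} {N : ModuleCat.{u} R} (σ : M →ₛₗ[φ] N)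
    {t : TensorialConstruction} {L : Submodule A (t.obj M)} {x : t.obj M} (hx : x ∈ L) :
    smap σ t x ∈ push σ t L :=
  Submodule.subset_span ⟨x, hx, rfl⟩

theorem push_span {φ : A →+* R} {M : ModuleCat.{u} A} {N : ModuleCat.{u} R} (σ : M →ₛₗ[φ] N)
    {t : TensorialConstruction} (s : Set (t.obj M)) :
    push σ t (Submodule.span A s) = Submodule.span R (smap σ t '' s) := by
  apply le_antisymm
  · rw [push_le_iff]
    intro x hx
    induction hx using Submodule.span_induction with
    | mem x hx => exact Submodule.subset_span ⟨x, hx, rfl⟩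
    | zero => rw [map_zero]; exact zero_mem _
    | add x y _ _ hx hy => rw [map_add]; exact add_mem hx hy
    | smul a x _ hx => rw [LinearMap.map_smulₛₗ]; exact Submodule.smul_mem _ _ hx
  · exact Submodule.span_mono (Set.image_mono Submodule.subset_span)

/-- The rule by which all later transport of submodules between opens, rings and points is computed.
-/
theorem push_push {φ : A →+* R} {ψ : R →+* S} {χ : A →+* S} {M : ModuleCat.{u} A}
    {N : ModuleCat.{u} R} {P : ModuleCat.{u} S} (σ : M →ₛₗ[φ] N) (τ : N →ₛₗ[ψ] P)
    (ρ : M →ₛₗ[χ] P) (h : ∀ m, ρ m = τ (σ m)) (hχ : χ = ψ.comp φ) {t : TensorialConstruction}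
    (ht : t.IsPoly) (L : Submodule A (t.obj M)) : push τ t (push σ t L) = push ρ t L := by
  rw [show push σ t L = Submodule.span R (smap σ t '' L) from rfl, push_span, ← Set.image_comp,
    push]
  congr 1
  apply Set.image_congr
  intro x _
  exact (smap_comp σ τ ρ h hχ ht x).symm

theorem map_congr_eq_push {M N : ModuleCat.{u} A} (e : M ≃ₗ[A] N) {t : TensorialConstruction}
    (ht : t.IsPoly) (L : Submodule A (t.obj M)) :
    L.map (congr e t).toLinearMap = push e.toLinearMap t L := by
  rw [← Submodule.span_eq L, push_span, Submodule.map_span]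
  congr 1
  exact Set.image_congr fun x _ ↦ congr_eq_smap e ht x

/-- Together with `map_congr_eq_push` this rewrites the condition on `L` entirely in terms of
`push`. -/
theorem pullbackSub_eq_push [Algebra A R] {M : ModuleCat.{u} A} {t : TensorialConstruction}
    (ht : t.IsPoly) (L : Submodule A (t.obj M)) :
    pullbackSub R t M L = push (N := ModuleCat.of R (R ⊗[A] M)) (inclBC R M) t L := by
  rw [pullbackSub, Submodule.baseChange_eq_span, Submodule.map_span, push]
  congr 1
  rw [Submodule.map_coe, ← Set.image_comp]
  refine Set.image_congr fun x _ ↦ ?_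
  exact (baseChange_tmul ht 1 x).trans (one_smul _ _)

end

end TensorialConstruction

/-! ### The determinant line of a split submodule. -/

section Determinant

/-- The image of `⋀ᵈ P` in `⋀ᵈ W`. -/
def detSub {A : Type u} [CommRing A] {W : Type u} [AddCommGroup W] [Module A W] (d : ℕ)
    (P : Submodule A W) : Submodule A (⋀[A]^d W) :=
  LinearMap.range (exteriorPower.map d P.subtype)

/-- A submodule of `W` with a basis `p₁, …, p_d` that admits dual linear forms on `W`. -/
def HasSplitBasis {A : Type u} [CommRing A] {W : Type u} [AddCommGroup W] [Module A W]
    (P : Submodule A W) (d : ℕ) : Prop :=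
  ∃ (p : Fin d → W) (φ : Fin d → Module.Dual A W),
    (∀ a b, φ a (p b) = if a = b then 1 else 0) ∧ Submodule.span A (Set.range p) = P

variable {A : Type u} [CommRing A] {W : Type u} [AddCommGroup W] [Module A W]

theorem detSub_span (d : ℕ) (s : Set W) :
    detSub d (Submodule.span A s) =
      Submodule.span A (exteriorPower.ιMulti A d '' {v | Set.range v ⊆ s}) := by
  have h : Submodule.span A (Subtype.val ⁻¹' s : Set (Submodule.span A s)) = ⊤ :=
    Submodule.span_span_coe_preimage
  rw [detSub, LinearMap.range_eq_map, ← exteriorPower.ιMulti_span_of_span A d _ h,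
    Submodule.map_span, ← Set.image_comp]
  congr 1
  ext x
  constructor
  · rintro ⟨v, hv, rfl⟩
    refine ⟨fun i ↦ (v i).1, ?_, ?_⟩
    · rintro _ ⟨i, rfl⟩
      exact hv ⟨i, rfl⟩
    · exact (exteriorPower.map_apply_ιMulti (Submodule.subtype _) v).symm
  · rintro ⟨v, hv, rfl⟩
    refine ⟨fun i ↦ ⟨v i, Submodule.subset_span (hv ⟨i, rfl⟩)⟩, ?_, ?_⟩
    · rintro _ ⟨i, rfl⟩
      exact hv ⟨i, rfl⟩
    · exact exteriorPower.map_apply_ιMulti (Submodule.subtype _) _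

/-- A `d`-tuple of members of the family `p` has the form `p ∘ f`. Its wedge is `±` that of `p` if
`f` is a permutation, and zero otherwise. -/
theorem detSub_span_range {d : ℕ} (p : Fin d → W) :
    detSub d (Submodule.span A (Set.range p)) =
      Submodule.span A {exteriorPower.ιMulti A d p} := by
  rw [detSub_span]
  apply le_antisymm
  · rw [Submodule.span_le]
    rintro _ ⟨v, hv, rfl⟩
    choose f hf using fun i ↦ hv ⟨i, rfl⟩
    obtain rfl : p ∘ f = v := funext hf
    by_cases hf' : Function.Injective f
    · have := (exteriorPower.ιMulti A d).map_perm p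
        (Equiv.ofBijective f (Finite.injective_iff_bijective.1 hf'))
      change exteriorPower.ιMulti A d (p ∘ f) = _ at this
      rw [this]
      exact Submodule.smul_of_tower_mem _ _ (Submodule.mem_span_singleton_self _)
    · rw [(exteriorPower.ιMulti A d).map_eq_zero_of_not_injective (p ∘ f) fun h ↦ hf' h.of_comp]
      exact zero_mem _
  · exact Submodule.span_mono (Set.singleton_subset_iff.2 ⟨p, Set.Subset.refl (Set.range p), rfl⟩)

/-- The linear form on `⋀ᵈ W` given by `d` linear forms on `W`. -/
def detForm {d : ℕ} (φ : Fin d → Module.Dual A W) : ⋀[A]^d W →ₗ[A] A :=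
  exteriorPower.alternatingMapLinearEquiv
    (Matrix.detRowAlternating.compLinearMap (LinearMap.pi φ))

theorem detForm_ιMulti {d : ℕ} (φ : Fin d → Module.Dual A W) (v : Fin d → W) :
    detForm φ (exteriorPower.ιMulti A d v) = (Matrix.of fun b a ↦ φ a (v b)).det :=
  exteriorPower.alternatingMapLinearEquiv_apply_ιMulti _ _

/-- The determinant of the dual forms takes the value `1` on `p₁ ∧ ⋯ ∧ p_d`. It is therefore a
coordinate on the line, and its kernel is a complement. -/
theorem HasSplitBasis.detSub_equiv {d : ℕ} {P : Submodule A W} (h : HasSplitBasis P d) :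
    Nonempty (detSub d P ≃ₗ[A] A) ∧ ∃ C : Submodule A (⋀[A]^d W), IsCompl (detSub d P) C := by
  obtain ⟨p, φ, hp, rfl⟩ := h
  set l := exteriorPower.ιMulti A d p
  have hl : detForm φ l = 1 := by
    rw [detForm_ιMulti]
    convert Matrix.det_one (R := A) (n := Fin d)
    ext b a
    rw [Matrix.of_apply, hp, Matrix.one_apply]
    simp [eq_comm]
  rw [detSub_span_range]
  have key (x : ⋀[A]^d W) (hx : x ∈ Submodule.span A {l}) : x = detForm φ x • l := by
    obtain ⟨a, rfl⟩ := Submodule.mem_span_singleton.1 hx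
    rw [map_smul, hl, smul_eq_mul, mul_one]
  constructor
  · refine ⟨LinearEquiv.ofBijective ((detForm φ).domRestrict _) ⟨fun x y hxy ↦ ?_, fun a ↦ ?_⟩⟩
    · have hxy' : detForm φ x = detForm φ y := hxy
      apply Subtype.ext
      rw [key x x.2, key y y.2, hxy']
    · refine ⟨⟨a • l, Submodule.smul_mem _ _ (Submodule.mem_span_singleton_self _)⟩, ?_⟩
      change detForm φ (a • l) = a
      rw [map_smul, hl, smul_eq_mul, mul_one]
  · refine ⟨LinearMap.ker (detForm φ), ?_, ?_⟩
    · rw [Submodule.disjoint_def]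
      intro x hx hx'
      rw [key x hx, LinearMap.mem_ker.1 hx', zero_smul]
    · rw [codisjoint_iff, eq_top_iff]
      intro x _
      rw [Submodule.mem_sup]
      refine ⟨detForm φ x • l, Submodule.smul_mem _ _ (Submodule.mem_span_singleton_self _),
        x - detForm φ x • l, ?_, by abel⟩
      rw [LinearMap.mem_ker, map_sub, map_smul, hl, smul_eq_mul, mul_one, sub_self]

/-- A split submodule is determined by its determinant line: an automorphism that preserves
the line preserves the submodule. -/
theorem HasSplitBasis.map_le_of_detSub_map_le [Module.Free A W] {d : ℕ} {P : Submodule A W}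
    (h : HasSplitBasis P d) (g : W ≃ₗ[A] W)
    (hg : (detSub d P).map (exteriorPower.map d g.toLinearMap) ≤ detSub d P) :
    P.map g.toLinearMap ≤ P := by
  obtain ⟨p, φ, hp, rfl⟩ := h
  set l := exteriorPower.ιMulti A d p with hl
  rw [detSub_span_range, Submodule.map_span_le] at hg
  obtain ⟨c, hc⟩ := Submodule.mem_span_singleton.1 (hg l rfl)
  rw [Submodule.map_span, Submodule.span_le]
  rintro _ ⟨_, ⟨a, rfl⟩, rfl⟩
  -- Every form `ψ` that vanishes on `P` also vanishes on `g (p a)`. Transport the dual forms by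
  -- `g⁻¹` and replace the `a`-th one by `ψ`. The determinant of these forms is `ψ (g (p a))` on `g
  -- l`, by Cramer's rule for the identity matrix, and `0` on `l`, because column `a` vanishes. But
  -- `g l` is a multiple of `l`.
  have hker (ψ : Module.Dual A W) (hψ : ∀ b, ψ (p b) = 0) : ψ (g (p a)) = 0 := by
    let F : Fin d → Module.Dual A W :=
      Function.update (fun b ↦ φ b ∘ₗ g.symm.toLinearMap) a ψ
    have h1 : detForm F (exteriorPower.map d g.toLinearMap l) = ψ (g (p a)) := by
      rw [hl, exteriorPower.map_apply_ιMulti, detForm_ιMulti]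
      have : (Matrix.of fun b c ↦ F c ((g.toLinearMap ∘ p) b)) =
          (1 : Matrix (Fin d) (Fin d) A).updateCol a fun b ↦ ψ (g (p b)) := by
        ext b c
        by_cases hca : c = a
        · subst hca
          simp [F]
        · simp [F, hca, hp, Matrix.one_apply, eq_comm]
      rw [this, ← Matrix.cramer_apply, Matrix.cramer_one]
      rfl
    have h2 : detForm F l = 0 := by
      rw [hl, detForm_ιMulti]
      refine Matrix.det_eq_zero_of_column_eq_zero a fun b ↦ ?_
      simp [F, hψ]
    rw [← h1, ← hc, map_smul, h2, smul_zero]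
  -- `W` is free, so linear forms separate its points. Each `ψ` is corrected by the dual forms so as
  -- to vanish on `P`, and `hker` applies.
  have : g (p a) = ∑ b, φ b (g (p a)) • p b := by
    rw [← sub_eq_zero, ← Module.forall_dual_apply_eq_zero_iff A]
    intro ψ
    have := hker (ψ - ∑ b, ψ (p b) • φ b) fun c ↦ by simp [hp]
    simpa [mul_comm] using this
  change g (p a) ∈ _
  rw [this]
  exact Submodule.sum_mem _ fun b _ ↦ Submodule.smul_mem _ _ (Submodule.subset_span ⟨b, rfl⟩)

end Determinant

/-! ### Determinant lines and split bases under base change. -/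

namespace TensorialConstruction

variable {A R : Type u} [CommRing A] [CommRing R]

/-- Both sides are spanned by the wedges of the images of `d`-tuples from `P`, whatever the
semilinear map. -/
theorem push_detSub {φ : A →+* R} {M : ModuleCat.{u} A} {N : ModuleCat.{u} R} (σ : M →ₛₗ[φ] N)
    (t : TensorialConstruction) (d : ℕ) (P : Submodule A (t.obj M)) :
    push σ (ext d t) (detSub d P) = detSub d (push σ t P) := by
  rw [push.eq_def σ t P, detSub_span]
  conv_lhs => rw [← Submodule.span_eq P, detSub_span]
  refine (push_span (t := ext d t) σ _).trans ?_
  congr 1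
  ext x
  constructor
  · rintro ⟨_, ⟨v, hv, rfl⟩, rfl⟩
    refine ⟨fun i ↦ smap σ t (v i), ?_, (extPowSemilinear_ιMulti d (smap σ t) v).symm⟩
    rintro _ ⟨i, rfl⟩
    exact ⟨v i, hv ⟨i, rfl⟩, rfl⟩
  · rintro ⟨v, hv, rfl⟩
    choose w hw hw' using fun i ↦ hv ⟨i, rfl⟩
    refine ⟨_, ⟨w, ?_, rfl⟩, (extPowSemilinear_ιMulti d (smap σ t) w).trans ?_⟩
    · rintro _ ⟨i, rfl⟩
      exact hw i
    · exact congrArg _ (funext hw')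

variable [Algebra A R] {M : ModuleCat.{u} A} {N : ModuleCat.{u} R} {σ : M →ₛₗ[algebraMap A R] N}
  {t : TensorialConstruction}

/-- The extension of a linear form on `t(M)` to a linear form on `t(N)`, for a base change
map `M → N`. -/
def dualExt (hσ : IsBC σ) (ht : t.IsPoly) (l : Module.Dual A (t.obj M)) :
    Module.Dual R (t.obj N) :=
  (isBC_smap hσ ht).lift
    { toFun := fun x ↦ algebraMap A R (l x)
      map_add' := fun x y ↦ by rw [map_add, map_add]
      map_smul' := fun a x ↦ by rw [map_smul, smul_eq_mul, map_mul, smul_eq_mul] }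

@[simp]
theorem dualExt_smap (hσ : IsBC σ) (ht : t.IsPoly) (l : Module.Dual A (t.obj M)) (x : t.obj M) :
    dualExt hσ ht l (smap σ t x) = algebraMap A R (l x) :=
  (isBC_smap hσ ht).lift_apply _ x

theorem hasSplitBasis_push (hσ : IsBC σ) (ht : t.IsPoly) {P : Submodule A (t.obj M)} {d : ℕ}
    (h : HasSplitBasis P d) : HasSplitBasis (push σ t P) d := by
  obtain ⟨p, φ, hp, rfl⟩ := h
  refine ⟨fun a ↦ smap σ t (p a), fun a ↦ dualExt hσ ht (φ a), fun a b ↦ ?_, ?_⟩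
  · rw [dualExt_smap, hp]
    split_ifs <;> simp
  · rw [push_span, ← Set.range_comp]
    rfl

end TensorialConstruction

/-! ### Basic opens of affine opens. -/

section BasicOpens

variable {X : Scheme.{u}}

/-- `U'` is a basic open of the affine open `U`. -/
def IsBasicIn (U' U : X.affineOpens) : Prop :=
  ∃ f : Γ(X, U), (U' : X.Opens) = X.basicOpen f

namespace IsBasicIn

theorem le {U' U : X.affineOpens} (h : IsBasicIn U' U) : U' ≤ U := by
  obtain ⟨f, hf⟩ := h
  change (U' : X.Opens) ≤ U
  rw [hf]
  exact X.basicOpen_le f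

theorem refl (U : X.affineOpens) : IsBasicIn U U :=
  ⟨1, (X.basicOpen_of_isUnit isUnit_one).symm⟩

theorem trans {U'' U' U : X.affineOpens} (h : IsBasicIn U'' U') (h' : IsBasicIn U' U) :
    IsBasicIn U'' U := by
  obtain ⟨f, hf⟩ := h'
  obtain ⟨g, hg⟩ := h
  obtain ⟨U', hU'⟩ := U'
  subst hf
  obtain ⟨f', hf'⟩ := U.2.basicOpen_basicOpen_is_basicOpen f g
  exact ⟨f', hg.trans hf'.symm⟩

theorem exists_mem_inter {U U' : X.affineOpens} {x : X} (hx : x ∈ (U : X.Opens))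
    (hx' : x ∈ (U' : X.Opens)) :
    ∃ W : X.affineOpens, x ∈ (W : X.Opens) ∧ IsBasicIn W U ∧ IsBasicIn W U' := by
  obtain ⟨f, g, h, hxf⟩ := exists_basicOpen_le_affine_inter U.2 U'.2 x ⟨hx, hx'⟩
  exact ⟨⟨X.basicOpen f, U.2.basicOpen f⟩, hxf, ⟨f, rfl⟩, ⟨g, h⟩⟩

end IsBasicIn

/-- The basic open `U' ∩ D(f)` of `U'`, for `f` a function on a larger affine open. -/
def basicRes {U' U : X.affineOpens} (h : U' ≤ U) (f : Γ(X, U)) : X.affineOpens :=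
  ⟨X.basicOpen (resRing h f), U'.2.basicOpen _⟩

theorem isBasicIn_basicRes {U' U : X.affineOpens} (h : U' ≤ U) (f : Γ(X, U)) :
    IsBasicIn (basicRes h f) U' :=
  ⟨_, rfl⟩

theorem isBasicIn_basicRes_of_eq {U' U D : X.affineOpens} (h : IsBasicIn U' U) {f : Γ(X, U)}
    (hD : (D : X.Opens) = X.basicOpen f) : IsBasicIn (basicRes h.le f) D := by
  obtain ⟨g, hg⟩ := h
  have hDU : (D : X.Opens) ≤ U := hD ▸ X.basicOpen_le f
  refine ⟨X.presheaf.map (homOfLE hDU).op g, ?_⟩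
  change X.basicOpen (X.presheaf.map _ f) = _
  rw [Scheme.basicOpen_res, Scheme.basicOpen_res, hg, hD, inf_comm]

end BasicOpens

/-! ### Sections and fibers of `V` as base changes of one another. -/

section Sections

variable {X : Scheme.{u}} (V : X.Modules)

/-- Restriction of sections as a semilinear map. -/
def resMod {U U' : X.affineOpens} (h : U' ≤ U) : sections V U →ₛₗ[resRing h] sections V U' where
  toFun := resSections V h
  map_add' := map_add _
  map_smul' a m := V.map_smul _ a m

/-- Quasi-coherence enters here: restriction to a basic open is a localization of modules, and
localization is a base change. -/
theorem isBC_resMod (hV : V.IsQuasicoherent) {U U' : X.affineOpens} (h : IsBasicIn U' U) :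
    letI : Algebra Γ(X, U) Γ(X, U') := (resRing h.le).toAlgebra
    IsBC (A := Γ(X, U)) (R := Γ(X, U')) (resMod V h.le) := by
  obtain ⟨f, hf⟩ := h
  let : Algebra Γ(X, U) Γ(X, U') := (resRing (IsBasicIn.le ⟨f, hf⟩)).toAlgebra
  have hloc : IsLocalization.Away f Γ(X, U') :=
    U.2.isLocalization_of_eq_basicOpen f (homOfLE (IsBasicIn.le ⟨f, hf⟩)) hf
  have hq := exists_eq_of_isQuasicoherent V U.2 f (IsBasicIn.le ⟨f, hf⟩) hf
  let : Module Γ(X, U) (sections V U') := Module.compHom _ (algebraMap Γ(X, U) Γ(X, U'))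
  have : IsScalarTower Γ(X, U) Γ(X, U') (sections V U') := ⟨fun a r p ↦ by
    rw [Algebra.smul_def, mul_smul]; rfl⟩
  let r : sections V U →ₗ[Γ(X, U)] sections V U' :=
    { toFun := resMod V (IsBasicIn.le ⟨f, hf⟩)
      map_add' := map_add _
      map_smul' := fun a m ↦ (resMod V (IsBasicIn.le ⟨f, hf⟩)).map_smulₛₗ a m }
  have hr : IsLocalizedModule (Submonoid.powers f) r := by
    refine ⟨fun s ↦ ?_, fun y ↦ ?_, fun {x y} hxy ↦ ?_⟩
    · have h1 := (IsLocalization.map_units Γ(X, U') s).map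
        (algebraMap Γ(X, U') (Module.End Γ(X, U') (sections V U')))
      rw [Module.End.isUnit_iff] at h1 ⊢
      exact h1
    · obtain ⟨n, x, hx⟩ := hq.1 y
      exact ⟨⟨x, ⟨f ^ n, n, rfl⟩⟩, hx⟩
    · obtain ⟨n, hn⟩ := hq.2 (x - y) (by rw [map_sub]; exact sub_eq_zero.2 hxy)
      exact ⟨⟨f ^ n, n, rfl⟩, by rw [smul_sub] at hn; exact sub_eq_zero.1 hn⟩
  have hb := IsLocalizedModule.isBaseChange (Submonoid.powers f) Γ(X, U') r
  have : hb.equiv.toLinearMap = liftBC (resMod V (IsBasicIn.le ⟨f, hf⟩)) := by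
    apply liftBC_unique
    intro m
    exact (hb.equiv_tmul 1 m).trans (one_smul _ _)
  rw [IsBC, ← this]
  exact hb.equiv.bijective

/-- The map from sections of `V` over `U` to the fiber of `V` at a point of `U' ⊆ U`. -/
def toFib {U U' : X.affineOpens} (h : U' ≤ U) (R : Type u) [CommRing R] [Algebra Γ(X, U') R] :
    sections V U →ₛₗ[(algebraMap Γ(X, U') R).comp (resRing h)] fiber V U' R where
  toFun m := 1 ⊗ₜ resSections V h m
  map_add' x y := by rw [map_add, tmul_add]
  map_smul' a x := by
    change (1 : R) ⊗ₜ[Γ(X, U')] (resMod V h (a • x)) = _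
    rw [LinearMap.map_smulₛₗ, tmul_smul, ← algebraMap_smul R]
    rfl

theorem isBC_toFib (hV : V.IsQuasicoherent) {U U' : X.affineOpens} (h : IsBasicIn U' U)
    (R : Type u) [CommRing R] [Algebra Γ(X, U') R] :
    letI : Algebra Γ(X, U) R := ((algebraMap Γ(X, U') R).comp (resRing h.le)).toAlgebra
    IsBC (A := Γ(X, U)) (R := R) (toFib V h.le R) := by
  let : Algebra Γ(X, U) R := ((algebraMap Γ(X, U') R).comp (resRing h.le)).toAlgebra
  let : Algebra Γ(X, U) Γ(X, U') := (resRing h.le).toAlgebra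
  have : IsScalarTower Γ(X, U) Γ(X, U') R := .of_algebraMap_eq fun _ ↦ rfl
  exact (isBC_resMod V hV h).comp (τ := inclBC R (sections V U')) isBC_inclBC _ fun m ↦ rfl

/-- The transition map between fibers as a semilinear map. -/
def trans {U U' : X.affineOpens} (h : U' ≤ U) {R R' : Type u} [CommRing R] [CommRing R']
    [Algebra Γ(X, U) R] [Algebra Γ(X, U') R'] (φ : R →+* R')
    (hφ : φ.comp (algebraMap Γ(X, U) R) = (algebraMap Γ(X, U') R').comp (resRing h)) :
    fiber V U R →ₛₗ[φ] fiber V U' R' where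
  toFun := transition V h φ hφ
  map_add' := map_add _
  map_smul' r v := by
    induction v using TensorProduct.induction_on with
    | zero => rw [smul_zero, map_zero, smul_zero]
    | tmul s m =>
      change φ (r * s) ⊗ₜ[Γ(X, U')] resSections V h m = φ r • (φ s ⊗ₜ[Γ(X, U')] resSections V h m)
      rw [map_mul, smul_tmul', smul_eq_mul]
    | add x y hx hy => rw [smul_add, map_add, hx, hy, map_add, smul_add]

variable {U U' : X.affineOpens} (h : U' ≤ U) {R R' : Type u} [CommRing R] [CommRing R']
    [Algebra Γ(X, U) R] [Algebra Γ(X, U') R'] (φ : R →+* R')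
    (hφ : φ.comp (algebraMap Γ(X, U) R) = (algebraMap Γ(X, U') R').comp (resRing h))

theorem trans_tmul (r : R) (m : Γ(V, U)) :
    trans V h φ hφ (r ⊗ₜ m) = φ r ⊗ₜ resSections V h m := rfl

theorem trans_inclBC (m : sections V U) : trans V h φ hφ (inclBC R _ m) = toFib V h R' m := by
  rw [inclBC_apply, trans_tmul, map_one]
  rfl

/-- Two-out-of-three for sections over `U`, the fiber over `R` and the fiber over `R'`. -/
theorem isBC_trans (hV : V.IsQuasicoherent) (hU : IsBasicIn U' U) :
    letI := φ.toAlgebra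
    IsBC (A := R) (R := R') (trans V h φ hφ) := by
  let := φ.toAlgebra
  let : Algebra Γ(X, U) R' := ((algebraMap Γ(X, U') R').comp (resRing h)).toAlgebra
  have : IsScalarTower Γ(X, U) R R' := .of_algebraMap_eq fun a ↦ (RingHom.congr_fun hφ a).symm
  exact isBC_inclBC.of_comp _ (isBC_toFib V hV hU R') fun m ↦ (trans_inclBC V h φ hφ m).symm

end Sections

/-! ### Points of `G` inside `GL(V)` and the universal point. -/

section Points

variable {X : Scheme.{u}} {G : Over X} [GrpObj G] {V : X.Modules} (ρ : LinearAction G V)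

/-- The subgroup of `R`-valued points of `GL(V)` that come from `G`. -/
def GPts (U : X.affineOpens) (R : Type u) [CommRing R] [Algebra Γ(X, U) R] :
    Subgroup (GLPoints V U R) :=
  (ρ.hom U R).range

theorem resRing_refl (U : X.affineOpens) (h : U ≤ U) : resRing h = RingHom.id Γ(X, U) := by
  have : (homOfLE h).op = 𝟙 (op (U : X.Opens)) := rfl
  ext x
  rw [resRing, this, CategoryTheory.Functor.map_id]
  rfl

theorem SpecMap_pt {U U' : X.affineOpens} (h : U' ≤ U) {R R' : Type u} [CommRing R] [CommRing R']
    [Algebra Γ(X, U) R] [Algebra Γ(X, U') R'] (φ : R →+* R')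
    (hφ : φ.comp (algebraMap Γ(X, U) R) = (algebraMap Γ(X, U') R').comp (resRing h)) :
    Spec.map (CommRingCat.ofHom φ) ≫ pt U R = pt U' R' := by
  have h1 : Spec.map (X.presheaf.map (homOfLE h).op) ≫ U.2.fromSpec = U'.2.fromSpec :=
    IsAffineOpen.map_fromSpec U.2 U'.2 _
  rw [pt, pt, ← h1, ← Category.assoc, ← Category.assoc, ← Spec.map_comp, ← Spec.map_comp]
  congr 2
  ext a
  exact RingHom.congr_fun hφ a

theorem exists_mem_GPts {U U' : X.affineOpens} (h : U' ≤ U) {R R' : Type u} [CommRing R]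
    [CommRing R'] [Algebra Γ(X, U) R] [Algebra Γ(X, U') R'] (φ : R →+* R')
    (hφ : φ.comp (algebraMap Γ(X, U) R) = (algebraMap Γ(X, U') R').comp (resRing h))
    {g : GLPoints V U R} (hg : g ∈ GPts ρ U R) :
    ∃ g' ∈ GPts ρ U' R', ∀ v, trans V h φ hφ (g v) = g' (trans V h φ hφ v) := by
  obtain ⟨x, rfl⟩ := hg
  let x' : Over.mk (pt U' R') ⟶ G := Over.homMk (Spec.map (CommRingCat.ofHom φ) ≫ x.left) (by
    rw [Category.assoc, Over.w x]
    exact SpecMap_pt h φ hφ)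
  exact ⟨_, ⟨x', rfl⟩, ρ.natural U U' h R R' φ hφ x x' rfl⟩

theorem mem_GPts_of_trans (hV : V.IsQuasicoherent) {U U' : X.affineOpens} (h : IsBasicIn U' U)
    {R R' : Type u} [CommRing R] [CommRing R'] [Algebra Γ(X, U) R] [Algebra Γ(X, U') R']
    (φ : R →+* R')
    (hφ : φ.comp (algebraMap Γ(X, U) R) = (algebraMap Γ(X, U') R').comp (resRing h.le))
    {g : GLPoints V U R} (hg : g ∈ GPts ρ U R) (g' : GLPoints V U' R')
    (hg' : ∀ v, trans V h.le φ hφ (g v) = g' (trans V h.le φ hφ v)) : g' ∈ GPts ρ U' R' := by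
  obtain ⟨g'', h1, h2⟩ := exists_mem_GPts ρ h.le φ hφ hg
  let := φ.toAlgebra
  have : g'.toLinearMap = g''.toLinearMap :=
    (isBC_trans V h.le φ hφ hV h).hom_ext fun v ↦ (hg' v).symm.trans (h2 v)
  rwa [LinearEquiv.toLinearMap_injective this]

theorem trans_id_injective (hV : V.IsQuasicoherent) {U U' : X.affineOpens} (h : IsBasicIn U' U)
    {R : Type u} [CommRing R] [Algebra Γ(X, U) R] [Algebra Γ(X, U') R]
    (hR : (RingHom.id R).comp (algebraMap Γ(X, U) R) =
      (algebraMap Γ(X, U') R).comp (resRing h.le)) :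
    Function.Injective (trans V h.le _ hR) :=
  (isBC_trans V h.le _ hR hV h).injective_of_algebraMap_eq _ fun _ ↦ rfl

theorem SpecMap_ofHom_id (R : Type u) [CommRing R] :
    Spec.map (CommRingCat.ofHom (RingHom.id R)) = 𝟙 (Spec (CommRingCat.of R)) := by
  rw [CommRingCat.ofHom_id, Spec.map_id]

theorem pt_eq_pt {U U' : X.affineOpens} (h : U' ≤ U)
    {R : Type u} [CommRing R] [Algebra Γ(X, U) R] [Algebra Γ(X, U') R]
    (hR : (RingHom.id R).comp (algebraMap Γ(X, U) R) =
      (algebraMap Γ(X, U') R).comp (resRing h)) : pt U R = pt U' R := by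
  have h1 := SpecMap_pt h _ hR
  rwa [SpecMap_ofHom_id, Category.id_comp] at h1

/-- Moves a point of `G` along an equality of structure maps without a cast. The morphism `i` stands
for `Spec` of an identity homomorphism, the shape in which `LinearAction.natural` asks for it. -/
theorem exists_left_eq_of_eq {X S : Scheme.{u}} {G : Over X} {p q : S ⟶ X} (hpq : p = q)
    (x : Over.mk q ⟶ G) : ∃ x' : Over.mk p ⟶ G, ∀ i : S ⟶ S, i = 𝟙 S → x.left = i ≫ x'.left := by
  subst hpq
  refine ⟨x, fun i hi ↦ ?_⟩
  subst hi
  exact (Category.id_comp x.left).symm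

theorem exists_mem_GPts_of_mem {U U' : X.affineOpens} (h : U' ≤ U)
    {R : Type u} [CommRing R] [Algebra Γ(X, U) R] [Algebra Γ(X, U') R]
    (hR : (RingHom.id R).comp (algebraMap Γ(X, U) R) = (algebraMap Γ(X, U') R).comp (resRing h))
    (g' : GLPoints V U' R) (hg' : g' ∈ GPts ρ U' R) :
    ∃ g ∈ GPts ρ U R, ∀ v, trans V h _ hR (g v) = g' (trans V h _ hR v) := by
  obtain ⟨x, rfl⟩ := hg'
  obtain ⟨x', hx'⟩ := exists_left_eq_of_eq (pt_eq_pt h hR) x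
  have hx'' := ρ.natural U U' h R R _ hR x' x (hx' _ (SpecMap_ofHom_id R))
  exact ⟨_, ⟨x', rfl⟩, hx''⟩

theorem mem_GPts_of_mem_GPts (hV : V.IsQuasicoherent) {U U' : X.affineOpens} (h : IsBasicIn U' U)
    {R : Type u} [CommRing R] [Algebra Γ(X, U) R] [Algebra Γ(X, U') R]
    (hR : (RingHom.id R).comp (algebraMap Γ(X, U) R) =
      (algebraMap Γ(X, U') R).comp (resRing h.le))
    {g : GLPoints V U R} (g' : GLPoints V U' R) (hg' : g' ∈ GPts ρ U' R)
    (hgg : ∀ v, trans V h.le _ hR (g v) = g' (trans V h.le _ hR v)) : g ∈ GPts ρ U R := by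
  obtain ⟨g'', h1, h2⟩ := exists_mem_GPts_of_mem ρ h.le hR g' hg'
  have : g = g'' := LinearEquiv.ext fun v ↦ trans_id_injective hV h hR (by rw [hgg, h2])
  rwa [this]

/-- As `G` is affine over `X`, its part over `U` is the spectrum of a ring `B`, flat over `Γ(X, U)`,
whose tautological point is universal. A point with values in `R` over `U` lands in this part and so
is induced by a homomorphism `B → R`. -/
theorem exists_universal [IsAffineHom G.hom] [Flat G.hom] (U : X.affineOpens) :
    ∃ (B : Type u) (_ : CommRing B) (_ : Algebra Γ(X, U) B), Module.Flat Γ(X, U) B ∧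
      ∃ gu ∈ GPts ρ U B, ∀ (R : Type u) [CommRing R] [Algebra Γ(X, U) R], ∀ g ∈ GPts ρ U R,
        ∃ (φ : B →+* R) (hφ : φ.comp (algebraMap Γ(X, U) B) =
          (algebraMap Γ(X, U) R).comp (resRing le_rfl)),
          ∀ v, trans V le_rfl φ hφ (gu v) = g (trans V le_rfl φ hφ v) := by
  have hU : IsAffineOpen (U : X.Opens) := U.2
  have hW : IsAffineOpen (G.hom ⁻¹ᵁ (U : X.Opens)) := U.2.preimage G.hom
  let : Algebra Γ(X, U) Γ(G.left, G.hom ⁻¹ᵁ (U : X.Opens)) := (G.hom.app U).hom.toAlgebra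
  have hfl : Module.Flat Γ(X, U) Γ(G.left, G.hom ⁻¹ᵁ (U : X.Opens)) := by
    have := HasRingHomProperty.appLE @Flat G.hom inferInstance ⟨_, hU⟩ ⟨_, hW⟩ le_rfl
    rw [Scheme.Hom.appLE_eq_app] at this
    exact this
  have hpt : hW.fromSpec ≫ G.hom = pt U Γ(G.left, G.hom ⁻¹ᵁ (U : X.Opens)) := by
    rw [← IsAffineOpen.SpecMap_appLE_fromSpec G.hom U.2 hW le_rfl, Scheme.Hom.appLE_eq_app]
    rfl
  let xu : Over.mk (pt U Γ(G.left, G.hom ⁻¹ᵁ (U : X.Opens))) ⟶ G := Over.homMk hW.fromSpec hpt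
  refine ⟨Γ(G.left, G.hom ⁻¹ᵁ (U : X.Opens)), inferInstance, inferInstance, hfl, _, ⟨xu, rfl⟩, ?_⟩
  rintro R _ _ _ ⟨x, rfl⟩
  have hx : x.left ≫ G.hom = pt U R := Over.w x
  have hrange : Set.range x.left ⊆ Set.range hW.fromSpec := by
    rw [hW.range_fromSpec]
    rintro _ ⟨y, rfl⟩
    change G.hom (x.left y) ∈ (U : Set X)
    rw [← Scheme.Hom.comp_apply, hx, ← U.2.range_fromSpec]
    exact ⟨_, rfl⟩
  let l : Spec (CommRingCat.of R) ⟶ Spec Γ(G.left, G.hom ⁻¹ᵁ (U : X.Opens)) :=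
    IsOpenImmersion.lift hW.fromSpec x.left hrange
  have hl : Spec.map (Spec.preimage l) ≫ hW.fromSpec = x.left := by
    rw [Spec.map_preimage, IsOpenImmersion.lift_fac]
  have hφ : (Spec.preimage l).hom.comp (algebraMap Γ(X, U) Γ(G.left, G.hom ⁻¹ᵁ (U : X.Opens))) =
      (algebraMap Γ(X, U) R).comp (resRing le_rfl) := by
    rw [resRing_refl, RingHom.comp_id]
    have h1 : Spec.map (Spec.preimage l) ≫ pt U _ = pt U R := by
      rw [← hpt, ← Category.assoc, hl, hx]
    change _ ≫ _ ≫ hU.fromSpec = _ ≫ hU.fromSpec at h1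
    rw [← Category.assoc, cancel_mono, ← Spec.map_comp] at h1
    exact congrArg CommRingCat.Hom.hom (Spec.map_injective h1)
  refine ⟨_, hφ, ρ.natural U U le_rfl _ R _ hφ xu x ?_⟩
  exact hl.symm

end Points

/-! ### Values `l(g · v)` of linear forms along points of `GL(V)`. -/

section Evaluation

open TensorialConstruction

variable {X : Scheme.{u}} {V : X.Modules} (hV : V.IsQuasicoherent) {t : TensorialConstruction}
  (ht : t.IsPoly)

/-- The extension of a linear form on `t(V)(C)` to the fibers of `t(V)` at points of `U ⊆ C`. -/
def extForm {C U : X.affineOpens} (h : IsBasicIn U C) (R : Type u) [CommRing R]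
    [Algebra Γ(X, U) R] (l : Module.Dual Γ(X, C) (t.obj (sections V C))) :
    Module.Dual R (t.obj (fiber V U R)) :=
  letI : Algebra Γ(X, C) R := ((algebraMap Γ(X, U) R).comp (resRing h.le)).toAlgebra
  dualExt (σ := toFib V h.le R) (isBC_toFib V hV h R) ht l

theorem extForm_toFib {C U : X.affineOpens} (h : IsBasicIn U C) (R : Type u) [CommRing R]
    [Algebra Γ(X, U) R] (l : Module.Dual Γ(X, C) (t.obj (sections V C)))
    (x : t.obj (sections V C)) :
    extForm hV ht h R l (smap (N := fiber V U R) (toFib V h.le R) t x) =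
      algebraMap Γ(X, U) R (resRing h.le (l x)) := by
  let : Algebra Γ(X, C) R := ((algebraMap Γ(X, U) R).comp (resRing h.le)).toAlgebra
  exact dualExt_smap (σ := toFib V h.le R) (isBC_toFib V hV h R) ht l x

include hV ht in
theorem toFib_hom_ext {C U : X.affineOpens} (h : IsBasicIn U C) (R : Type u) [CommRing R]
    [Algebra Γ(X, U) R] {S : Type*} [CommRing S] {P : Type*} [AddCommGroup P] [Module S P]
    {ψ : R →+* S} {f g : t.obj (fiber V U R) →ₛₗ[ψ] P}
    (hfg : ∀ x, f (smap (N := fiber V U R) (toFib V h.le R) t x) =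
      g (smap (N := fiber V U R) (toFib V h.le R) t x)) : f = g := by
  let : Algebra Γ(X, C) R := ((algebraMap Γ(X, U) R).comp (resRing h.le)).toAlgebra
  exact (isBC_smap (N := fiber V U R) (isBC_toFib V hV h R) ht).hom_ext hfg

section

variable {U U' : X.affineOpens} (h : U' ≤ U) {R R' : Type u} [CommRing R] [CommRing R']
    [Algebra Γ(X, U) R] [Algebra Γ(X, U') R'] (φ : R →+* R')
    (hφ : φ.comp (algebraMap Γ(X, U) R) = (algebraMap Γ(X, U') R').comp (resRing h))

omit hV in
theorem resMod_resMod {C : X.affineOpens} (hC : U ≤ C) (m : sections V C) :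
    resMod V h (resMod V hC m) = resMod V (h.trans hC) m := by
  change V.presheaf.map _ (V.presheaf.map _ m) = _
  rw [← ConcreteCategory.comp_apply, ← Functor.map_comp]
  rfl

omit hV in
theorem resRing_comp {C : X.affineOpens} (hC : U ≤ C) :
    (resRing h).comp (resRing hC) = resRing (h.trans hC) := by
  ext m
  change X.presheaf.map _ (X.presheaf.map _ m) = _
  rw [← ConcreteCategory.comp_apply, ← Functor.map_comp]
  rfl

omit hV in
theorem trans_toFib {C : X.affineOpens} (hC : U ≤ C) (m : sections V C) :
    trans V h φ hφ (toFib V hC R m) = toFib V (h.trans hC) R' m := by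
  change φ 1 ⊗ₜ resMod V h (resMod V hC m) = (1 : R') ⊗ₜ resMod V _ m
  rw [map_one, resMod_resMod]

omit hV in
include hφ in
theorem trans_ringHom {C : X.affineOpens} (hC : U ≤ C) :
    (algebraMap Γ(X, U') R').comp (resRing (h.trans hC)) =
      φ.comp ((algebraMap Γ(X, U) R).comp (resRing hC)) := by
  rw [← RingHom.comp_assoc, hφ, RingHom.comp_assoc, resRing_comp]

omit hV in
include ht in
theorem smap_trans_toFib {C : X.affineOpens} (hC : U ≤ C) (x : t.obj (sections V C)) :
    smap (trans V h φ hφ) t (smap (N := fiber V U R) (toFib V hC R) t x) =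
      smap (N := fiber V U' R') (toFib V (h.trans hC) R') t x :=
  (smap_comp _ _ _ (fun m ↦ (trans_toFib h φ hφ hC m).symm) (trans_ringHom h φ hφ hC) ht x).symm

omit hV in
include ht in
theorem smap_trans_inclBC (x : t.obj (sections V U)) :
    smap (trans V h φ hφ) t (smap (N := fiber V U R) (inclBC R (sections V U)) t x) =
      smap (N := fiber V U' R') (toFib V h R') t x :=
  (smap_comp _ _ _ (fun m ↦ (trans_inclBC V h φ hφ m).symm) hφ.symm ht x).symm

omit hV in
include ht in
theorem smap_trans_equiv (g : GLPoints V U R) (g' : GLPoints V U' R')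
    (hg : ∀ v, trans V h φ hφ (g v) = g' (trans V h φ hφ v)) (x : t.obj (fiber V U R)) :
    smap (trans V h φ hφ) t (smap g.toLinearMap t x) =
      smap g'.toLinearMap t (smap (trans V h φ hφ) t x) := by
  rw [← smap_comp g.toLinearMap (trans V h φ hφ) ((trans V h φ hφ).comp g.toLinearMap)
      (fun m ↦ rfl) rfl ht,
    ← smap_comp (trans V h φ hφ) g'.toLinearMap ((trans V h φ hφ).comp g.toLinearMap) hg rfl ht]

theorem extForm_trans {C : X.affineOpens} (hU : IsBasicIn U C) (hU' : IsBasicIn U' C)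
    (l : Module.Dual Γ(X, C) (t.obj (sections V C))) (x : t.obj (fiber V U R)) :
    extForm hV ht hU' R' l (smap (trans V h φ hφ) t x) = φ (extForm hV ht hU R l x) := by
  let f : t.obj (fiber V U R) →ₛₗ[φ] R' := (extForm hV ht hU' R' l).comp (smap (trans V h φ hφ) t)
  let f' : t.obj (fiber V U R) →ₛₗ[φ] R' :=
    { toFun := fun x ↦ φ (extForm hV ht hU R l x)
      map_add' := fun x y ↦ by rw [map_add, map_add]
      map_smul' := fun a x ↦ by rw [map_smul, smul_eq_mul, map_mul, smul_eq_mul] }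
  suffices f = f' from LinearMap.congr_fun this x
  refine toFib_hom_ext hV ht hU R fun x ↦ ?_
  change extForm hV ht hU' R' l (smap (trans V h φ hφ) t _) = φ (extForm hV ht hU R l _)
  rw [smap_trans_toFib ht, extForm_toFib, extForm_toFib]
  exact RingHom.congr_fun (trans_ringHom h φ hφ hU.le) (l x)

end

/-- The value `l(g · v)` of a linear form `l` on `t(V)(C)`, a section `v` of `t(V)` over `U`, and
a point `g` of `GL(V)` over `W ⊆ C ∩ U`. -/
def evalPt {C U W : X.affineOpens} (h' : IsBasicIn W C) (h : W ≤ U) (R : Type u) [CommRing R]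
    [Algebra Γ(X, W) R] (l : Module.Dual Γ(X, C) (t.obj (sections V C))) (g : GLPoints V W R) :
    t.obj (sections V U) →ₛₗ[(algebraMap Γ(X, W) R).comp (resRing h)] R :=
  (extForm hV ht h' R l).comp ((smap g.toLinearMap t).comp (smap (N := fiber V W R) (toFib V h R) t))

theorem evalPt_apply {C U W : X.affineOpens} (h' : IsBasicIn W C) (h : W ≤ U) (R : Type u)
    [CommRing R] [Algebra Γ(X, W) R] (l : Module.Dual Γ(X, C) (t.obj (sections V C)))
    (g : GLPoints V W R) (v : t.obj (sections V U)) :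
    evalPt hV ht h' h R l g v =
      extForm hV ht h' R l (smap g.toLinearMap t (smap (N := fiber V W R) (toFib V h R) t v)) := rfl

theorem evalPt_trans {C U W W' : X.affineOpens} (hW : IsBasicIn W C) (hW' : IsBasicIn W' C)
    (h : W ≤ U) (h' : W' ≤ W) {R R' : Type u} [CommRing R] [CommRing R'] [Algebra Γ(X, W) R]
    [Algebra Γ(X, W') R'] (φ : R →+* R')
    (hφ : φ.comp (algebraMap Γ(X, W) R) = (algebraMap Γ(X, W') R').comp (resRing h'))
    (l : Module.Dual Γ(X, C) (t.obj (sections V C))) (g : GLPoints V W R) (g' : GLPoints V W' R')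
    (hg : ∀ v, trans V h' φ hφ (g v) = g' (trans V h' φ hφ v)) (v : t.obj (sections V U)) :
    evalPt hV ht hW' (h'.trans h) R' l g' v = φ (evalPt hV ht hW h R l g v) := by
  rw [evalPt_apply, evalPt_apply, ← extForm_trans hV ht h' φ hφ hW hW' l,
    smap_trans_equiv ht h' φ hφ g g' hg, smap_trans_toFib ht]

theorem evalPt_resMod {C U U' W : X.affineOpens} (hW : IsBasicIn W C) (h : U' ≤ U) (h' : W ≤ U')
    (R : Type u) [CommRing R] [Algebra Γ(X, W) R] (l : Module.Dual Γ(X, C) (t.obj (sections V C)))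
    (g : GLPoints V W R) (v : t.obj (sections V U)) :
    evalPt hV ht hW h' R l g (smap (resMod V h) t v) = evalPt hV ht hW (h'.trans h) R l g v := by
  rw [evalPt_apply, evalPt_apply]
  congr 2
  refine (smap_comp _ _ _ (fun m ↦ ?_) ?_ ht v).symm
  · change (1 : R) ⊗ₜ resMod V _ m = (1 : R) ⊗ₜ resMod V _ (resMod V _ m)
    rw [resMod_resMod]
  · rw [RingHom.comp_assoc, resRing_comp]

end Evaluation

/-! ### Working locally on the spectrum of the ring of a point. -/

section Localization

variable {X : Scheme.{u}}

theorem exists_algebra_localization {U D : X.affineOpens} (h : D ≤ U) (f : Γ(X, U))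
    (hD : (D : X.Opens) = X.basicOpen f) (R R' : Type u) [CommRing R] [CommRing R']
    [Algebra Γ(X, U) R] (φ : R →+* R') (hf : IsUnit (φ (algebraMap Γ(X, U) R f))) :
    ∃ _ : Algebra Γ(X, D) R',
      φ.comp (algebraMap Γ(X, U) R) = (algebraMap Γ(X, D) R').comp (resRing h) := by
  let : Algebra Γ(X, U) Γ(X, D) := (resRing h).toAlgebra
  have : IsLocalization.Away f Γ(X, D) := U.2.isLocalization_of_eq_basicOpen f (homOfLE h) hD
  let ψ : Γ(X, D) →+* R' :=
    IsLocalization.Away.lift f (g := φ.comp (algebraMap Γ(X, U) R)) hf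
  exact ⟨ψ.toAlgebra, (IsLocalization.Away.lift_comp f hf).symm⟩

/-- Here `x` is the image of the prime `p` in `X`. A basic open `D` of `U` and `W` around `x` is
given by a function on `U`. Its image `f` in `R` lies outside `p`, and inverting it turns the point
over `U` into a point over `D`. Statements near `p` can thus be checked over any chosen
neighbourhood `W` of `x`. -/
theorem exists_localization (U : X.affineOpens) (R : Type u) [CommRing R] [Algebra Γ(X, U) R]
    (p : Ideal R) [p.IsPrime] : ∃ x ∈ (U : X.Opens), ∀ W : X.affineOpens, x ∈ (W : X.Opens) →
      ∃ (D : X.affineOpens) (hU : IsBasicIn D U) (_ : IsBasicIn D W) (f : R) (_ : f ∉ p)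
        (_ : Algebra Γ(X, D) (Localization.Away f)), x ∈ (D : X.Opens) ∧
        (algebraMap R (Localization.Away f)).comp (algebraMap Γ(X, U) R) =
          (algebraMap Γ(X, D) (Localization.Away f)).comp (resRing hU.le) := by
  have hU : IsAffineOpen (U : X.Opens) := U.2
  let q : PrimeSpectrum Γ(X, U) := ⟨p.comap (algebraMap Γ(X, U) R), inferInstance⟩
  have hq : hU.fromSpec q ∈ (U : X.Opens) := by
    rw [← SetLike.mem_coe, ← hU.range_fromSpec]
    exact ⟨q, rfl⟩
  refine ⟨hU.fromSpec q, hq, fun W hW ↦ ?_⟩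
  obtain ⟨D, hxD, hDU, hDW⟩ := IsBasicIn.exists_mem_inter hq hW
  obtain ⟨f, hf⟩ := id hDU
  have hfq : f ∉ q.asIdeal := by
    have : q ∈ hU.fromSpec ⁻¹ᵁ X.basicOpen f := by rw [← hf]; exact hxD
    rw [hU.fromSpec_preimage_basicOpen f] at this
    exact this
  obtain ⟨alg, halg⟩ := exists_algebra_localization hDU.le f hf R
    (Localization.Away (algebraMap Γ(X, U) R f)) (algebraMap _ _)
    (IsLocalization.Away.algebraMap_isUnit _)
  exact ⟨D, hDU, hDW, algebraMap Γ(X, U) R f, hfq, alg, hxD, halg⟩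

/-- Otherwise the annihilator of `r` lies in a maximal ideal, which excludes every power of the
corresponding `f`. -/
theorem eq_zero_of_forall_prime {R : Type*} [CommRing R] (r : R)
    (h : ∀ p : Ideal R, p.IsPrime → ∃ f ∉ p, algebraMap R (Localization.Away f) r = 0) :
    r = 0 := by
  by_contra hr
  have h1 : Ideal.span {r} ≠ ⊥ := by rwa [Ne, Ideal.span_singleton_eq_bot]
  have h2 : Module.annihilator R (Ideal.span {r}) ≠ ⊤ := by
    rw [Ne, Module.annihilator_eq_top_iff]
    intro h3
    exact hr (congrArg Subtype.val
      (Subsingleton.elim (⟨r, Ideal.mem_span_singleton_self r⟩ : Ideal.span {r}) 0))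
  obtain ⟨m, hm, hle⟩ := Ideal.exists_le_maximal _ h2
  obtain ⟨f, hf, hfr⟩ := h m hm.isPrime
  obtain ⟨⟨_, n, rfl⟩, hn⟩ := (IsLocalization.map_eq_zero_iff (Submonoid.powers f) _ r).1 hfr
  refine hf (hm.isPrime.mem_of_pow_mem n (hle ?_))
  rw [Module.mem_annihilator]
  rintro ⟨s, hs⟩
  obtain ⟨a, rfl⟩ := Ideal.mem_span_singleton'.1 hs
  apply Subtype.ext
  change f ^ n * (a * r) = 0
  rw [mul_left_comm, show f ^ n * r = 0 from hn, mul_zero]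

end Localization

/-! ### Clearing denominators, and kernels under flat base change. -/

section Algebra

theorem exists_pow_smul_eq {A R : Type u} [CommRing A] [CommRing R] [Algebra A R] {M N : Type u}
    [AddCommGroup M] [Module A M] [AddCommGroup N] [Module R N] {σ : M →ₛₗ[algebraMap A R] N}
    (hσ : IsBC σ) (f : A) [IsLocalization.Away f R] (y : N) :
    ∃ (n : ℕ) (m : M), algebraMap A R f ^ n • y = σ m := by
  obtain ⟨x, rfl⟩ := hσ.2 y
  induction x using TensorProduct.induction_on with
  | zero => exact ⟨0, 0, by simp⟩
  | tmul r m =>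
    obtain ⟨n, a, ha⟩ := IsLocalization.Away.surj f r
    refine ⟨n, a • m, ?_⟩
    rw [liftBC_tmul, smul_smul, mul_comm, ha, LinearMap.map_smulₛₗ]
  | add x y hx hy =>
    obtain ⟨n, m, h1⟩ := hx
    obtain ⟨n', m', h2⟩ := hy
    refine ⟨n + n', f ^ n' • m + f ^ n • m', ?_⟩
    rw [map_add, map_add, LinearMap.map_smulₛₗ, LinearMap.map_smulₛₗ, ← h1, ← h2, smul_add,
      smul_smul, smul_smul, map_pow, map_pow, ← pow_add, ← pow_add, add_comm n' n]

/-- Tensoring with a flat `B` preserves the kernel of the combined map to `∏ N k`; finiteness of `K`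
lets the tensor product commute with the product. -/
theorem mem_baseChange_of_lTensor_eq_zero {A B M : Type u} [CommRing A] [CommRing B] [Algebra A B]
    [Module.Flat A B] [AddCommGroup M] [Module A M] {K : Type*} [Finite K] {N : K → Type u}
    [∀ k, AddCommGroup (N k)] [∀ k, Module A (N k)] (e : ∀ k, M →ₗ[A] N k) (P : Submodule A M)
    (hP : ∀ m, (∀ k, e k m = 0) → m ∈ P) (y : B ⊗[A] M) (hy : ∀ k, (e k).lTensor B y = 0) :
    y ∈ P.baseChange B := by
  classical
  have := Fintype.ofFinite K
  have hex := Module.Flat.lTensor_exact B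
    (LinearMap.exact_subtype_ker_map (LinearMap.pi e))
  have h0 : (LinearMap.pi e).lTensor B y = 0 := by
    apply (TensorProduct.piRight A A B N).injective
    rw [map_zero]
    ext k
    have h1 : (LinearMap.proj k ∘ₗ (TensorProduct.piRight A A B N).toLinearMap) ∘ₗ
        (LinearMap.pi e).lTensor B = (e k).lTensor B := by
      ext b m
      simp
    exact (LinearMap.congr_fun h1 y).trans (hy k)
  obtain ⟨z, rfl⟩ := (hex y).1 h0
  clear h0 hy
  induction z using TensorProduct.induction_on with
  | zero => rw [map_zero]; exact zero_mem _
  | tmul b m =>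
    rw [LinearMap.lTensor_tmul]
    refine Submodule.tmul_mem_baseChange_of_mem b (hP _ fun k ↦ ?_)
    exact congrFun m.2 k
  | add x y hx hy => rw [map_add]; exact add_mem hx hy

end Algebra

/-! ### Stable submodules, and the sections killed by linear forms along `G`. -/

section StableSub

open TensorialConstruction

variable {X : Scheme.{u}} {G : Over X} [GrpObj G] {V : X.Modules} (ρ : LinearAction G V)

/-- A quasi-coherent submodule of a tensorial construction `W(V)` that is `G`-stable and
saturated, given by its sections over the affine opens. -/
structure StableSub where
  /-- The tensorial construction. -/
  W : TensorialConstruction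
  isPoly : W.IsPoly
  /-- The sections over affine opens. -/
  sub : ∀ U : X.affineOpens, Submodule Γ(X, U) (W.obj (sections V U))
  push_res : ∀ (U U' : X.affineOpens) (h : IsBasicIn U' U),
    push (resMod V h.le) W (sub U) = sub U'
  stable : ∀ (U : X.affineOpens) (R : Type u) [CommRing R] [Algebra Γ(X, U) R],
    ∀ g ∈ GPts ρ U R, push g.toLinearMap W
        (push (N := fiber V U R) (inclBC R (sections V U)) W (sub U)) ≤
      push (N := fiber V U R) (inclBC R (sections V U)) W (sub U)
  sat : ∀ (U : X.affineOpens), ∀ a ∈ nonZeroDivisors Γ(X, U),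
    ∀ v : W.obj (sections V U), a • v ∈ sub U → v ∈ sub U

variable (hV : V.IsQuasicoherent) {t : TensorialConstruction} (ht : t.IsPoly)
variable {J : Type} (c : J → X.affineOpens)
  (l : ∀ j, Module.Dual Γ(X, c j) (t.obj (sections V (c j))))

/-- The largest `G`-stable submodule of `t(V)` on which the linear forms `l j` vanish. -/
def stableKer (U : X.affineOpens) : Submodule Γ(X, U) (t.obj (sections V U)) where
  carrier := {v | ∀ (j : J) (W : X.affineOpens) (h : IsBasicIn W U) (h' : IsBasicIn W (c j))
    (R : Type u) [CommRing R] [Algebra Γ(X, W) R], ∀ g ∈ GPts ρ W R,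
      evalPt hV ht h' h.le R (l j) g v = 0}
  zero_mem' := fun j W h h' R _ _ g hg ↦ map_zero _
  add_mem' := fun hv hw j W h h' R _ _ g hg ↦ by
    rw [map_add, hv j W h h' R g hg, hw j W h h' R g hg, add_zero]
  smul_mem' := fun a v hv j W h h' R _ _ g hg ↦ by
    rw [LinearMap.map_smulₛₗ, hv j W h h' R g hg, smul_zero]

/-- Vanishing of a value in `R` is local on `Spec R`. Near each prime the given point of `G` can be
moved to some member `W k` of the cover, where the value vanishes by assumption. -/
theorem evalPt_eq_zero_of_cover {U : X.affineOpens} {K : Type*} (W : K → X.affineOpens)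
    (j : K → J) (hU : ∀ k, IsBasicIn (W k) U) (hc : ∀ k, IsBasicIn (W k) (c (j k)))
    (hW : ∀ j₀ : J, ∀ x ∈ (U : X.Opens), x ∈ (c j₀ : X.Opens) →
      ∃ k, x ∈ (W k : X.Opens) ∧ j k = j₀) (v : t.obj (sections V U))
    (hv : ∀ (k : K) (R : Type u) [CommRing R] [Algebra Γ(X, W k) R], ∀ g ∈ GPts ρ (W k) R,
      evalPt hV ht (hc k) (hU k).le R (l (j k)) g v = 0) :
    v ∈ stableKer ρ hV ht c l U := by
  intro j₀ W₀ h h' R _ _ g hg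
  refine eq_zero_of_forall_prime _ fun p hp ↦ ?_
  obtain ⟨x, hx, H⟩ := exists_localization W₀ R p
  obtain ⟨k, hxk, rfl⟩ := hW j₀ x (h.le hx) (h'.le hx)
  obtain ⟨D, hD, hDk, f, hf, _, _, hcompat⟩ := H (W k) hxk
  refine ⟨f, hf, ?_⟩
  obtain ⟨g₁, hg₁, hg₁'⟩ := exists_mem_GPts ρ hD.le _ hcompat hg
  rw [← evalPt_trans hV ht h' (hD.trans h') h.le hD.le _ hcompat (l (j k)) g g₁ hg₁' v]
  let : Algebra Γ(X, W k) (Localization.Away f) :=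
    ((algebraMap Γ(X, D) (Localization.Away f)).comp (resRing hDk.le)).toAlgebra
  obtain ⟨g₂, hg₂, hg₂'⟩ := exists_mem_GPts_of_mem ρ hDk.le rfl g₁ hg₁
  have := evalPt_trans hV ht (hc k) (hD.trans h') (hU k).le hDk.le _ rfl (l (j k)) g₂ g₁ hg₂' v
  rw [hv k _ g₂ hg₂, map_zero] at this
  exact this

/-- The intersections `U ∩ c j` need not be affine, but they are quasi-compact because `X` is a
noetherian space. -/
theorem exists_finite_cover_inter [TopologicalSpace.NoetherianSpace X] [Finite J]
    (U : X.affineOpens) : ∃ (K : Type u) (_ : Finite K) (W : K → X.affineOpens) (j : K → J),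
      (∀ k, IsBasicIn (W k) U) ∧ (∀ k, IsBasicIn (W k) (c (j k))) ∧
      ∀ j₀ : J, ∀ x ∈ (U : X.Opens), x ∈ (c j₀ : X.Opens) →
        ∃ k, x ∈ (W k : X.Opens) ∧ j k = j₀ := by
  have H (j : J) : ∃ s : Finset {x : X // x ∈ (U : X.Opens) ⊓ (c j : X.Opens)},
      ∃ W : {x : X // x ∈ (U : X.Opens) ⊓ (c j : X.Opens)} → X.affineOpens,
      (∀ x, IsBasicIn (W x) U ∧ IsBasicIn (W x) (c j)) ∧
      ∀ x ∈ (U : X.Opens) ⊓ (c j : X.Opens), ∃ y ∈ s, x ∈ (W y : X.Opens) := by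
    choose W hW hWU hWc using fun x : {x : X // x ∈ (U : X.Opens) ⊓ (c j : X.Opens)} ↦
      IsBasicIn.exists_mem_inter x.2.1 x.2.2
    have hcomp : IsCompact (((U : X.Opens) ⊓ (c j : X.Opens) : X.Opens) : Set X) :=
      TopologicalSpace.NoetherianSpace.isCompact _
    obtain ⟨s, hs⟩ := hcomp.elim_finite_subcover (fun x ↦ ((W x : X.Opens) : Set X))
      (fun x ↦ (W x : X.Opens).isOpen) fun x hx ↦ Set.mem_iUnion.2 ⟨⟨x, hx⟩, hW ⟨x, hx⟩⟩
    refine ⟨s, W, fun x ↦ ⟨hWU x, hWc x⟩, fun x hx ↦ ?_⟩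
    obtain ⟨y, hy⟩ := Set.mem_iUnion.1 (hs hx)
    obtain ⟨hys, hy⟩ := Set.mem_iUnion.1 hy
    exact ⟨y, hys, hy⟩
  choose s W hW hs using H
  refine ⟨Σ j, s j, inferInstance, fun k ↦ W k.1 k.2.1, fun k ↦ k.1, fun k ↦ (hW _ _).1,
    fun k ↦ (hW _ _).2, fun j x hx hx' ↦ ?_⟩
  obtain ⟨y, hy, hxy⟩ := hs j x ⟨hx, hx'⟩
  exact ⟨⟨j, y, hy⟩, hxy, rfl⟩

/-- Every point of `G` over an overlap `W k` is pulled back from the universal one. Membership in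
`stableKer`, a condition on all points with values in all rings, is thereby reduced to finitely many
values in flat algebras. -/
theorem exists_detectors [TopologicalSpace.NoetherianSpace X] [Finite J] [IsAffineHom G.hom]
    [Flat G.hom] (U : X.affineOpens) :
    ∃ (K : Type u) (_ : Finite K) (W : K → X.affineOpens) (j : K → J)
      (hU : ∀ k, IsBasicIn (W k) U) (hc : ∀ k, IsBasicIn (W k) (c (j k)))
      (B : K → Type u) (_ : ∀ k, CommRing (B k)) (_ : ∀ k, Algebra Γ(X, W k) (B k))
      (g : ∀ k, GLPoints V (W k) (B k)),
      (∀ k, Module.Flat Γ(X, W k) (B k)) ∧ (∀ k, g k ∈ GPts ρ (W k) (B k)) ∧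
      ∀ v : t.obj (sections V U),
        (∀ k, evalPt hV ht (hc k) (hU k).le (B k) (l (j k)) (g k) v = 0) →
          v ∈ stableKer ρ hV ht c l U := by
  obtain ⟨K, _, W, j, hU, hc, hW⟩ := exists_finite_cover_inter c U
  choose B ring alg hB g hg hu using fun k ↦ exists_universal ρ (W k)
  refine ⟨K, inferInstance, W, j, hU, hc, B, ring, alg, g, hB, hg, fun v hv ↦ ?_⟩
  refine evalPt_eq_zero_of_cover ρ hV ht c l W j hU hc hW v fun k R _ _ g' hg' ↦ ?_
  obtain ⟨φ, hφ, h⟩ := hu k R g' hg'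
  have := evalPt_trans hV ht (hc k) (hc k) (hU k).le le_rfl φ hφ (l (j k)) (g k) g' h v
  rwa [hv k, map_zero] at this

/-- By flatness of `B k` over `Γ(X, W k)` and of `Γ(X, W k)` over `Γ(X, U)`, a nonzerodivisor `a` on
`U` acts injectively on the detecting values. -/
theorem stableKer_sat [TopologicalSpace.NoetherianSpace X] [Finite J] [IsAffineHom G.hom]
    [Flat G.hom] (U : X.affineOpens) (a : Γ(X, U)) (ha : a ∈ nonZeroDivisors Γ(X, U))
    (v : t.obj (sections V U)) (hv : a • v ∈ stableKer ρ hV ht c l U) :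
    v ∈ stableKer ρ hV ht c l U := by
  obtain ⟨K, _, W, j, hU, hc, B, _, _, g, hB, hg, H⟩ := exists_detectors ρ hV ht c l U
  refine H v fun k ↦ ?_
  have h1 := hv (j k) (W k) (hU k) (hc k) (B k) (g k) (hg k)
  rw [LinearMap.map_smulₛₗ] at h1
  have h2 : resRing (hU k).le a ∈ nonZeroDivisors Γ(X, W k) := by
    obtain ⟨f, hf⟩ := id (hU k)
    let : Algebra Γ(X, U) Γ(X, W k) := (resRing (hU k).le).toAlgebra
    have : IsLocalization.Away f Γ(X, W k) :=
      U.2.isLocalization_of_eq_basicOpen f (homOfLE (hU k).le) hf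
    have : Module.Flat Γ(X, U) Γ(X, W k) := IsLocalization.flat _ (Submonoid.powers f)
    have h3 := Module.Flat.isSMulRegular_of_nonZeroDivisors (M := Γ(X, W k)) ha
    rw [mem_nonZeroDivisors_iff_right]
    intro x hx
    apply h3
    change algebraMap Γ(X, U) Γ(X, W k) a * x = algebraMap Γ(X, U) Γ(X, W k) a * 0
    rw [mul_zero, mul_comm]
    exact hx
  have h4 := Module.Flat.isSMulRegular_of_nonZeroDivisors (M := B k) h2
  apply h4
  change resRing (hU k).le a • _ = resRing (hU k).le a • (0 : B k)
  rw [smul_zero, Algebra.smul_def]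
  exact h1

/-- For the harder inclusion, `fⁿ v'` is the restriction of a section `v` over `U`. Each detecting
value of `v` vanishes once `f` is inverted, so a power of `f` kills it. Finitely many detectors
allow a common power, and `f` is invertible on `U'`. -/
theorem stableKer_push_res [TopologicalSpace.NoetherianSpace X] [Finite J] [IsAffineHom G.hom]
    [Flat G.hom] (U U' : X.affineOpens) (h : IsBasicIn U' U) :
    push (resMod V h.le) t (stableKer ρ hV ht c l U) = stableKer ρ hV ht c l U' := by
  apply le_antisymm
  · rw [push_le_iff]
    intro v hv j W hW hc R _ _ g hg
    rw [evalPt_resMod]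
    exact hv j W (hW.trans h) hc R g hg
  · intro v' hv'
    obtain ⟨f, hf⟩ := id h
    let : Algebra Γ(X, U) Γ(X, U') := (resRing h.le).toAlgebra
    have : IsLocalization.Away f Γ(X, U') :=
      U.2.isLocalization_of_eq_basicOpen f (homOfLE h.le) hf
    obtain ⟨n, v, hv⟩ := exists_pow_smul_eq (isBC_smap (isBC_resMod V hV h) ht) f v'
    obtain ⟨K, _, W, j, hU, hc, B, _, _, g, hB, hg, H⟩ := exists_detectors ρ hV ht c l U
    have key (k : K) : ∃ m : ℕ, (algebraMap Γ(X, W k) (B k) (resRing (hU k).le f)) ^ m *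
        evalPt hV ht (hc k) (hU k).le (B k) (l (j k)) (g k) v = 0 := by
      set a := algebraMap Γ(X, W k) (B k) (resRing (hU k).le f) with ha
      obtain ⟨_, hcompat⟩ := exists_algebra_localization (isBasicIn_basicRes (hU k).le f).le
        (resRing (hU k).le f) rfl (B k) (Localization.Away a) (algebraMap _ _)
        (IsLocalization.Away.algebraMap_isUnit _)
      obtain ⟨g', hg', hgg'⟩ := exists_mem_GPts ρ _ _ hcompat (hg k)
      have h1 := evalPt_trans hV ht (hc k) ((isBasicIn_basicRes (hU k).le f).trans (hc k))
        (hU k).le (isBasicIn_basicRes (hU k).le f).le _ hcompat (l (j k)) (g k) g' hgg' v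
      -- `W k ∩ D(f)` is a basic open of `U'` as well, so the hypothesis on `v'` applies to the
      -- localized universal point.
      have hb := isBasicIn_basicRes_of_eq (hU k) hf
      have h2 := evalPt_resMod hV ht ((isBasicIn_basicRes (hU k).le f).trans (hc k)) h.le hb.le _
        (l (j k)) g' v
      have h3 := (stableKer ρ hV ht c l U').smul_mem (algebraMap Γ(X, U) Γ(X, U') f ^ n) hv'
        (j k) _ hb ((isBasicIn_basicRes (hU k).le f).trans (hc k)) _ g' hg'
      rw [hv, h2, h1] at h3
      obtain ⟨⟨_, m, rfl⟩, hm⟩ :=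
        (IsLocalization.map_eq_zero_iff (Submonoid.powers a) (Localization.Away a) _).1 h3
      exact ⟨m, hm⟩
    choose m hm using key
    obtain ⟨m₀, hm₀⟩ := (Set.finite_range m).bddAbove
    have hmem : f ^ m₀ • v ∈ stableKer ρ hV ht c l U := by
      refine H _ fun k ↦ ?_
      rw [LinearMap.map_smulₛₗ, ← Nat.sub_add_cancel (hm₀ ⟨k, rfl⟩), pow_add, map_mul, mul_smul]
      have : ((algebraMap Γ(X, W k) (B k)).comp (resRing (hU k).le)) (f ^ m k) •
          evalPt hV ht (hc k) (hU k).le (B k) (l (j k)) (g k) v = 0 := by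
        rw [map_pow, smul_eq_mul]
        exact hm k
      rw [this, smul_zero]
    have hu : IsUnit (algebraMap Γ(X, U) Γ(X, U') f ^ (m₀ + n)) :=
      (IsLocalization.Away.algebraMap_isUnit f).pow _
    have h5 := smap_mem_push (resMod V h.le) hmem
    rw [LinearMap.map_smulₛₗ, ← hv, map_pow] at h5
    rw [← Submodule.smul_mem_iff_of_isUnit _ hu, pow_add, mul_smul]
    exact h5

end StableSub

/-! ### Stability of these submodules under `G`. -/

section StableKer

open TensorialConstruction

variable {X : Scheme.{u}} {G : Over X} [GrpObj G] {V : X.Modules} (ρ : LinearAction G V)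
variable (hV : V.IsQuasicoherent) {t : TensorialConstruction} (ht : t.IsPoly)
variable {J : Type} (c : J → X.affineOpens)
  (l : ∀ j, Module.Dual Γ(X, c j) (t.obj (sections V (c j))))

/-- The submodule of `t(R ⊗ V(U))` generated by a submodule of `t(V(U))`. -/
abbrev pushFiber {U : X.affineOpens} (R : Type u) [CommRing R] [Algebra Γ(X, U) R]
    (t : TensorialConstruction) (P : Submodule Γ(X, U) (t.obj (sections V U))) :
    Submodule R (t.obj (fiber V U R)) :=
  push (N := fiber V U R) (inclBC R (sections V U)) t P

omit [GrpObj G] in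
theorem toFib_refl {U : X.affineOpens} (R : Type u) [CommRing R] [Algebra Γ(X, U) R]
    (m : sections V U) : toFib V le_rfl R m = inclBC R _ m := by
  change (1 : R) ⊗ₜ[Γ(X, U)] V.presheaf.map (homOfLE le_rfl).op m = (1 : R) ⊗ₜ[Γ(X, U)] m
  have : (homOfLE (le_refl (U : X.Opens))).op = 𝟙 (op (U : X.Opens)) := rfl
  rw [show V.presheaf.map (homOfLE le_rfl).op m = m from
    (congrArg (fun i ↦ V.presheaf.map i m) this).trans (by rw [CategoryTheory.Functor.map_id]; rfl)]

omit [GrpObj G] in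
include ht in
theorem push_trans_pushFiber {U : X.affineOpens} {R R' : Type u} [CommRing R] [CommRing R']
    [Algebra Γ(X, U) R] [Algebra Γ(X, U) R'] (φ : R →+* R')
    (hφ : φ.comp (algebraMap Γ(X, U) R) = (algebraMap Γ(X, U) R').comp (resRing le_rfl))
    (P : Submodule Γ(X, U) (t.obj (sections V U))) :
    push (trans V le_rfl φ hφ) t (pushFiber R t P) = pushFiber R' t P := by
  refine push_push _ _ _ (fun m ↦ ?_) ?_ ht P
  · rw [trans_inclBC, toFib_refl]
  · rw [hφ, resRing_refl, RingHom.comp_id]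

/-- The submodule is the common kernel of the detecting maps `e k`, and flatness of `B` carries this
description over to `B ⊗ t(V)`. It remains to see that each `1 ⊗ e k` kills `g v`. Its value there
is that of `l` on `g₂ g₁ v`, where `g₁` and `g₂` are the pullbacks of `g` and of the `k`-th
universal point to `B ⊗ B' k`. -/
theorem smap_universal_mem [TopologicalSpace.NoetherianSpace X] [Finite J] [IsAffineHom G.hom]
    [Flat G.hom] (U : X.affineOpens) (B : Type u) [CommRing B] [Algebra Γ(X, U) B]
    [Module.Flat Γ(X, U) B] (g : GLPoints V U B) (hg : g ∈ GPts ρ U B)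
    (v : t.obj (sections V U)) (hv : v ∈ stableKer ρ hV ht c l U) :
    smap g.toLinearMap t (smap (N := fiber V U B) (inclBC B (sections V U)) t v) ∈
      pushFiber B t (stableKer ρ hV ht c l U) := by
  obtain ⟨K, _, W, j, hU, hc, B', ring, alg, g', hB', hg', H⟩ := exists_detectors ρ hV ht c l U
  have hE := isBC_smap (N := fiber V U B) (isBC_inclBC (A := Γ(X, U)) (R := B) (M := sections V U)) ht
  let : ∀ k, Algebra Γ(X, U) (B' k) := fun k ↦
    ((algebraMap Γ(X, W k) (B' k)).comp (resRing (hU k).le)).toAlgebra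
  let e : ∀ k, t.obj (sections V U) →ₗ[Γ(X, U)] B' k := fun k ↦
    { toFun := evalPt hV ht (hc k) (hU k).le (B' k) (l (j k)) (g' k)
      map_add' := map_add _
      map_smul' := fun a x ↦ by
        rw [LinearMap.map_smulₛₗ, Algebra.smul_def]
        rfl }
  obtain ⟨y, hy⟩ := hE.2 (smap g.toLinearMap t
    (smap (N := fiber V U B) (inclBC B (sections V U)) t v))
  suffices h : y ∈ (stableKer ρ hV ht c l U).baseChange B by
    rw [← hy]
    have h1 := Submodule.mem_map_of_mem (f := liftBC (smap (N := fiber V U B)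
      (inclBC B (sections V U)) t)) h
    rw [Submodule.baseChange_eq_span, Submodule.map_span] at h1
    refine Submodule.span_mono ?_ h1
    rintro _ ⟨_, ⟨x, hx, rfl⟩, rfl⟩
    exact ⟨x, hx, (one_smul _ _).symm⟩
  refine mem_baseChange_of_lTensor_eq_zero e _ H y fun k ↦ ?_
  let φ : B →+* B ⊗[Γ(X, U)] B' k := Algebra.TensorProduct.includeLeftRingHom
  let ψ : B' k →+* B ⊗[Γ(X, U)] B' k :=
    (Algebra.TensorProduct.includeRight : B' k →ₐ[Γ(X, U)] B ⊗[Γ(X, U)] B' k).toRingHom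
  -- The structure over `W k` comes from the second factor; over `U` it agrees with the one from
  -- `B`, which is the content of `hφ`.
  let : Algebra Γ(X, W k) (B ⊗[Γ(X, U)] B' k) := (ψ.comp (algebraMap Γ(X, W k) (B' k))).toAlgebra
  have hφ : φ.comp (algebraMap Γ(X, U) B) =
      (algebraMap Γ(X, W k) (B ⊗[Γ(X, U)] B' k)).comp (resRing (hU k).le) := by
    ext a
    exact Algebra.TensorProduct.algebraMap_apply' (R := Γ(X, U)) (A := B) (B := B' k) a
  have hψ : ψ.comp (algebraMap Γ(X, W k) (B' k)) =
      (algebraMap Γ(X, W k) (B ⊗[Γ(X, U)] B' k)).comp (resRing le_rfl) := by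
    rw [resRing_refl]
    rfl
  obtain ⟨g₁, hg₁, hgg₁⟩ := exists_mem_GPts ρ (hU k).le φ hφ hg
  obtain ⟨g₂, hg₂, hgg₂⟩ := exists_mem_GPts ρ le_rfl ψ hψ (hg' k)
  let θ : t.obj (fiber V U B) →ₛₗ[φ] B ⊗[Γ(X, U)] B' k :=
    (extForm hV ht (hc k) (B ⊗[Γ(X, U)] B' k) (l (j k))).comp
      ((smap g₂.toLinearMap t).comp (smap (trans V (hU k).le φ hφ) t))
  have hθ (m : t.obj (sections V U)) :
      θ (smap (N := fiber V U B) (inclBC B (sections V U)) t m) = ψ (e k m) := by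
    change extForm hV ht (hc k) (B ⊗[Γ(X, U)] B' k) (l (j k)) (smap g₂.toLinearMap t
      (smap (trans V (hU k).le φ hφ) t (smap (N := fiber V U B) (inclBC B (sections V U)) t m))) = _
    rw [smap_trans_inclBC ht]
    exact evalPt_trans hV ht (hc k) (hc k) (hU k).le le_rfl ψ hψ (l (j k)) (g' k) g₂ hgg₂ m
  have hθ' (z : B ⊗[Γ(X, U)] t.obj (sections V U)) :
      θ (liftBC (smap (N := fiber V U B) (inclBC B (sections V U)) t) z) = (e k).lTensor B z := by
    induction z using TensorProduct.induction_on with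
    | zero => rw [map_zero, map_zero, map_zero]
    | tmul b m =>
      rw [liftBC_tmul, LinearMap.map_smulₛₗ, hθ, LinearMap.lTensor_tmul]
      change (b ⊗ₜ[Γ(X, U)] (1 : B' k)) * ((1 : B) ⊗ₜ[Γ(X, U)] e k m) = _
      rw [Algebra.TensorProduct.tmul_mul_tmul, mul_one, one_mul]
    | add x y hx hy => rw [map_add, map_add, map_add, hx, hy]
  rw [← hθ', hy]
  change extForm hV ht (hc k) (B ⊗[Γ(X, U)] B' k) (l (j k)) (smap g₂.toLinearMap t
      (smap (trans V (hU k).le φ hφ) t (smap g.toLinearMap t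
        (smap (N := fiber V U B) (inclBC B (sections V U)) t v)))) = _
  rw [smap_trans_equiv ht (hU k).le φ hφ g g₁ hgg₁, smap_trans_inclBC ht,
    ← smap_comp g₁.toLinearMap g₂.toLinearMap (g₂ * g₁).toLinearMap (fun m ↦ rfl) rfl ht]
  -- The group law is used here: `g₂ * g₁` is again a point of `G`, so `v` is killed along it.
  exact hv (j k) (W k) (hU k) (hc k) _ (g₂ * g₁) (mul_mem hg₂ hg₁)

/-- An arbitrary point is a pullback of the universal one, for which the ring is flat and
`smap_universal_mem` applies. -/
theorem stableKer_stable [TopologicalSpace.NoetherianSpace X] [Finite J] [IsAffineHom G.hom]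
    [Flat G.hom] (U : X.affineOpens) (R : Type u) [CommRing R] [Algebra Γ(X, U) R]
    (g : GLPoints V U R) (hg : g ∈ GPts ρ U R) :
    push g.toLinearMap t (pushFiber R t (stableKer ρ hV ht c l U)) ≤
      pushFiber R t (stableKer ρ hV ht c l U) := by
  obtain ⟨B, _, _, _, gu, hgu, H⟩ := exists_universal ρ U
  obtain ⟨φ, hφ, h⟩ := H R g hg
  rw [← push_trans_pushFiber ht φ hφ,
    push_push (trans V le_rfl φ hφ) g.toLinearMap
      (g.toLinearMap.comp (trans V le_rfl φ hφ)) (fun _ ↦ rfl) rfl ht,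
    ← push_push gu.toLinearMap (trans V le_rfl φ hφ) (g.toLinearMap.comp (trans V le_rfl φ hφ))
      (fun m ↦ (h m).symm) rfl ht, push_le_iff]
  intro x hx
  apply smap_mem_push
  revert x
  change push _ _ _ ≤ _
  rw [pushFiber, push_push (N := fiber V U B) (P := fiber V U B) (inclBC B (sections V U)) gu.toLinearMap
    (gu.toLinearMap.comp (inclBC B (sections V U))) (fun _ ↦ rfl) rfl ht, push_le_iff]
  intro x hx
  rw [smap_comp (N := fiber V U B) (P := fiber V U B) (inclBC B (sections V U)) gu.toLinearMap
    (gu.toLinearMap.comp (inclBC B (sections V U))) (fun _ ↦ rfl) rfl ht]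
  exact smap_universal_mem ρ hV ht c l U B gu hgu x hx

/-- The largest `G`-stable submodule of `t(V)` on which given linear forms vanish. -/
def StableSub.ofForms [TopologicalSpace.NoetherianSpace X] [Finite J] [IsAffineHom G.hom]
    [Flat G.hom] : StableSub ρ where
  W := t
  isPoly := ht
  sub := stableKer ρ hV ht c l
  push_res U U' h := stableKer_push_res ρ hV ht c l U U' h
  stable U R _ _ g hg := stableKer_stable ρ hV ht c l U R g hg
  sat U a ha v hv := stableKer_sat ρ hV ht c l U a ha v hv

end StableKer

/-! ### Direct sums of submodules and matrix coefficients. -/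

namespace TensorialConstruction

variable {A R : Type u} [CommRing A] [CommRing R]

/-- The direct sum of two submodules, as a submodule of `(s ⊕ t)(M)`. -/
def sumSub {M : ModuleCat.{u} A} {s t : TensorialConstruction} (P : Submodule A (s.obj M))
    (Q : Submodule A (t.obj M)) : Submodule A ((sum s t).obj M) :=
  P.prod Q

theorem push_sum {φ : A →+* R} {M : ModuleCat.{u} A} {N : ModuleCat.{u} R} (σ : M →ₛₗ[φ] N)
    {s t : TensorialConstruction} (P : Submodule A (s.obj M)) (Q : Submodule A (t.obj M)) :
    push σ (sum s t) (sumSub P Q) = sumSub (push σ s P) (push σ t Q) := by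
  apply le_antisymm
  · rw [push_le_iff]
    intro x hx
    exact ⟨smap_mem_push σ hx.1, smap_mem_push σ hx.2⟩
  · have h1 : push σ s P ≤ (push σ (sum s t) (sumSub P Q)).comap
        (LinearMap.inl R (s.obj N) (t.obj N)) := by
      rw [push_le_iff]
      intro x hx
      have h' := smap_mem_push (t := sum s t) σ (L := sumSub P Q) (x := (x, 0)) ⟨hx, zero_mem _⟩
      have h2 : smap σ (sum s t) (x, 0) = (smap σ s x, 0) := Prod.ext rfl (map_zero (smap σ t))
      rw [h2] at h'
      exact h'
    have h2 : push σ t Q ≤ (push σ (sum s t) (sumSub P Q)).comap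
        (LinearMap.inr R (s.obj N) (t.obj N)) := by
      rw [push_le_iff]
      intro x hx
      have h' := smap_mem_push (t := sum s t) σ (L := sumSub P Q) (x := (0, x)) ⟨zero_mem _, hx⟩
      have h2 : smap σ (sum s t) (0, x) = (0, smap σ t x) := Prod.ext (map_zero (smap σ s)) rfl
      rw [h2] at h'
      exact h'
    intro x hx
    have h3 : x = (LinearMap.inl R (s.obj N) (t.obj N) x.1 +
        LinearMap.inr R (s.obj N) (t.obj N) x.2 : s.obj N × t.obj N) :=
      Prod.ext (add_zero _).symm (zero_add _).symm
    rw [h3]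
    exact Submodule.add_mem (push σ (sum s t) (sumSub P Q)) (h1 hx.1) (h2 hx.2)

theorem sumSub_le_sumSub {M : ModuleCat.{u} A} {s t : TensorialConstruction}
    {P P' : Submodule A (s.obj M)} {Q Q' : Submodule A (t.obj M)} :
    sumSub P Q ≤ sumSub P' Q' ↔ P ≤ P' ∧ Q ≤ Q' :=
  ⟨fun h ↦ ⟨fun x hx ↦ (h (x := (x, 0)) ⟨hx, zero_mem _⟩).1,
    fun x hx ↦ (h (x := (0, x)) ⟨zero_mem _, hx⟩).2⟩, fun h _ hx ↦ ⟨h.1 hx.1, h.2 hx.2⟩⟩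

/-- Every polynomial in the entries of a matrix is a matrix coefficient of a tensorial
construction. -/
theorem exists_matrixCoeff {κ : Type} [Finite κ] {M : ModuleCat.{u} A} (b : Module.Basis κ A M)
    (f : MvPolynomial (κ × κ) A) :
    ∃ (t : TensorialConstruction) (_ : t.IsPoly) (w : t.obj M) (l : Module.Dual A (t.obj M)),
      ∀ (R : Type u) [CommRing R] [Algebra A R]
        (g : (ModuleCat.of R (R ⊗[A] M) : ModuleCat.{u} R) →ₗ[R]
          (ModuleCat.of R (R ⊗[A] M) : ModuleCat.{u} R))
        (Λ : Module.Dual R (t.obj (ModuleCat.of R (R ⊗[A] M)))),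
        (∀ x, Λ (smap (N := ModuleCat.of R (R ⊗[A] M)) (inclBC R M) t x) = algebraMap A R (l x)) →
          Λ (smap g t (smap (N := ModuleCat.of R (R ⊗[A] M)) (inclBC R M) t w)) =
            MvPolynomial.aeval
              (fun p : κ × κ ↦ (Algebra.TensorProduct.basis R b).repr (g (1 ⊗ₜ b p.2)) p.1) f := by
  -- A form on the base change is determined by its values on `M`, so `Λ` has to be the coordinate
  -- form of the extended basis.
  have hvar (p : κ × κ) (R : Type u) [CommRing R] [Algebra A R]
      (g : (ModuleCat.of R (R ⊗[A] M) : ModuleCat.{u} R) →ₗ[R]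
        (ModuleCat.of R (R ⊗[A] M) : ModuleCat.{u} R))
      (Λ : Module.Dual R (ModuleCat.of R (R ⊗[A] M)))
      (hΛ : ∀ x : M, Λ (inclBC R M x) = algebraMap A R (b.coord p.1 x)) :
      Λ (g (inclBC R M (b p.2))) =
        (Algebra.TensorProduct.basis R b).repr (g (1 ⊗ₜ b p.2)) p.1 := by
    have : Λ = (Algebra.TensorProduct.basis R b).coord p.1 := by
      refine (isBC_inclBC (A := A) (R := R) (M := M)).hom_ext fun m ↦ ?_
      refine (hΛ m).trans ?_
      rw [inclBC_apply, Module.Basis.coord_apply, Module.Basis.coord_apply,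
        Algebra.TensorProduct.basis_repr_tmul]
      simp
    rw [this]
    rfl
  -- For the same reason, an extension of `l₁ ⊗ l₂` is the product of the extensions of `l₁` and
  -- `l₂`.
  have hmul {t₁ t₂ : TensorialConstruction} (h₁ : t₁.IsPoly) (h₂ : t₂.IsPoly)
      (l₁ : Module.Dual A (t₁.obj M)) (l₂ : Module.Dual A (t₂.obj M))
      (R : Type u) [CommRing R] [Algebra A R]
      (Λ : Module.Dual R ((tensor t₁ t₂).obj (ModuleCat.of R (R ⊗[A] M))))
      (hΛ : ∀ x, Λ (smap (N := ModuleCat.of R (R ⊗[A] M)) (inclBC R M) (tensor t₁ t₂) x) =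
        algebraMap A R ((LinearMap.mul' A A ∘ₗ TensorProduct.map l₁ l₂) x)) :
      ∃ (Λ₁ : Module.Dual R (t₁.obj (ModuleCat.of R (R ⊗[A] M))))
        (Λ₂ : Module.Dual R (t₂.obj (ModuleCat.of R (R ⊗[A] M)))),
        (∀ x, Λ₁ (smap (N := ModuleCat.of R (R ⊗[A] M)) (inclBC R M) t₁ x) = algebraMap A R (l₁ x)) ∧
        (∀ x, Λ₂ (smap (N := ModuleCat.of R (R ⊗[A] M)) (inclBC R M) t₂ x) = algebraMap A R (l₂ x)) ∧
        ∀ x y, Λ (x ⊗ₜ[R] y) = Λ₁ x * Λ₂ y := by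
    have hb := isBC_inclBC (A := A) (R := R) (M := M)
    refine ⟨dualExt (N := ModuleCat.of R (R ⊗[A] M)) hb h₁ l₁,
      dualExt (N := ModuleCat.of R (R ⊗[A] M)) hb h₂ l₂,
      dualExt_smap (N := ModuleCat.of R (R ⊗[A] M)) hb h₁ l₁,
      dualExt_smap (N := ModuleCat.of R (R ⊗[A] M)) hb h₂ l₂, fun x y ↦ ?_⟩
    set Λ₁ := dualExt (N := ModuleCat.of R (R ⊗[A] M)) hb h₁ l₁ with hΛ₁
    set Λ₂ := dualExt (N := ModuleCat.of R (R ⊗[A] M)) hb h₂ l₂ with hΛ₂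
    suffices Λ = LinearMap.mul' R R ∘ₗ TensorProduct.map Λ₁ Λ₂ from
      LinearMap.congr_fun this (x ⊗ₜ y)
    let F : (t₁.obj M ⊗[A] t₂.obj M) →ₛₗ[algebraMap A R] R :=
      (LinearMap.mul' R R ∘ₗ TensorProduct.map Λ₁ Λ₂).comp (TensorProduct.map
        (smap (N := ModuleCat.of R (R ⊗[A] M)) (inclBC R M) t₁)
        (smap (N := ModuleCat.of R (R ⊗[A] M)) (inclBC R M) t₂))
    have hF (z) : F z = algebraMap A R ((LinearMap.mul' A A ∘ₗ TensorProduct.map l₁ l₂) z) := by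
      induction z using TensorProduct.induction_on with
      | zero => rw [map_zero, map_zero, map_zero]
      | tmul z z' =>
        change Λ₁ (smap _ t₁ z) * Λ₂ (smap _ t₂ z') = algebraMap A R (l₁ z * l₂ z')
        rw [dualExt_smap, dualExt_smap, map_mul]
      | add z z' h h' => rw [map_add, map_add, map_add, h, h']
    exact (isBC_smap (t := tensor t₁ t₂) (N := ModuleCat.of R (R ⊗[A] M)) hb ⟨h₁, h₂⟩).hom_ext
      fun z ↦ (hΛ z).trans (hF z).symm
  -- Constants come from `⋀⁰`, on which `g` acts trivially, sums of polynomials from `⊕`, and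
  -- multiplication by a matrix entry from `⊗` with the variable.
  induction f using MvPolynomial.induction_on with
  | C a =>
    refine ⟨ext 0 var, trivial, exteriorPower.ιMulti A 0 (M := M) Fin.elim0,
      a • (exteriorPower.zeroEquiv A M).toLinearMap, fun R _ _ g Λ hΛ ↦ ?_⟩
    let σ : M →ₛₗ[algebraMap A R] (ModuleCat.of R (R ⊗[A] M) : ModuleCat.{u} R) := inclBC R M
    have h1 : extPowSemilinear 0 g (extPowSemilinear 0 σ (exteriorPower.ιMulti A 0 Fin.elim0)) =
        extPowSemilinear 0 σ (exteriorPower.ιMulti A 0 Fin.elim0) := by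
      rw [extPowSemilinear_ιMulti, extPowSemilinear_ιMulti]
      exact congrArg _ (Subsingleton.elim _ _)
    have h2 : (a • (exteriorPower.zeroEquiv A M).toLinearMap)
        (exteriorPower.ιMulti A 0 (M := M) Fin.elim0) = a := by
      change a * exteriorPower.zeroEquiv A M _ = a
      rw [exteriorPower.zeroEquiv_ιMulti, mul_one]
    rw [MvPolynomial.aeval_C]
    exact (congrArg Λ h1).trans ((hΛ _).trans (congrArg _ h2))
  | add f f' hf hf' =>
    obtain ⟨t₁, h₁, w₁, l₁, H₁⟩ := hf
    obtain ⟨t₂, h₂, w₂, l₂, H₂⟩ := hf'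
    refine ⟨sum t₁ t₂, ⟨h₁, h₂⟩, (w₁, w₂), LinearMap.coprod l₁ l₂, fun R _ _ g Λ hΛ ↦ ?_⟩
    let Λ' : Module.Dual R (t₁.obj (ModuleCat.of R (R ⊗[A] M)) ×
      t₂.obj (ModuleCat.of R (R ⊗[A] M))) := Λ
    rw [map_add, ← H₁ R g (Λ' ∘ₗ LinearMap.inl R _ _), ← H₂ R g (Λ' ∘ₗ LinearMap.inr R _ _)]
    · change Λ' (smap g t₁ _, smap g t₂ _) = Λ' (smap g t₁ _, 0) + Λ' (0, smap g t₂ _)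
      rw [← map_add, Prod.mk_add_mk, add_zero, zero_add]
      rfl
    · intro x
      change Λ' (0, smap _ t₂ x) = _
      rw [← map_zero (smap (N := ModuleCat.of R (R ⊗[A] M)) (inclBC R M) t₁)]
      refine (hΛ (0, x)).trans ?_
      change algebraMap A R (l₁ 0 + l₂ x) = _
      rw [map_zero, zero_add]
    · intro x
      change Λ' (smap _ t₁ x, 0) = _
      rw [← map_zero (smap (N := ModuleCat.of R (R ⊗[A] M)) (inclBC R M) t₂)]
      refine (hΛ (x, 0)).trans ?_
      change algebraMap A R (l₁ x + l₂ 0) = _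
      rw [map_zero, add_zero]
  | mul_X f p hf =>
    obtain ⟨t₁, h₁, w₁, l₁, H₁⟩ := hf
    refine ⟨tensor t₁ var, ⟨h₁, trivial⟩, w₁ ⊗ₜ b p.2,
      LinearMap.mul' A A ∘ₗ TensorProduct.map l₁ (b.coord p.1), fun R _ _ g Λ hΛ ↦ ?_⟩
    obtain ⟨Λ₁, Λ₂, hΛ₁, hΛ₂, h⟩ := hmul (t₂ := var) h₁ trivial l₁ (b.coord p.1) R Λ hΛ
    rw [map_mul, MvPolynomial.aeval_X, ← H₁ R g Λ₁ hΛ₁, ← hvar p R g Λ₂ hΛ₂]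
    exact h _ _

end TensorialConstruction

/-! ### Stabilizers of stable submodules, and equations for `G`. -/

section Stabilizer

open TensorialConstruction

variable {X : Scheme.{u}} {G : Over X} [GrpObj G] {V : X.Modules} {ρ : LinearAction G V}

namespace StableSub

/-- The point `g` of `GL(V)` stabilizes the submodule `S`. -/
def Stab (S : StableSub ρ) (U : X.affineOpens) (R : Type u) [CommRing R] [Algebra Γ(X, U) R]
    (g : GLPoints V U R) : Prop :=
  push g.toLinearMap S.W (pushFiber R S.W (S.sub U)) ≤ pushFiber R S.W (S.sub U)

/-- The direct sum of two stable submodules. -/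
def prod (S T : StableSub ρ) : StableSub ρ where
  W := sum S.W T.W
  isPoly := ⟨S.isPoly, T.isPoly⟩
  sub U := sumSub (S.sub U) (T.sub U)
  push_res U U' h := by rw [push_sum, S.push_res U U' h, T.push_res U U' h]
  stable U R _ _ g hg := by
    rw [push_sum, push_sum, sumSub_le_sumSub]
    exact ⟨S.stable U R g hg, T.stable U R g hg⟩
  sat U a ha v hv := ⟨S.sat U a ha v.1 hv.1, T.sat U a ha v.2 hv.2⟩

theorem stab_prod (S T : StableSub ρ) (U : X.affineOpens) (R : Type u) [CommRing R]
    [Algebra Γ(X, U) R] (g : GLPoints V U R) :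
    (S.prod T).Stab U R g ↔ S.Stab U R g ∧ T.Stab U R g := by
  change push _ (sum S.W T.W) (push _ (sum S.W T.W) (sumSub _ _)) ≤
    push _ (sum S.W T.W) (sumSub _ _) ↔ _
  rw [push_sum, push_sum, sumSub_le_sumSub]
  rfl

/-- An iterated direct sum, since stabilizing a direct sum means stabilizing each summand; `S₀`
starts the induction. -/
theorem exists_stab_of_finset {α : Type*} (S₀ : StableSub ρ) (S : α → StableSub ρ) (F : Finset α) :
    ∃ T : StableSub ρ, ∀ a ∈ F, ∀ (U : X.affineOpens) (R : Type u) [CommRing R]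
      [Algebra Γ(X, U) R] (g : GLPoints V U R), T.Stab U R g → (S a).Stab U R g := by
  classical
  induction F using Finset.induction_on with
  | empty => exact ⟨S₀, by simp⟩
  | insert a F _ h =>
    obtain ⟨T, hT⟩ := h
    refine ⟨(S a).prod T, fun b hb U R _ _ g hg ↦ ?_⟩
    rw [stab_prod] at hg
    rcases Finset.mem_insert.1 hb with rfl | hb
    · exact hg.1
    · exact hT b hb U R g hg.2

end StableSub

theorem resSections_refl (V : X.Modules) (U : X.affineOpens) (m : Γ(V, U)) :
    resSections V (le_refl U) m = m := by
  have : (homOfLE (le_refl (U : X.Opens))).op = 𝟙 (op (U : X.Opens)) := rfl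
  exact (congrArg (fun i ↦ V.presheaf.map i m) this).trans
    (by rw [CategoryTheory.Functor.map_id]; rfl)

/-- The matrix entries of a point of `GL(V)`. -/
def matEntries {κ : Type} [Finite κ] {U : X.affineOpens}
    (b : Module.Basis κ Γ(X, U) (sections V U)) (R : Type u) [CommRing R] [Algebra Γ(X, U) R]
    (g : GLPoints V U R) (p : κ × κ) : R :=
  (Algebra.TensorProduct.basis R b).repr (g (1 ⊗ₜ b p.2)) p.1

/-- `R₀` is the coordinate ring of `GL_n`, that is the polynomial ring in the entries with the
determinant `d` inverted, and `g₀` is the generic matrix. -/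
theorem exists_generic (U : X.affineOpens) {κ : Type} [Fintype κ]
    [DecidableEq κ] (b : Module.Basis κ Γ(X, U) (sections V U)) :
    ∃ (R₀ : Type u) (_ : CommRing R₀) (_ : Algebra Γ(X, U) R₀)
      (_ : Algebra (MvPolynomial (κ × κ) Γ(X, U)) R₀) (d : MvPolynomial (κ × κ) Γ(X, U))
      (_ : IsLocalization.Away d R₀) (_ : IsScalarTower Γ(X, U) (MvPolynomial (κ × κ) Γ(X, U)) R₀)
      (g₀ : GLPoints V U R₀), ∀ (R : Type u) [CommRing R] [Algebra Γ(X, U) R]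
        (g : GLPoints V U R), ∃ φ : R₀ →ₐ[Γ(X, U)] R,
        (∀ f : MvPolynomial (κ × κ) Γ(X, U), φ (algebraMap _ R₀ f) = MvPolynomial.aeval (matEntries b R g) f) ∧
        ∀ v : R₀ ⊗[Γ(X, U)] Γ(V, U), g (φ.toLinearMap.rTensor Γ(V, U) v) =
          φ.toLinearMap.rTensor Γ(V, U) (g₀ v) := by
  let P := MvPolynomial (κ × κ) Γ(X, U)
  let d : P := (Matrix.of fun i j ↦ (MvPolynomial.X (i, j) : P)).det
  let R₀ := Localization.Away d
  let M : Matrix κ κ R₀ := Matrix.of fun i j ↦ algebraMap P R₀ (MvPolynomial.X (i, j))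
  have hM : M.det = algebraMap P R₀ d := by
    rw [RingHom.map_det]
    rfl
  have hMu : IsUnit M.det := hM ▸ IsLocalization.Away.algebraMap_isUnit d
  let b₀ := Algebra.TensorProduct.basis R₀ b
  refine ⟨R₀, inferInstance, inferInstance, inferInstance, d, inferInstance, inferInstance,
    Matrix.toLinearEquiv b₀ M hMu, fun R _ _ g ↦ ?_⟩
  let b₁ := Algebra.TensorProduct.basis R b
  have hd : IsUnit (MvPolynomial.aeval (matEntries b R g) d) := by
    have h1 : MvPolynomial.aeval (matEntries b R g) d =
        (LinearMap.toMatrix b₁ b₁ g.toLinearMap).det := by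
      rw [AlgHom.map_det]
      congr 1
      ext i j
      simp [matEntries, LinearMap.toMatrix_apply, b₁]
    rw [h1]
    exact LinearEquiv.isUnit_det g b₁ b₁
  let φ : R₀ →ₐ[Γ(X, U)] R := IsLocalization.liftAlgHom (M := Submonoid.powers d)
    (f := MvPolynomial.aeval (matEntries b R g)) (by
      rintro ⟨_, n, rfl⟩
      rw [map_pow]
      exact hd.pow n)
  have hφ (f : P) : φ (algebraMap P R₀ f) = MvPolynomial.aeval (matEntries b R g) f :=
    IsLocalization.lift_eq _ f
  refine ⟨φ, hφ, fun v ↦ ?_⟩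
  have hc : φ.toRingHom.comp (algebraMap Γ(X, U) R₀) =
      (algebraMap Γ(X, U) R).comp (resRing le_rfl) := by
    rw [resRing_refl]
    exact φ.comp_algebraMap
  have h2 (v : fiber V U R₀) : φ.toLinearMap.rTensor Γ(V, U) v = trans V le_rfl φ.toRingHom hc v := by
    induction v using TensorProduct.induction_on with
    | zero => rw [map_zero, map_zero]
    | tmul r m =>
      rw [trans_tmul, resSections_refl]
      rfl
    | add x y hx hy => rw [map_add, map_add, hx, hy]
  rw [h2, h2]
  suffices g.toLinearMap.comp (trans V le_rfl φ.toRingHom hc) =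
      (trans V le_rfl φ.toRingHom hc).comp (Matrix.toLinearEquiv b₀ M hMu).toLinearMap from
    LinearMap.congr_fun this v
  refine b₀.ext fun j ↦ ?_
  have h3 (i : κ) : trans V le_rfl φ.toRingHom hc (b₀ i) = b₁ i := by
    rw [Algebra.TensorProduct.basis_apply, Algebra.TensorProduct.basis_apply, trans_tmul,
      resSections_refl, map_one]
  have h4 : Matrix.toLinearEquiv b₀ M hMu (b₀ j) = ∑ i, M i j • b₀ i := by
    change Matrix.toLin b₀ b₀ M (b₀ j) = _
    rw [Matrix.toLin_self]
  change g (trans V le_rfl φ.toRingHom hc (b₀ j)) =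
    trans V le_rfl φ.toRingHom hc (Matrix.toLinearEquiv b₀ M hMu (b₀ j))
  rw [h3, h4, map_sum]
  have h5 (i : κ) : trans V le_rfl φ.toRingHom hc (M i j • b₀ i) = matEntries b R g (i, j) • b₁ i := by
    rw [LinearMap.map_smulₛₗ, h3]
    congr 1
    exact (hφ _).trans (MvPolynomial.aeval_X _ _)
  rw [Finset.sum_congr rfl fun i _ ↦ h5 i]
  refine (b₁.sum_repr (g (b₁ j))).symm.trans ?_
  refine Finset.sum_congr rfl fun i _ ↦ ?_
  congr 1
  rw [Algebra.TensorProduct.basis_apply]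
  rfl

/-- Closedness, applied to the generic matrix, gives an ideal `I` of the coordinate ring of `GL_n`.
Its contraction to the polynomial ring is finitely generated by Hilbert's basis theorem, and defines
the same points because the determinant is invertible on them. -/
theorem exists_equations (hρ : ρ.IsClosedImmersion) (U : X.affineOpens) [IsNoetherianRing Γ(X, U)]
    {κ : Type} [Fintype κ] [DecidableEq κ] (b : Module.Basis κ Γ(X, U) (sections V U)) :
    ∃ F : Finset (MvPolynomial (κ × κ) Γ(X, U)), ∀ (R : Type u) [CommRing R] [Algebra Γ(X, U) R]
      (g : GLPoints V U R),
      g ∈ GPts ρ U R ↔ ∀ f ∈ F, MvPolynomial.aeval (matEntries b R g) f = 0 := by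
  obtain ⟨R₀, _, _, _, d, _, _, g₀, H⟩ := exists_generic U b
  obtain ⟨I, hI⟩ := hρ.closed U R₀ g₀
  let P := MvPolynomial (κ × κ) Γ(X, U)
  obtain ⟨F, hF⟩ := (isNoetherian_def.1 (inferInstanceAs (IsNoetherian P P)))
    (I.comap (algebraMap P R₀))
  refine ⟨F, fun R _ _ g ↦ ?_⟩
  obtain ⟨φ, hφ, hg⟩ := H R g
  refine (hI R φ g hg).trans ⟨fun h f hf ↦ ?_, fun h a ha ↦ ?_⟩
  · rw [← hφ]
    apply h
    have : f ∈ Submodule.span P (F : Set P) := Submodule.subset_span hf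
    rw [hF] at this
    exact this
  · obtain ⟨n, f, hf⟩ := IsLocalization.Away.surj d a
    have h1 : f ∈ I.comap (algebraMap P R₀) := by
      rw [Ideal.mem_comap, ← hf]
      exact I.mul_mem_right _ ha
    rw [← hF] at h1
    have h2 : Submodule.span P (F : Set P) ≤
        RingHom.ker (MvPolynomial.aeval (matEntries b R g) : P →ₐ[Γ(X, U)] R) :=
      Ideal.span_le.2 fun f hf ↦ h f hf
    have h3 : φ a * φ (algebraMap P R₀ d) ^ n = 0 := by
      rw [← map_pow, ← map_mul, hf, hφ]
      exact h2 h1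
    have h4 : IsUnit (φ (algebraMap P R₀ d) ^ n) :=
      ((IsLocalization.Away.algebraMap_isUnit d).map φ).pow n
    exact (h4.mul_left_eq_zero).1 h3

end Stabilizer

/-! ### Realizing `G` as a stabilizer over one affine open. -/

section Stabilizer

open TensorialConstruction

variable {X : Scheme.{u}} {G : Over X} [GrpObj G] {V : X.Modules} (ρ : LinearAction G V)

omit [GrpObj G] in
theorem smap_toFib_refl {t : TensorialConstruction} (ht : t.IsPoly) {U : X.affineOpens} (R : Type u)
    [CommRing R] [Algebra Γ(X, U) R] (x : t.obj (sections V U)) :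
    smap (N := fiber V U R) (toFib V le_rfl R) t x =
      smap (N := fiber V U R) (inclBC R (sections V U)) t x := by
  refine (smap_comp (N := fiber V U R) (P := fiber V U R)
    (inclBC R (sections V U)) LinearMap.id _
    (fun m ↦ toFib_refl R m) ?_ ht x).trans ?_
  · rw [resRing_refl]
    rfl
  · exact smap_id _ (fun _ ↦ rfl) ht _

omit [GrpObj G] in
theorem extForm_inclBC (hV : V.IsQuasicoherent) {t : TensorialConstruction} (ht : t.IsPoly)
    {U : X.affineOpens} (R : Type u) [CommRing R] [Algebra Γ(X, U) R]
    (l : Module.Dual Γ(X, U) (t.obj (sections V U))) (x : t.obj (sections V U)) :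
    extForm hV ht (IsBasicIn.refl U) R l (smap (N := fiber V U R) (inclBC R (sections V U)) t x) =
      algebraMap Γ(X, U) R (l x) := by
  rw [← smap_toFib_refl ht, extForm_toFib, resRing_refl]
  rfl

variable [TopologicalSpace.NoetherianSpace X] [IsAffineHom G.hom] [Flat G.hom]

/-- Write `f(g) = l(g w)` and let `S` be the stable submodule defined by `l`. Then `w ∈ S` because
`f` vanishes on `G`. If `g` stabilizes `S`, then `g w` lies in the extension of `S` to `R`, on which
`l` vanishes. -/
theorem exists_stab_le_hypersurface (hV : V.IsQuasicoherent) (U : X.affineOpens) {κ : Type}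
    [Finite κ] (b : Module.Basis κ Γ(X, U) (sections V U)) (f : MvPolynomial (κ × κ) Γ(X, U))
    (hf : ∀ (R : Type u) [CommRing R] [Algebra Γ(X, U) R], ∀ g ∈ GPts ρ U R,
      MvPolynomial.aeval (matEntries b R g) f = 0) :
    ∃ S : StableSub ρ, ∀ (R : Type u) [CommRing R] [Algebra Γ(X, U) R] (g : GLPoints V U R),
      S.Stab U R g → MvPolynomial.aeval (matEntries b R g) f = 0 := by
  obtain ⟨t, ht, w, l, H⟩ := exists_matrixCoeff b f
  have heval (R : Type u) [CommRing R] [Algebra Γ(X, U) R] (g : GLPoints V U R) :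
      evalPt hV ht (IsBasicIn.refl U) le_rfl R l g w =
        MvPolynomial.aeval (matEntries b R g) f := by
    rw [evalPt_apply, smap_toFib_refl ht]
    exact H R g.toLinearMap _ (extForm_inclBC hV ht R l)
  let S := StableSub.ofForms ρ hV ht (fun _ : Unit ↦ U) fun _ ↦ l
  refine ⟨S, fun R _ _ g hg ↦ ?_⟩
  have hw : w ∈ S.sub U := by
    intro _ W h h' R _ _ g hg
    let : Algebra Γ(X, U) R := ((algebraMap Γ(X, W) R).comp (resRing h.le)).toAlgebra
    obtain ⟨g₂, hg₂, hg₂'⟩ := exists_mem_GPts_of_mem ρ h.le rfl g hg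
    have := evalPt_trans hV ht (IsBasicIn.refl U) h' le_rfl h.le _ rfl l g₂ g hg₂' w
    rw [heval, hf R g₂ hg₂, map_zero] at this
    exact this
  have h1 := hg (smap_mem_push g.toLinearMap (smap_mem_push (N := fiber V U R)
    (inclBC R (sections V U)) hw))
  -- The identity point of `G` shows that `S` lies in the kernel of `l`.
  have h2 : pushFiber R t (stableKer ρ hV ht (fun _ : Unit ↦ U) (fun _ ↦ l) U) ≤ LinearMap.ker (extForm hV ht (IsBasicIn.refl U) R l) := by
    rw [push_le_iff]
    intro v hv
    have h3 := hv () U (IsBasicIn.refl U) (IsBasicIn.refl U) R 1 (one_mem _)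
    rw [evalPt_apply, smap_toFib_refl ht] at h3
    rwa [smap_id _ (fun _ ↦ rfl) ht] at h3
  have h3 := heval R g
  rw [evalPt_apply, smap_toFib_refl ht] at h3
  rw [← h3]
  exact h2 h1

theorem exists_stab_le_GPts (hV : V.IsQuasicoherent) (hρ : ρ.IsClosedImmersion)
    (U : X.affineOpens) [IsNoetherianRing Γ(X, U)] [Module.Free Γ(X, U) Γ(V, U)]
    [Module.Finite Γ(X, U) Γ(V, U)] :
    ∃ S : StableSub ρ, ∀ (R : Type u) [CommRing R] [Algebra Γ(X, U) R] (g : GLPoints V U R),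
      S.Stab U R g → g ∈ GPts ρ U R := by
  classical
  let b₀ := Module.Free.chooseBasis Γ(X, U) Γ(V, U)
  let b : Module.Basis (Fin (Fintype.card (Module.Free.ChooseBasisIndex Γ(X, U) Γ(V, U))))
    Γ(X, U) (sections V U) := b₀.reindex (Fintype.equivFin _)
  obtain ⟨F, hF⟩ := exists_equations hρ U b
  have hS (f : F) := exists_stab_le_hypersurface ρ hV U b f.1
    fun R _ _ g hg ↦ (hF R g).1 hg f.1 f.2
  choose S hS using hS
  -- With no linear forms there is no condition, so `S₀` is all of `V`.
  let S₀ : StableSub ρ := StableSub.ofForms ρ hV (t := var) trivial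
    (J := Empty) (fun j ↦ j.elim) fun j ↦ j.elim
  obtain ⟨T, hT⟩ := StableSub.exists_stab_of_finset S₀ S Finset.univ
  refine ⟨T, fun R _ _ g hg ↦ (hF R g).2 fun f hf ↦ ?_⟩
  exact hS ⟨f, hf⟩ R g (hT ⟨f, hf⟩ (Finset.mem_univ _) U R g hg)

end Stabilizer

/-! ### Local freeness and split bases. -/

section SplitBasis

/-- The base change of the retraction `π` makes `B ⊗ P` a direct summand of `T'`, with no flatness
of `B`. Composing it with the coordinates of a basis gives the dual forms. -/
theorem hasSplitBasis_span_image {A B : Type u} [CommRing A] [CommRing B] [Algebra A B]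
    {T T' : Type u} [AddCommGroup T] [Module A T] [AddCommGroup T'] [Module B T']
    {σ : T →ₛₗ[algebraMap A B] T'} (hσ : IsBC σ) (P : Submodule A T) (π : T →ₗ[A] P)
    (hπ : ∀ p : P, π p = p) [Module.Free B (B ⊗[A] P)] [Module.Finite B (B ⊗[A] P)] :
    ∃ d, HasSplitBasis (Submodule.span B (σ '' P)) d := by
  let β₀ := Module.Free.chooseBasis B (B ⊗[A] P)
  let β := β₀.reindex (Fintype.equivFin _)
  let i : B ⊗[A] P →ₗ[B] T' := liftBC (σ.comp P.subtype)
  let r : T' →ₗ[B] B ⊗[A] P := hσ.lift ((inclBC B P).comp π)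
  have hi (m : P) : i (inclBC B P m) = σ m := (liftBC_tmul _ _ _).trans (one_smul _ _)
  have hri : r ∘ₗ i = LinearMap.id := by
    refine (isBC_inclBC (A := A) (R := B) (M := P)).hom_ext fun m ↦ ?_
    change r (i (inclBC B P m)) = inclBC B P m
    rw [hi]
    refine (hσ.lift_apply _ _).trans ?_
    change inclBC B P (π m) = _
    rw [hπ]
  refine ⟨_, fun a ↦ i (β a), fun a ↦ β.coord a ∘ₗ r, fun a b ↦ ?_, ?_⟩
  · have : r (i (β b)) = β b := LinearMap.congr_fun hri (β b)
    rw [LinearMap.comp_apply, this, Module.Basis.coord_apply, Module.Basis.repr_self,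
      Finsupp.single_apply]
    simp [eq_comm]
  · have h1 : Set.range (fun a ↦ i (β a)) = i '' Set.range β := by
      rw [← Set.range_comp]
      rfl
    have h2 : σ '' P = i '' Set.range (inclBC B P : P → B ⊗[A] P) := by
      rw [← Set.range_comp]
      ext x
      constructor
      · rintro ⟨m, hm, rfl⟩
        exact ⟨⟨m, hm⟩, hi _⟩
      · rintro ⟨m, rfl⟩
        exact ⟨m, m.2, (hi m).symm⟩
    rw [h1, h2, Submodule.span_image, Submodule.span_image, β.span_eq, span_range_inclBC]

/-- A finitely presented flat module is free over the local ring at `p`, and freeness spreads out to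
the complement of a single `r ∉ p`. -/
theorem exists_away_free {A : Type u} [CommRing A] (P : Type u) [AddCommGroup P] [Module A P]
    [Module.FinitePresentation A P] [Module.Flat A P] (p : Ideal A) [p.IsPrime] :
    ∃ r ∉ p, ∀ (B : Type u) [CommRing B] [Algebra A B] [IsLocalization.Away r B],
      Module.Free B (B ⊗[A] P) := by
  have : Module.Free (Localization.AtPrime p) (LocalizedModule p.primeCompl P) :=
    Module.free_of_flat_of_isLocalRing
  obtain ⟨r, hr, hfree, -⟩ := Module.FinitePresentation.exists_free_localizedModule_powers
    p.primeCompl (LocalizedModule.mkLinearMap p.primeCompl P) (Localization.AtPrime p)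
  refine ⟨r, hr, fun B _ _ _ ↦ ?_⟩
  let f : Localization.Away r →ₐ[A] B := IsLocalization.liftAlgHom (M := Submonoid.powers r)
    (f := Algebra.ofId A B) (by
      rintro ⟨_, n, rfl⟩
      rw [map_pow]
      exact (IsLocalization.Away.algebraMap_isUnit r).pow n)
  let : Algebra (Localization.Away r) B := f.toRingHom.toAlgebra
  have : IsScalarTower A (Localization.Away r) B := .of_algebraMap_eq fun a ↦ (f.commutes a).symm
  have hb := IsLocalizedModule.isBaseChange (Submonoid.powers r) (Localization.Away r)
    (LocalizedModule.mkLinearMap (Submonoid.powers r) P)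
  have : Module.Free (Localization.Away r) (Localization.Away r ⊗[A] P) :=
    Module.Free.of_equiv hb.equiv.symm
  exact Module.Free.of_equiv (AlgebraTensorModule.cancelBaseChange A (Localization.Away r) B B P)

theorem HasSplitBasis.rank_unique {A W : Type u} [CommRing A] [Nontrivial A] [AddCommGroup W]
    [Module A W] {P : Submodule A W} {d d' : ℕ} (h : HasSplitBasis P d) (h' : HasSplitBasis P d') :
    d = d' := by
  have key {d : ℕ} (h : HasSplitBasis P d) : Module.finrank A P = d := by
    obtain ⟨p, φ, hp, rfl⟩ := h
    have hl : LinearIndependent A p := by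
      rw [Fintype.linearIndependent_iff]
      intro c hc a
      have := congrArg (φ a) hc
      simpa [hp] using this
    rw [finrank_span_eq_card hl, Fintype.card_fin]
  rw [← key h, key h']

theorem HasSplitBasis.prod_bot {A W : Type u} [CommRing A] [AddCommGroup W] [Module A W]
    {P : Submodule A W} {d : ℕ} (h : HasSplitBasis P d) (N : Type u) [AddCommGroup N] [Module A N] :
    HasSplitBasis (P.prod (⊥ : Submodule A N)) d := by
  obtain ⟨p, φ, hp, rfl⟩ := h
  refine ⟨fun a ↦ LinearMap.inl A W N (p a), fun a ↦ φ a ∘ₗ LinearMap.fst A W N, hp, ?_⟩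
  have h1 : Set.range (fun a ↦ LinearMap.inl A W N (p a)) =
      LinearMap.inl A W N '' Set.range p := by
    rw [← Set.range_comp]
    rfl
  rw [h1, Submodule.span_image, Submodule.map_inl]

theorem HasSplitBasis.prod_top {A W : Type u} [CommRing A] [AddCommGroup W] [Module A W]
    {P : Submodule A W} {d : ℕ} (h : HasSplitBasis P d) {N : Type u} [AddCommGroup N] [Module A N]
    (e : N ≃ₗ[A] A) : HasSplitBasis (P.prod (⊤ : Submodule A N)) (d + 1) := by
  obtain ⟨p, φ, hp, rfl⟩ := h
  refine ⟨Fin.cons (0, e.symm 1) fun a ↦ (p a, 0), Fin.cons (e.toLinearMap ∘ₗ LinearMap.snd A W N)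
    fun a ↦ φ a ∘ₗ LinearMap.fst A W N, fun a b ↦ ?_, ?_⟩
  · refine Fin.cases ?_ (fun a ↦ ?_) a <;> refine Fin.cases ?_ (fun b ↦ ?_) b <;>
      simp [hp, Fin.succ_ne_zero, (Fin.succ_ne_zero _).symm]
  · rw [Fin.range_cons, Submodule.span_insert]
    have h1 : Set.range (fun a ↦ ((p a, 0) : W × N)) = LinearMap.inl A W N '' Set.range p := by
      rw [← Set.range_comp]
      rfl
    rw [h1, Submodule.span_image]
    apply le_antisymm
    · rw [sup_le_iff, Submodule.span_singleton_le_iff_mem, Submodule.map_le_iff_le_comap]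
      exact ⟨⟨zero_mem _, trivial⟩, fun x hx ↦ ⟨hx, trivial⟩⟩
    · rintro ⟨x, y⟩ ⟨hx, -⟩
      rw [Submodule.mem_sup]
      refine ⟨_, Submodule.smul_mem _ (e y) (Submodule.mem_span_singleton_self _), _,
        Submodule.mem_map_of_mem (f := LinearMap.inl A W N) hx, ?_⟩
      simp [← map_smul]

end SplitBasis

/-! ### Transport of stabilizers between opens. -/

section Transport

open TensorialConstruction

variable {X : Scheme.{u}} {G : Over X} [GrpObj G] {V : X.Modules} {ρ : LinearAction G V}

namespace StableSub

variable (S : StableSub ρ)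

theorem push_toFib {U U' : X.affineOpens} (h : IsBasicIn U' U) (R : Type u) [CommRing R]
    [Algebra Γ(X, U') R] :
    push (N := fiber V U' R) (toFib V h.le R) S.W (S.sub U) = pushFiber R S.W (S.sub U') := by
  rw [← S.push_res U U' h]
  exact (push_push (N := sections V U') (P := fiber V U' R) _ _ _ (fun m ↦ rfl) rfl S.isPoly _).symm

theorem push_trans {U U' : X.affineOpens} (h : IsBasicIn U' U) {R R' : Type u} [CommRing R]
    [CommRing R'] [Algebra Γ(X, U) R] [Algebra Γ(X, U') R'] (φ : R →+* R')
    (hφ : φ.comp (algebraMap Γ(X, U) R) = (algebraMap Γ(X, U') R').comp (resRing h.le)) :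
    push (trans V h.le φ hφ) S.W (pushFiber R S.W (S.sub U)) = pushFiber R' S.W (S.sub U') := by
  rw [← S.push_toFib h]
  exact push_push _ _ _ (fun m ↦ (trans_inclBC V h.le φ hφ m).symm) hφ.symm S.isPoly _

theorem push_trans_equiv {t : TensorialConstruction} (ht : t.IsPoly) {U U' : X.affineOpens}
    (h : U' ≤ U) {R R' : Type u} [CommRing R]
    [CommRing R'] [Algebra Γ(X, U) R] [Algebra Γ(X, U') R'] (φ : R →+* R')
    (hφ : φ.comp (algebraMap Γ(X, U) R) = (algebraMap Γ(X, U') R').comp (resRing h))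
    (g : GLPoints V U R) (g' : GLPoints V U' R')
    (hg : ∀ v, trans V h φ hφ (g v) = g' (trans V h φ hφ v))
    (L : Submodule R (t.obj (fiber V U R))) :
    push g'.toLinearMap t (push (trans V h φ hφ) t L) =
      push (trans V h φ hφ) t (push g.toLinearMap t L) := by
  rw [push_push g.toLinearMap (trans V h φ hφ) ((trans V h φ hφ).comp g.toLinearMap)
    (fun _ ↦ rfl) rfl ht, push_push _ _ ((trans V h φ hφ).comp g.toLinearMap) hg rfl ht]

theorem exists_fiberEquiv (hV : V.IsQuasicoherent) {U U' : X.affineOpens} (h : IsBasicIn U' U)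
    {R : Type u} [CommRing R] [Algebra Γ(X, U) R] [Algebra Γ(X, U') R]
    (hR : (RingHom.id R).comp (algebraMap Γ(X, U) R) =
      (algebraMap Γ(X, U') R).comp (resRing h.le)) :
    ∃ e : fiber V U R ≃ₗ[R] fiber V U' R, e.toLinearMap = trans V h.le (RingHom.id R) hR := by
  refine ⟨LinearEquiv.ofBijective (trans V h.le (RingHom.id R) hR)
    ⟨trans_id_injective hV h hR, ?_⟩, rfl⟩
  have h1 := (isBC_trans V h.le _ hR hV h).span_range
  have h2 : Set.range (trans V h.le (RingHom.id R) hR) =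
      (LinearMap.range (trans V h.le (RingHom.id R) hR) : Set (fiber V U' R)) := rfl
  rw [← LinearMap.range_eq_top, ← h1, h2]
  exact (Submodule.span_eq _).symm

/-- A point over `U'` is also a point over `U` with values in the same ring. The isomorphism `e` of
the two fibers carries `g`, the extended submodules and membership in `G` across. -/
theorem stab_of_trans {U U' : X.affineOpens} (h : IsBasicIn U' U)
    (hS : ∀ (R : Type u) [CommRing R] [Algebra Γ(X, U) R] (g : GLPoints V U R),
      S.Stab U R g → g ∈ GPts ρ U R) (hV : V.IsQuasicoherent)
    (R : Type u) [CommRing R] [Algebra Γ(X, U') R] (g : GLPoints V U' R) (hg : S.Stab U' R g) :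
    g ∈ GPts ρ U' R := by
  let : Algebra Γ(X, U) R := ((algebraMap Γ(X, U') R).comp (resRing h.le)).toAlgebra
  obtain ⟨e, he⟩ := exists_fiberEquiv hV h (R := R) rfl
  have he' (v) : e v = trans V h.le (RingHom.id R) rfl v := LinearMap.congr_fun he v
  let g₂ : GLPoints V U R := e ≪≫ₗ g ≪≫ₗ e.symm
  have hg₂ (v) : trans V h.le (RingHom.id R) rfl (g₂ v) =
      g (trans V h.le (RingHom.id R) rfl v) := by
    rw [← he', ← he']
    exact e.apply_symm_apply _
  refine mem_GPts_of_trans ρ hV h (RingHom.id R) rfl (hS R g₂ ?_) g hg₂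
  have h1 : ∀ L : Submodule R (S.W.obj (fiber V U R)), push e.symm.toLinearMap S.W
      (push (trans V h.le (RingHom.id R) rfl) S.W L) = L := fun L ↦ by
    rw [← he, push_push e.toLinearMap e.symm.toLinearMap LinearMap.id
      (fun m ↦ (e.symm_apply_apply m).symm) rfl S.isPoly]
    have h2 : smap LinearMap.id S.W '' (L : Set (S.W.obj (fiber V U R))) = L := by
      refine (Set.image_congr fun x _ ↦ smap_id _ (fun _ ↦ ?_) S.isPoly x).trans (Set.image_id _)
      rfl
    rw [push, h2, Submodule.span_eq]
  rw [Stab, ← h1 (push g₂.toLinearMap S.W _), ← push_trans_equiv S.isPoly h.le _ rfl g₂ g hg₂,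
    S.push_trans h]
  conv_rhs => rw [← h1 (pushFiber R S.W (S.sub U)), S.push_trans h]
  exact Submodule.span_mono (Set.image_mono hg)

end StableSub

end Transport

/-! ### Saturated submodules over Dedekind domains. -/

section Dedekind

/-- Saturation says that `T ⧸ P` is torsion-free. Over a Dedekind domain it is then flat, and being
finitely presented it is projective, so the quotient map splits. -/
theorem exists_retraction {A T : Type u} [CommRing A] [IsDedekindDomain A] [AddCommGroup T]
    [Module A T] [Module.Finite A T] (P : Submodule A T)
    (hP : ∀ a ∈ nonZeroDivisors A, ∀ v : T, a • v ∈ P → v ∈ P) :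
    ∃ π : T →ₗ[A] P, ∀ p : P, π p = p := by
  have : Module.IsTorsionFree A (T ⧸ P) := ⟨fun a ha x y hxy ↦ by
    obtain ⟨x, rfl⟩ := P.mkQ_surjective x
    obtain ⟨y, rfl⟩ := P.mkQ_surjective y
    change a • P.mkQ x = a • P.mkQ y at hxy
    rw [← map_smul, ← map_smul, ← sub_eq_zero, ← map_sub, ← smul_sub, Submodule.mkQ_apply,
      Submodule.Quotient.mk_eq_zero] at hxy
    rw [← sub_eq_zero, ← map_sub, Submodule.mkQ_apply, Submodule.Quotient.mk_eq_zero]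
    exact hP a (isRegular_iff_mem_nonZeroDivisors.1 ha) _ hxy⟩
  have : Module.FinitePresentation A (T ⧸ P) := Module.finitePresentation_of_finite A _
  have : Module.Projective A (T ⧸ P) := Module.Flat.projective_of_finitePresentation
  obtain ⟨s, hs⟩ := Module.projective_lifting_property P.mkQ LinearMap.id P.mkQ_surjective
  have hs' (x : T ⧸ P) : P.mkQ (s x) = x := LinearMap.congr_fun hs x
  have hmem (v : T) : (LinearMap.id - s ∘ₗ P.mkQ : T →ₗ[A] T) v ∈ P := by
    rw [← Submodule.Quotient.mk_eq_zero, ← Submodule.mkQ_apply, LinearMap.sub_apply, map_sub,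
      LinearMap.comp_apply, hs', LinearMap.id_apply, sub_self]
  refine ⟨(LinearMap.id - s ∘ₗ P.mkQ : T →ₗ[A] T).codRestrict P hmem, fun p ↦ ?_⟩
  apply Subtype.ext
  have : P.mkQ p = 0 := by simp
  rw [LinearMap.codRestrict_apply, LinearMap.sub_apply, LinearMap.comp_apply, this, map_zero,
    sub_zero, LinearMap.id_apply]

end Dedekind

/-! ### Opens on which everything is free. -/

section Cover

open TensorialConstruction

variable {X : Scheme.{u}} {V : X.Modules}

theorem free_finite_of_isBasicIn (hV : V.IsQuasicoherent) {U' U : X.affineOpens}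
    (h : IsBasicIn U' U) (h1 : Module.Free Γ(X, U) Γ(V, U)) (h2 : Module.Finite Γ(X, U) Γ(V, U)) :
    Module.Free Γ(X, U') Γ(V, U') ∧ Module.Finite Γ(X, U') Γ(V, U') := by
  let : Algebra Γ(X, U) Γ(X, U') := (resRing h.le).toAlgebra
  exact ⟨Module.Free.of_equiv (isBC_resMod V hV h).equiv,
    Module.Finite.equiv (isBC_resMod V hV h).equiv⟩

/-- The point `x` guarantees that the basic open is nonempty, so that a nonzero function is inverted
and the localization is still a domain. -/
theorem isDedekindDomain_of_isBasicIn {U' U : X.affineOpens} (h : IsBasicIn U' U)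
    [IsDedekindDomain Γ(X, U)] {x : X} (hx : x ∈ (U' : X.Opens)) : IsDedekindDomain Γ(X, U') := by
  obtain ⟨f, hf⟩ := id h
  let : Algebra Γ(X, U) Γ(X, U') := (resRing h.le).toAlgebra
  have : IsLocalization.Away f Γ(X, U') :=
    U.2.isLocalization_of_eq_basicOpen f (homOfLE h.le) hf
  have hM : Submonoid.powers f ≤ nonZeroDivisors Γ(X, U) := by
    refine powers_le_nonZeroDivisors_of_noZeroDivisors ?_
    rintro rfl
    rw [hf, Scheme.basicOpen_zero] at hx
    exact hx
  have : IsDomain Γ(X, U') := IsLocalization.isDomain_of_le_nonZeroDivisors Γ(X, U') hM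
  exact IsLocalization.isDedekindDomain _ hM _

theorem exists_dedekind_free (hX : IsDedekindScheme X) (hV : IsVectorBundle V) (x : X) :
    ∃ U : X.affineOpens, x ∈ (U : X.Opens) ∧ IsDedekindDomain Γ(X, U) ∧
      Module.Free Γ(X, U) Γ(V, U) ∧ Module.Finite Γ(X, U) Γ(V, U) := by
  obtain ⟨s, -, hs, hD⟩ := hX
  have hx : x ∈ (⨆ U ∈ s, (U : X.Opens)) := hs ▸ trivial
  simp only [TopologicalSpace.Opens.mem_iSup] at hx
  obtain ⟨U₁, hU₁, hx₁⟩ := hx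
  obtain ⟨U₂, hx₂, h1, h2⟩ := hV.locally_free x
  obtain ⟨W, hxW, hW₁, hW₂⟩ := IsBasicIn.exists_mem_inter hx₁ hx₂
  have := hD U₁ hU₁
  exact ⟨W, hxW, isDedekindDomain_of_isBasicIn hW₁ hxW,
    free_finite_of_isBasicIn hV.isQuasicoherent hW₂ h1 h2⟩

theorem IsDedekindScheme.noetherianSpace (hX : IsDedekindScheme X) :
    TopologicalSpace.NoetherianSpace X := by
  obtain ⟨s, hfin, hs, hD⟩ := hX
  rw [← TopologicalSpace.noetherian_univ_iff, ← TopologicalSpace.Opens.coe_top, ← hs]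
  have : ((⨆ U ∈ s, (U : X.Opens) : X.Opens) : Set X) = ⋃ U : s, ((U : X.affineOpens) : Set X) := by
    ext x
    simp
  rw [this]
  have := hfin.to_subtype
  have (U : s) : TopologicalSpace.NoetherianSpace ((U : X.affineOpens) : Set X) := by
    have := hD U U.2
    exact noetherianSpace_of_isAffineOpen _ U.1.2
  exact TopologicalSpace.NoetherianSpace.iUnion _

variable {G : Over X} [GrpObj G] {ρ : LinearAction G V}

/-- As a direct summand of a free module, the submodule over `U` is projective, hence free near the
prime of `x`; the retraction supplies the dual forms there. -/
theorem StableSub.exists_hasSplitBasis (S : StableSub ρ) (hV : V.IsQuasicoherent)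
    (U : X.affineOpens) [IsDedekindDomain Γ(X, U)] (h1 : Module.Free Γ(X, U) Γ(V, U))
    (h2 : Module.Finite Γ(X, U) Γ(V, U)) {x : X} (hx : x ∈ (U : X.Opens)) :
    ∃ U' : X.affineOpens, x ∈ (U' : X.Opens) ∧ IsBasicIn U' U ∧ ∃ d, HasSplitBasis (S.sub U') d := by
  have hU : IsAffineOpen (U : X.Opens) := U.2
  obtain ⟨_, _⟩ := free_finite_obj (M := sections V U) h1 h2 S.isPoly
  obtain ⟨π, hπ⟩ := exists_retraction (S.sub U) (S.sat U)
  have : Module.Projective Γ(X, U) (S.sub U) :=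
    Module.Projective.of_split (S.sub U).subtype π (LinearMap.ext hπ)
  have : Module.FinitePresentation Γ(X, U) (S.sub U) := Module.finitePresentation_of_finite _ _
  obtain ⟨r, hr, H⟩ := exists_away_free (S.sub U) (hU.primeIdealOf ⟨x, hx⟩).asIdeal
  let U' : X.affineOpens := ⟨X.basicOpen r, hU.basicOpen r⟩
  have hU' : IsBasicIn U' U := ⟨r, rfl⟩
  refine ⟨U', ?_, hU', ?_⟩
  · have : hU.primeIdealOf ⟨x, hx⟩ ∈ hU.fromSpec ⁻¹ᵁ X.basicOpen r := by
      rw [hU.fromSpec_preimage_basicOpen r]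
      exact hr
    change hU.fromSpec (hU.primeIdealOf ⟨x, hx⟩) ∈ X.basicOpen r at this
    rwa [hU.fromSpec_primeIdealOf] at this
  · let : Algebra Γ(X, U) Γ(X, U') := (resRing hU'.le).toAlgebra
    have : IsLocalization.Away r Γ(X, U') :=
      hU.isLocalization_of_eq_basicOpen r (homOfLE hU'.le) rfl
    have := H Γ(X, U')
    rw [← S.push_res U U' hU']
    exact hasSplitBasis_span_image (isBC_smap (isBC_resMod V hV hU') S.isPoly) (S.sub U) π hπ

end Cover

/-! ### A global stable submodule of constant rank. -/

section Rank

open TensorialConstruction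

variable {X : Scheme.{u}} {V : X.Modules} {G : Over X} [GrpObj G] {ρ : LinearAction G V}

theorem exists_finite_affine_cover [TopologicalSpace.NoetherianSpace X] (p : X.affineOpens → Prop)
    (h : ∀ x : X, ∃ U : X.affineOpens, x ∈ (U : X.Opens) ∧ p U) :
    ∃ (n : ℕ) (U : Fin n → X.affineOpens), (∀ x : X, ∃ k, x ∈ (U k : X.Opens)) ∧ ∀ k, p (U k) := by
  choose U hU hp using h
  obtain ⟨s, hs⟩ := (TopologicalSpace.NoetherianSpace.isCompact (Set.univ : Set X)).elim_finite_subcover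
    (fun x ↦ ((U x : X.Opens) : Set X)) (fun x ↦ (U x : X.Opens).isOpen)
    fun x _ ↦ Set.mem_iUnion.2 ⟨x, hU x⟩
  refine ⟨s.card, fun k ↦ U (s.equivFin.symm k), fun x ↦ ?_, fun k ↦ hp _⟩
  obtain ⟨y, hy⟩ := Set.mem_iUnion.1 (hs (Set.mem_univ x))
  obtain ⟨hys, hy⟩ := Set.mem_iUnion.1 hy
  refine ⟨s.equivFin ⟨y, hys⟩, ?_⟩
  change x ∈ (U (s.equivFin.symm (s.equivFin ⟨y, hys⟩)) : X.Opens)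
  rw [Equiv.symm_apply_apply]
  exact hy

/-- Two covers are needed. The first consists of Dedekind opens with `V` free and serves to build
`T`. Only then can it be refined to opens on which `T` has a split basis, and `stab_of_trans` keeps
the stabilizer inside `G`. -/
theorem exists_adapted_cover (hX : IsDedekindScheme X) (hV : IsVectorBundle V)
    [IsAffineHom G.hom] [Flat G.hom] (hρ : ρ.IsClosedImmersion) :
    ∃ (S : StableSub ρ) (n : ℕ) (U : Fin n → X.affineOpens) (d : Fin n → ℕ),
      (∀ x : X, ∃ k, x ∈ (U k : X.Opens)) ∧
      (∀ k, Module.Free Γ(X, U k) Γ(V, U k)) ∧ (∀ k, Module.Finite Γ(X, U k) Γ(V, U k)) ∧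
      (∀ k, HasSplitBasis (S.sub (U k)) (d k)) ∧
      ∀ (k : Fin n) (R : Type u) [CommRing R] [Algebra Γ(X, U k) R] (g : GLPoints V (U k) R),
        S.Stab (U k) R g → g ∈ GPts ρ (U k) R := by
  have := hX.noetherianSpace
  have hq := hV.isQuasicoherent
  obtain ⟨m, W, hW, hD⟩ := exists_finite_affine_cover _ (exists_dedekind_free hX hV)
  have hS (i : Fin m) : ∃ S : StableSub ρ, ∀ (R : Type u) [CommRing R] [Algebra Γ(X, W i) R]
      (g : GLPoints V (W i) R), S.Stab (W i) R g → g ∈ GPts ρ (W i) R := by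
    obtain ⟨_, _, _⟩ := hD i
    exact exists_stab_le_GPts ρ hq hρ (W i)
  choose S hS using hS
  let S₀ : StableSub ρ := StableSub.ofForms ρ hq (t := var) trivial
    (J := Empty) (fun j ↦ j.elim) fun j ↦ j.elim
  obtain ⟨T, hT⟩ := StableSub.exists_stab_of_finset S₀ S Finset.univ
  obtain ⟨n, U, hU, H⟩ := exists_finite_affine_cover (fun U : X.affineOpens ↦
    Module.Free Γ(X, U) Γ(V, U) ∧ Module.Finite Γ(X, U) Γ(V, U) ∧
      (∃ d, HasSplitBasis (T.sub U) d) ∧ ∀ (R : Type u) [CommRing R] [Algebra Γ(X, U) R]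
        (g : GLPoints V U R), T.Stab U R g → g ∈ GPts ρ U R) fun x ↦ by
    obtain ⟨i, hi⟩ := hW x
    obtain ⟨_, h1, h2⟩ := hD i
    obtain ⟨U', hx, hU', hd⟩ := T.exists_hasSplitBasis hq (W i) h1 h2 hi
    obtain ⟨h3, h4⟩ := free_finite_of_isBasicIn hq hU' h1 h2
    exact ⟨U', hx, h3, h4, hd, T.stab_of_trans hU'
      (fun R _ _ g hg ↦ hS i R g (hT i (Finset.mem_univ _) _ R g hg)) hq⟩
  choose d hd using fun k ↦ (H k).2.2.1
  exact ⟨T, n, U, d, hU, fun k ↦ (H k).1, fun k ↦ (H k).2.1, hd, fun k ↦ (H k).2.2.2⟩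

theorem StableSub.hasSplitBasis_of_isBasicIn (S : StableSub ρ) (hV : V.IsQuasicoherent)
    {U' U : X.affineOpens} (h : IsBasicIn U' U) {d : ℕ} (hd : HasSplitBasis (S.sub U) d) :
    HasSplitBasis (S.sub U') d := by
  rw [← S.push_res U U' h]
  let : Algebra Γ(X, U) Γ(X, U') := (resRing h.le).toAlgebra
  exact hasSplitBasis_push (isBC_resMod V hV h) S.isPoly hd

/-- The unit form on `⋀⁰`. -/
def unitForm (V : X.Modules) (U : X.affineOpens) :
    (ext 0 var).obj (sections V U) ≃ₗ[Γ(X, U)] Γ(X, U) :=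
  exteriorPower.zeroEquiv Γ(X, U) (sections V U)

/-- The added summand is the submodule of `⋀⁰ V = 𝒪` on which the unit form over the opens of rank
`D` vanishes. It is zero on those opens. On an open of another rank it is everything, because by
uniqueness of rank the two kinds of opens have no nonempty basic open in common. -/
theorem exists_rank_succ [TopologicalSpace.NoetherianSpace X] [IsAffineHom G.hom] [Flat G.hom]
    (hV : V.IsQuasicoherent) (S : StableSub ρ) {n : ℕ} (U : Fin n → X.affineOpens) (d : Fin n → ℕ)
    (hd : ∀ k, HasSplitBasis (S.sub (U k)) (d k)) (D : ℕ) :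
    ∃ S' : StableSub ρ,
      (∀ k, HasSplitBasis (S'.sub (U k)) (if d k = D then D else d k + 1)) ∧
      ∀ (W : X.affineOpens) (R : Type u) [CommRing R] [Algebra Γ(X, W) R] (g : GLPoints V W R),
        S'.Stab W R g → S.Stab W R g := by
  have ht : (ext 0 var).IsPoly := trivial
  let c : {k : Fin n // d k = D} → X.affineOpens := fun k ↦ U k
  let l : ∀ k, Module.Dual Γ(X, c k) ((ext 0 var).obj (sections V (c k))) :=
    fun k ↦ (unitForm V (c k)).toLinearMap
  let E := StableSub.ofForms ρ hV ht c l
  refine ⟨S.prod E, fun k ↦ ?_, fun W R _ _ g hg ↦ ((S.stab_prod E W R g).1 hg).1⟩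
  split_ifs with hk
  · have hE : stableKer ρ hV ht c l (U k) = ⊥ := by
      rw [eq_bot_iff]
      intro v hv
      have h1 := hv ⟨k, hk⟩ (U k) (IsBasicIn.refl _) (IsBasicIn.refl _) Γ(X, U k) 1 (one_mem _)
      rw [evalPt_apply, smap_toFib_refl ht, smap_id _ (fun _ ↦ rfl) ht, extForm_inclBC] at h1
      exact (LinearEquiv.map_eq_zero_iff (unitForm V (U k))).1 h1
    have h1 := (hk ▸ hd k : HasSplitBasis (S.sub (U k)) D).prod_bot
      ((ext 0 var).obj (sections V (U k)))
    rw [← hE] at h1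
    exact h1
  · have hE : stableKer ρ hV ht c l (U k) = ⊤ := by
      rw [eq_top_iff]
      intro v _ j W h h' R _ _ g hg
      have hW : Subsingleton Γ(X, W) := by
        by_contra hW
        rw [not_subsingleton_iff_nontrivial] at hW
        exact hk (((S.hasSplitBasis_of_isBasicIn hV h (hd k)).rank_unique
          (S.hasSplitBasis_of_isBasicIn hV h' (hd j))).trans j.2)
      have : Subsingleton R := (algebraMap Γ(X, W) R).codomain_trivial
      exact Subsingleton.elim _ _
    have h1 := (hd k).prod_top (unitForm V (U k))
    rw [← hE] at h1
    exact h1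

/-- Induction on a bound `m` for the rank deficit, which each application of `exists_rank_succ`
lowers by one. -/
theorem exists_constant_rank [TopologicalSpace.NoetherianSpace X] [IsAffineHom G.hom] [Flat G.hom]
    (hV : V.IsQuasicoherent) {n : ℕ} (U : Fin n → X.affineOpens) (D m : ℕ) (S : StableSub ρ)
    (d : Fin n → ℕ) (hd : ∀ k, HasSplitBasis (S.sub (U k)) (d k)) (hD : ∀ k, d k ≤ D)
    (hm : ∀ k, D ≤ d k + m) :
    ∃ S' : StableSub ρ, (∀ k, HasSplitBasis (S'.sub (U k)) D) ∧
      ∀ (W : X.affineOpens) (R : Type u) [CommRing R] [Algebra Γ(X, W) R] (g : GLPoints V W R),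
        S'.Stab W R g → S.Stab W R g := by
  induction m generalizing S d with
  | zero => exact ⟨S, fun k ↦ le_antisymm (hm k) (hD k) ▸ hd k, fun W R _ _ g hg ↦ hg⟩
  | succ m ih =>
    obtain ⟨S₁, h1, h2⟩ := exists_rank_succ hV S U d hd D
    obtain ⟨S₂, h3, h4⟩ := ih S₁ _ h1 (fun k ↦ by have := hD k; split_ifs <;> omega)
      fun k ↦ by have := hm k; split_ifs <;> omega
    exact ⟨S₂, h3, fun W R _ _ g hg ↦ h2 W R g (h4 W R g hg)⟩

end Rank

/-! ### The determinant line bundle and its stabilizer. -/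

section Line

open TensorialConstruction

variable {X : Scheme.{u}} {V : X.Modules} {G : Over X} [GrpObj G] {ρ : LinearAction G V}

/-- The image of `⋀ᵈ P` in `⋀ᵈ t(M)`, as a submodule of a tensorial construction. -/
def extSub {A : Type u} [CommRing A] {M : ModuleCat.{u} A} {t : TensorialConstruction} (d : ℕ)
    (P : Submodule A (t.obj M)) : Submodule A ((ext d t).obj M) :=
  detSub d P

theorem push_extSub {A R : Type u} [CommRing A] [CommRing R] {φ : A →+* R} {M : ModuleCat.{u} A}
    {N : ModuleCat.{u} R} (σ : M →ₛₗ[φ] N) (t : TensorialConstruction) (d : ℕ)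
    (P : Submodule A (t.obj M)) : push σ (ext d t) (extSub d P) = extSub d (push σ t P) :=
  push_detSub σ t d P

theorem push_le_of_push_extSub_le {A : Type u} [CommRing A] {M : ModuleCat.{u} A}
    (h1 : Module.Free A M) (h2 : Module.Finite A M) {t : TensorialConstruction} (ht : t.IsPoly)
    {d : ℕ} {P : Submodule A (t.obj M)} (hP : HasSplitBasis P d) (g : M ≃ₗ[A] M)
    (hg : extSub d (push g.toLinearMap t P) ≤ extSub d P) : push g.toLinearMap t P ≤ P := by
  have := (free_finite_obj h1 h2 ht).1
  rw [← map_congr_eq_push g ht]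
  refine hP.map_le_of_detSub_map_le (congr g t) ?_
  rw [← push_extSub, ← map_congr_eq_push g (t := ext d t) ht] at hg
  exact hg

/-- The determinant of a stable submodule of constant rank. -/
def StableSub.det (S : StableSub ρ) (hV : V.IsQuasicoherent) (D : ℕ)
    (h : ∀ x : X, ∃ U : X.affineOpens, x ∈ (U : X.Opens) ∧ HasSplitBasis (S.sub U) D) :
    LocallySplitLineBundle V (ext D S.W) where
  sub U := extSub D (S.sub U)
  restrict U U' h f hf := by
    have hU : IsBasicIn U' U := ⟨f, hf⟩
    let : Algebra Γ(X, U) Γ(X, U') := (resRing h).toAlgebra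
    refine ⟨(isBC_resMod V hV hU).equiv, fun m ↦ one_smul _ _, ?_⟩
    have ht : (ext D S.W).IsPoly := S.isPoly
    rw [pullbackSub_eq_push ht, map_congr_eq_push (M := fiber V U Γ(X, U')) (N := sections V U') _ ht,
      push_push (M := sections V U) (N := fiber V U Γ(X, U')) (P := sections V U')
        (inclBC Γ(X, U') (sections V U)) _ (resMod V h)
        (fun m ↦ (one_smul _ _).symm) rfl ht, push_extSub, S.push_res U U' hU]
  locally_split x := by
    obtain ⟨U, hx, hU⟩ := h x
    exact ⟨U, hx, hU.detSub_equiv⟩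

theorem StableSub.map_action_det_eq_iff (S : StableSub ρ) (hV : V.IsQuasicoherent) (D : ℕ)
    (h : ∀ x : X, ∃ U : X.affineOpens, x ∈ (U : X.Opens) ∧ HasSplitBasis (S.sub U) D)
    (U : X.affineOpens) (R : Type u) [CommRing R] [Algebra Γ(X, U) R] (g : GLPoints V U R) :
    (pullbackSub R (ext D S.W) (sections V U) ((S.det hV D h).sub U)).map
        ((ext D S.W).action (fiber V U R) g).toLinearMap =
      pullbackSub R (ext D S.W) (sections V U) ((S.det hV D h).sub U) ↔
    extSub D (push g.toLinearMap S.W (pushFiber R S.W (S.sub U))) =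
      extSub D (pushFiber R S.W (S.sub U)) := by
  have ht : (ext D S.W).IsPoly := S.isPoly
  change (pullbackSub R (ext D S.W) (sections V U) (extSub D (S.sub U))).map
      (congr (M := fiber V U R) g (ext D S.W)).toLinearMap =
    pullbackSub R (ext D S.W) (sections V U) (extSub D (S.sub U)) ↔ _
  rw [pullbackSub_eq_push ht, map_congr_eq_push (M := fiber V U R) (N := fiber V U R) _ ht,
    push_extSub, push_extSub (M := fiber V U R) (N := fiber V U R)]

/-- Stability gives one inclusion for `g`; the other follows from stability under `g⁻¹`. -/
theorem StableSub.push_eq_of_mem (S : StableSub ρ) {U : X.affineOpens} {R : Type u} [CommRing R]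
    [Algebra Γ(X, U) R] {g : GLPoints V U R} (hg : g ∈ GPts ρ U R) :
    push g.toLinearMap S.W (pushFiber R S.W (S.sub U)) = pushFiber R S.W (S.sub U) := by
  refine le_antisymm (S.stable U R g hg) fun x hx ↦ ?_
  have h1 := smap_mem_push g.toLinearMap
    (S.stable U R g⁻¹ (inv_mem hg) (smap_mem_push (g⁻¹ : GLPoints V U R).toLinearMap hx))
  rwa [← smap_comp (g⁻¹ : GLPoints V U R).toLinearMap g.toLinearMap LinearMap.id
    (fun m ↦ (LinearEquiv.apply_symm_apply g m).symm) rfl S.isPoly,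
    smap_id _ (fun _ ↦ rfl) S.isPoly] at h1

theorem exists_trans_equiv (hV : V.IsQuasicoherent) {U U' : X.affineOpens} (h : IsBasicIn U' U)
    {R R' : Type u} [CommRing R] [CommRing R'] [Algebra Γ(X, U) R] [Algebra Γ(X, U') R']
    (φ : R →+* R')
    (hφ : φ.comp (algebraMap Γ(X, U) R) = (algebraMap Γ(X, U') R').comp (resRing h.le))
    (g : GLPoints V U R) :
    ∃ g' : GLPoints V U' R', ∀ v, g' (trans V h.le φ hφ v) = trans V h.le φ hφ (g v) := by
  let := φ.toAlgebra
  exact (isBC_trans V h.le φ hφ hV h).exists_equiv g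

theorem trans_hom_ext (hV : V.IsQuasicoherent) {U U' : X.affineOpens} (h : IsBasicIn U' U)
    {R R' S : Type u} [CommRing R] [CommRing R'] [CommRing S] [Algebra Γ(X, U) R]
    [Algebra Γ(X, U') R'] (φ : R →+* R')
    (hφ : φ.comp (algebraMap Γ(X, U) R) = (algebraMap Γ(X, U') R').comp (resRing h.le))
    {P : Type u} [AddCommGroup P] [Module S P] {ψ : R' →+* S} {f g : fiber V U' R' →ₛₗ[ψ] P}
    (hfg : ∀ v, f (trans V h.le φ hφ v) = g (trans V h.le φ hφ v)) : f = g := by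
  let := φ.toAlgebra
  exact (isBC_trans V h.le φ hφ hV h).hom_ext hfg

theorem trans_trans {U U' U'' : X.affineOpens} (h : U' ≤ U) (h' : U'' ≤ U') {R R' R'' : Type u}
    [CommRing R] [CommRing R'] [CommRing R''] [Algebra Γ(X, U) R] [Algebra Γ(X, U') R']
    [Algebra Γ(X, U'') R''] (φ : R →+* R')
    (hφ : φ.comp (algebraMap Γ(X, U) R) = (algebraMap Γ(X, U') R').comp (resRing h))
    (φ' : R' →+* R'')
    (hφ' : φ'.comp (algebraMap Γ(X, U') R') = (algebraMap Γ(X, U'') R'').comp (resRing h'))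
    (ψ : R →+* R'') (hψ : ψ.comp (algebraMap Γ(X, U) R) =
      (algebraMap Γ(X, U'') R'').comp (resRing (h'.trans h))) (hψφ : ψ = φ'.comp φ)
    (v : fiber V U R) :
    trans V h' φ' hφ' (trans V h φ hφ v) = trans V (h'.trans h) ψ hψ v := by
  subst hψφ
  induction v using TensorProduct.induction_on with
  | zero => rw [map_zero, map_zero, map_zero]
  | tmul r m =>
    rw [trans_tmul, trans_tmul, trans_tmul]
    exact congrArg (φ' (φ r) ⊗ₜ ·) (resMod_resMod h' h m)
  | add x y hx hy => rw [map_add, map_add, map_add, hx, hy]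

theorem trans_refl_eq_rTensor {U : X.affineOpens} {R R' : Type u} [CommRing R] [CommRing R']
    [Algebra Γ(X, U) R] [Algebra Γ(X, U) R'] (φ : R →ₐ[Γ(X, U)] R')
    (hφ : φ.toRingHom.comp (algebraMap Γ(X, U) R) =
      (algebraMap Γ(X, U) R').comp (resRing le_rfl)) (v : fiber V U R) :
    trans V le_rfl φ.toRingHom hφ v = φ.toLinearMap.rTensor Γ(V, U) v := by
  induction v using TensorProduct.induction_on with
  | zero => rw [map_zero, map_zero]
  | tmul r m =>
    rw [trans_tmul, resSections_refl]
    rfl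
  | add x y hx hy => rw [map_add, map_add, hx, hy]

theorem free_finite_baseChange {A R : Type u} [CommRing A] [CommRing R] [Algebra A R]
    {M : ModuleCat.{u} A} (h1 : Module.Free A M) (h2 : Module.Finite A M) :
    Module.Free R (ModuleCat.of R (R ⊗[A] M)) ∧ Module.Finite R (ModuleCat.of R (R ⊗[A] M)) :=
  ⟨inferInstanceAs (Module.Free R (R ⊗[A] M)), inferInstanceAs (Module.Finite R (R ⊗[A] M))⟩

namespace StableSub

theorem stab_of_extSub_le (S : StableSub ρ) {U : X.affineOpens}
    (h1 : Module.Free Γ(X, U) Γ(V, U)) (h2 : Module.Finite Γ(X, U) Γ(V, U)) {D : ℕ}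
    (hD : HasSplitBasis (S.sub U) D) {R : Type u} [CommRing R] [Algebra Γ(X, U) R]
    (g : GLPoints V U R)
    (hg : extSub D (push g.toLinearMap S.W (pushFiber R S.W (S.sub U))) ≤
      extSub D (pushFiber R S.W (S.sub U))) : S.Stab U R g := by
  obtain ⟨h3, h4⟩ := free_finite_baseChange (R := R) (M := sections V U) h1 h2
  have h5 : HasSplitBasis (pushFiber R S.W (S.sub U)) D :=
    hasSplitBasis_push (N := fiber V U R) (σ := inclBC R (sections V U)) isBC_inclBC S.isPoly hD
  exact push_le_of_push_extSub_le (M := fiber V U R) h3 h4 S.isPoly h5 g hg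

theorem extSub_le_of_trans (S : StableSub ρ) {U U' : X.affineOpens} (h : IsBasicIn U' U) (D : ℕ)
    {R R' : Type u} [CommRing R] [CommRing R'] [Algebra Γ(X, U) R] [Algebra Γ(X, U') R']
    (φ : R →+* R')
    (hφ : φ.comp (algebraMap Γ(X, U) R) = (algebraMap Γ(X, U') R').comp (resRing h.le))
    (g : GLPoints V U R) (g' : GLPoints V U' R')
    (hgg' : ∀ v, g' (trans V h.le φ hφ v) = trans V h.le φ hφ (g v))
    (hg : extSub D (push g.toLinearMap S.W (pushFiber R S.W (S.sub U))) ≤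
      extSub D (pushFiber R S.W (S.sub U))) :
    extSub D (push g'.toLinearMap S.W (pushFiber R' S.W (S.sub U'))) ≤
      extSub D (pushFiber R' S.W (S.sub U')) := by
  have h1 := push_trans_equiv S.isPoly h.le φ hφ g g' (fun v ↦ (hgg' v).symm)
    (pushFiber R S.W (S.sub U))
  have h2 := S.push_trans h φ hφ
  have h3 : push (trans V h.le φ hφ) (ext D S.W) _ ≤ push (trans V h.le φ hφ) (ext D S.W) _ :=
    Submodule.span_mono (Set.image_mono hg)
  rw [push_extSub, push_extSub, ← h1, h2] at h3
  exact h3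

/-- The pullbacks of `g` to `R'` over `U` and over `U'` correspond under the identification of
fibers, so membership in `G` passes between them. -/
theorem mem_GPts_of_trans_trans (hV : V.IsQuasicoherent) {U U' : X.affineOpens}
    (h : IsBasicIn U' U) {R R' : Type u} [CommRing R] [CommRing R'] [Algebra Γ(X, U) R]
    [Algebra Γ(X, U) R'] [Algebra Γ(X, U') R'] (φ : R →+* R')
    (hφ : φ.comp (algebraMap Γ(X, U) R) = (algebraMap Γ(X, U') R').comp (resRing h.le))
    (hφ' : φ.comp (algebraMap Γ(X, U) R) = (algebraMap Γ(X, U) R').comp (resRing le_rfl))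
    (hR : (RingHom.id R').comp (algebraMap Γ(X, U) R') =
      (algebraMap Γ(X, U') R').comp (resRing h.le))
    (g : GLPoints V U R) (g₁ : GLPoints V U' R') (g₂ : GLPoints V U R')
    (hg₁ : ∀ v, g₁ (trans V h.le φ hφ v) = trans V h.le φ hφ (g v))
    (hg₂ : ∀ v, g₂ (trans V le_rfl φ hφ' v) = trans V le_rfl φ hφ' (g v))
    (hmem : g₁ ∈ GPts ρ U' R') : g₂ ∈ GPts ρ U R' := by
  refine mem_GPts_of_mem_GPts ρ hV h hR g₁ hmem fun v ↦ ?_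
  suffices h : (trans V h.le (RingHom.id R') hR).comp g₂.toLinearMap =
      g₁.toLinearMap.comp (trans V h.le (RingHom.id R') hR) from LinearMap.congr_fun h v
  refine trans_hom_ext hV (IsBasicIn.refl U) φ hφ' fun v ↦ ?_
  change trans V h.le (RingHom.id R') hR (g₂ (trans V le_rfl φ hφ' v)) =
    g₁ (trans V h.le (RingHom.id R') hR (trans V le_rfl φ hφ' v))
  rw [hg₂, trans_trans le_rfl h.le φ hφ' (RingHom.id R') hR φ hφ rfl,
    trans_trans le_rfl h.le φ hφ' (RingHom.id R') hR φ hφ rfl, hg₁]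

end StableSub

/-- On an arbitrary `U` the submodule need not have a split basis, so the line need not determine it
directly. Closedness measures the failure of `g` to lie in `G` by an ideal `I` of `R`, which
vanishes if it does so locally. Near each prime, `g` moves to a basic open of some `W k`, where the
line determines the submodule and the stabilizer lies in `G`. -/
theorem StableSub.mem_GPts_of_extSub_le (S : StableSub ρ) (hV : V.IsQuasicoherent)
    (hρ : ρ.IsClosedImmersion) (D : ℕ) {n : ℕ} (W : Fin n → X.affineOpens)
    (hW : ∀ x : X, ∃ k, x ∈ (W k : X.Opens)) (h1 : ∀ k, Module.Free Γ(X, W k) Γ(V, W k))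
    (h2 : ∀ k, Module.Finite Γ(X, W k) Γ(V, W k)) (hD : ∀ k, HasSplitBasis (S.sub (W k)) D)
    (hS : ∀ (k : Fin n) (R : Type u) [CommRing R] [Algebra Γ(X, W k) R] (g : GLPoints V (W k) R),
      S.Stab (W k) R g → g ∈ GPts ρ (W k) R)
    (U : X.affineOpens) (R : Type u) [CommRing R] [Algebra Γ(X, U) R] (g : GLPoints V U R)
    (hg : extSub D (push g.toLinearMap S.W (pushFiber R S.W (S.sub U))) ≤
      extSub D (pushFiber R S.W (S.sub U))) : g ∈ GPts ρ U R := by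
  obtain ⟨I, hI⟩ := hρ.closed U R g
  -- For the identity of `R`, membership of `g` amounts to `I = 0`.
  refine (hI R (AlgHom.id _ _) g fun v ↦ ?_).2 fun a ha ↦ ?_
  · rw [AlgHom.toLinearMap_id, LinearMap.rTensor_id]
    rfl
  refine eq_zero_of_forall_prime _ fun p hp ↦ ?_
  obtain ⟨x, hx, H⟩ := exists_localization U R p
  obtain ⟨k, hk⟩ := hW x
  obtain ⟨E, hEU, hEW, f, hf, _, hxE, hc⟩ := H (W k) hk
  refine ⟨f, hf, ?_⟩
  let φ : R →ₐ[Γ(X, U)] Localization.Away f := IsScalarTower.toAlgHom _ _ _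
  let R' := Localization.Away f
  obtain ⟨g₁, hg₁⟩ := exists_trans_equiv hV hEU φ.toRingHom hc g
  obtain ⟨h3, h4⟩ := free_finite_of_isBasicIn hV hEW (h1 k) (h2 k)
  have hstab : S.Stab E R' g₁ :=
    S.stab_of_extSub_le h3 h4 (S.hasSplitBasis_of_isBasicIn hV hEW (hD k)) g₁
      (S.extSub_le_of_trans hEU D φ.toRingHom hc g g₁ hg₁ hg)
  have hmem := S.stab_of_trans hEW (hS k) hV R' g₁ hstab
  have hc' : φ.toRingHom.comp (algebraMap Γ(X, U) R) =
      (algebraMap Γ(X, U) R').comp (resRing le_rfl) := by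
    rw [resRing_refl]
    exact φ.comp_algebraMap
  obtain ⟨g₂, hg₂⟩ := exists_trans_equiv hV (IsBasicIn.refl U) φ.toRingHom hc' g
  have hR' : (RingHom.id R').comp (algebraMap Γ(X, U) R') =
      (algebraMap Γ(X, E) R').comp (resRing hEU.le) := by
    rw [← hc]
    exact φ.comp_algebraMap.symm
  have hmem₂ : g₂ ∈ GPts ρ U R' :=
    mem_GPts_of_trans_trans hV hEU φ.toRingHom hc hc' hR' g g₁ g₂ hg₁ hg₂ hmem
  refine (hI R' φ g₂ fun v ↦ ?_).1 hmem₂ a ha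
  rw [← trans_refl_eq_rTensor φ hc', ← trans_refl_eq_rTensor φ hc', hg₂]

theorem exists_lineBundle_stabilizer (hX : IsDedekindScheme X) (hV : IsVectorBundle V)
    [IsAffineHom G.hom] [Flat G.hom] (hρ : ρ.IsClosedImmersion) :
    ∃ (t : TensorialConstruction) (L : LocallySplitLineBundle V t),
      ∀ (U : X.affineOpens) (R : Type u) [CommRing R] [Algebra Γ(X, U) R] (g : GLPoints V U R),
        g ∈ (ρ.hom U R).range ↔
          (pullbackSub R t (sections V U) (L.sub U)).map
              (t.action (fiber V U R) g).toLinearMap =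
            pullbackSub R t (sections V U) (L.sub U) := by
  have := hX.noetherianSpace
  have hq := hV.isQuasicoherent
  obtain ⟨S₀, n, W, d, hW, h1, h2, hd, hS₀⟩ := exists_adapted_cover hX hV hρ
  obtain ⟨D, hD⟩ := (Set.finite_range d).bddAbove
  -- `D` bounds all the ranks, so it also bounds the deficits and can start the induction.
  obtain ⟨S, hS, hSS₀⟩ := exists_constant_rank hq W D D S₀ d hd (fun k ↦ hD ⟨k, rfl⟩)
    fun k ↦ Nat.le_add_left D (d k)
  have h (x : X) : ∃ U : X.affineOpens, x ∈ (U : X.Opens) ∧ HasSplitBasis (S.sub U) D := by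
    obtain ⟨k, hk⟩ := hW x
    exact ⟨W k, hk, hS k⟩
  refine ⟨ext D S.W, S.det hq D h, fun U R _ _ g ↦ ?_⟩
  rw [S.map_action_det_eq_iff hq D h]
  refine ⟨fun hg ↦ ?_, fun hg ↦ ?_⟩
  · rw [S.push_eq_of_mem hg]
  · exact S.mem_GPts_of_extSub_le hq hρ D W hW h1 h2 hS
      (fun k R _ _ g hg ↦ hS₀ k R g (hSS₀ _ R g hg)) U R g hg.le

end Line

end TensorialStabilizer

end

open TensorialStabilizer in
theorem theorem3 {X : Scheme.{u}} (hX : IsDedekindScheme X)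
    (G : Over X) [GrpObj G] [IsAffineHom G.hom] [LocallyOfFiniteType G.hom] [Flat G.hom]
    (V : X.Modules) (hV : IsVectorBundle V)
    (ρ : LinearAction G V) (hρ : ρ.IsClosedImmersion) :
    ∃ (t : TensorialConstruction) (L : LocallySplitLineBundle V t),
      ∀ (U : X.affineOpens) (R : Type u) [CommRing R] [Algebra Γ(X, U) R] (g : GLPoints V U R),
        g ∈ (ρ.hom U R).range ↔
          (pullbackSub R t (sections V U) (L.sub U)).map
              (t.action (fiber V U R) g).toLinearMap =
            pullbackSub R t (sections V U) (L.sub U) :=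
  exists_lineBundle_stabilizer hX hV hρ
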